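/- **Definitions.** For $A\in\mathbb{R}^{n\times n}$ and a permutation $\pi$ of $[n]$, let $A^\pi$ be the matrix with entries $(A^\pi)_{ij}=A_{\pi(i)\pi(j)}$, and let $\|M\|_F=\sqrt{\sum_{i,j}M_{ij}^2}$. The problem MSim asks, for symmetric $A,B\in\mathbb{R}^{n\times n}$, for $\min_{\pi\in S_n}\|A^\pi-B\|_F$. A symmetric matrix $B$ of rank $r$ has a spectral decomposition $B=V\Gamma V^T$, where $\Gamma$ is the $r\times r$ diagonal matrix of the nonzero eigenvalues of $B$ and $V\in\mathbb{R}^{n\times r}$ has corresponding orthonormal eigenvectors as columns. The *clustering number* of $B$ is the number of distinct rows of $V$; it does not depend on the decomposition. **Machine model and cost.** Algorithms are random access machine programs with variables and arrays for natural numbers and for elements of an ordered field $K$, with the arithmetic operations of natural numbers and of fields, comparisons, conditionals and while-loops. Every elementary operation is charged one plus the size of the value it produces, where natural numbers are measured by bit length. Elements of $K$ are measured (a) for $K=\mathbb{Q}$, by the bit length of numerator and denominator in lowest terms; (b) for $K=\mathbb{R}$, by $0$ (unit-cost exact field arithmetic). The size $L$ of an instance $(A,B)$ is one plus the sum, over all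 entries of $A$ and $B$, of one plus the size of the entry. **Theorem.** There are an algorithm and constants $C,c,d\in\mathbb{N}$ such that the following holds, both for rational inputs with cost measure (a) and for real inputs with cost measure (b). For all $n,k,p$ and all symmetric positive semidefinite $n\times n$ matrices $A,B$ with $\operatorname{rank}(A),\operatorname{rank}(B)\le k$ such that $B$ has clustering number $p$, the algorithm, given $n$, $A$ and $B$, halts at a cost of at most $$C\cdot n^{c\,k\,p^2}\cdot L^{d},$$ (with $0^0=1$) and outputs a permutation $\pi$ that minimizes $\|A^\pi-B\|_F$ over $S_n$, together with the exact value of $\min_{\sigma\in S_n}\|A^\sigma-B\|_F^2$. In other words, MSim restricted to positive semidefinite matrices can be solved in time $O^*(n^{O(kp^2)})$, where $O^*$ hides factors polynomial in the size of the input representation. -/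

import Mathlib

/-! ### The mathematical problem -/

namespace MatSim

/-- `M = U * diag(ev) * Uᵀ` where the columns of `U` are orthonormal eigenvectors of `M` for all its
nonzero eigenvalues `ev 0, …, ev (r - 1)`, listed with multiplicity (so `r` is the rank of `M`). -/
structure IsSpectralDecomposition {n r : ℕ} (M : Matrix (Fin n) (Fin n) ℝ)
    (U : Matrix (Fin n) (Fin r) ℝ) (ev : Fin r → ℝ) : Prop where
  orthonormal : U.transpose * U = 1
  ev_ne_zero : ∀ q, ev q ≠ 0
  eq_mul : M = U * Matrix.diagonal ev * U.transpose

/-- `p` is the clustering number of the symmetric matrix `M`: the number of distinct rows of the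
eigenvector matrix of a spectral decomposition of `M`. (The number does not depend on the choice of
the decomposition.) -/
def IsClusteringNumber {n : ℕ} (M : Matrix (Fin n) (Fin n) ℝ) (p : ℕ) : Prop :=
  ∃ (r : ℕ) (U : Matrix (Fin n) (Fin r) ℝ) (ev : Fin r → ℝ),
    IsSpectralDecomposition M U ev ∧ (Set.range fun i : Fin n => U i).ncard = p

open scoped Matrix.Norms.Frobenius in
/-- The objective `‖A^π - B‖_F`, where `A^π` has the entry `A (π i) (π j)` at position `(i, j)`, and
the norm is the Frobenius norm. -/
noncomputable def frobDist {n : ℕ} (A B : Matrix (Fin n) (Fin n) ℝ) (π : Equiv.Perm (Fin n)) : ℝ :=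
  ‖A.submatrix π π - B‖

/-! ### The machine model

A random access machine with a finite structured program. It has memory for natural numbers and
memory for elements of an ordered field `K`; each consists of scalar variables and of arrays that
are addressed by computed natural numbers. The program itself does not depend on `K`. -/

/-- A memory state. Variables and arrays are named by natural numbers. -/
structure Store (K : Type) where
  natVar : ℕ → ℕ
  natArr : ℕ → ℕ → ℕ
  fldVar : ℕ → K
  fldArr : ℕ → ℕ → K

inductive NatOp : Type
  | add
  | sub
  | mul
  | div
  | mod

def NatOp.apply : NatOp → ℕ → ℕ → ℕ
  | .add, a, b => a + b
  | .sub, a, b => a - b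
  | .mul, a, b => a * b
  | .div, a, b => a / b
  | .mod, a, b => a % b

inductive FldOp : Type
  | add
  | sub
  | mul
  | div

def FldOp.apply {K : Type} [Field K] : FldOp → K → K → K
  | .add, a, b => a + b
  | .sub, a, b => a - b
  | .mul, a, b => a * b
  | .div, a, b => a / b

/-- Expressions with values in `ℕ`; `get a e` reads the array `a` at the address `e`. -/
inductive NatExpr : Type
  | const (c : ℕ)
  | var (x : ℕ)
  | get (a : ℕ) (e : NatExpr)
  | op (o : NatOp) (e f : NatExpr)

/-- Expressions with values in `K`; `get a e` reads the array `a` at the address `e`. -/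
inductive FldExpr : Type
  | ofNat (e : NatExpr)
  | var (x : ℕ)
  | get (a : ℕ) (e : NatExpr)
  | op (o : FldOp) (e f : FldExpr)

/-- Tests. -/
inductive Test : Type
  | natLe (e f : NatExpr)
  | fldLe (e f : FldExpr)
  | neg (b : Test)
  | and (b c : Test)

/-- Programs; `natPut a i e` and `fldPut a i e` write the value of `e` to the array `a` at the
address `i`. -/
inductive Prog : Type
  | skip
  | natSet (x : ℕ) (e : NatExpr)
  | natPut (a : ℕ) (i e : NatExpr)
  | fldSet (x : ℕ) (e : FldExpr)
  | fldPut (a : ℕ) (i : NatExpr) (e : FldExpr)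
  | seq (P Q : Prog)
  | ite (b : Test) (P Q : Prog)
  | loop (b : Test) (P : Prog)

def NatExpr.eval {K : Type} (s : Store K) : NatExpr → ℕ
  | .const c => c
  | .var x => s.natVar x
  | .get a e => s.natArr a (e.eval s)
  | .op o e f => o.apply (e.eval s) (f.eval s)

def FldExpr.eval {K : Type} [Field K] (s : Store K) : FldExpr → K
  | .ofNat e => (e.eval s : K)
  | .var x => s.fldVar x
  | .get a e => s.fldArr a (e.eval s)
  | .op o e f => o.apply (e.eval s) (f.eval s)

def Test.eval {K : Type} [Field K] [LinearOrder K] (s : Store K) : Test → Bool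
  | .natLe e f => decide (e.eval s ≤ f.eval s)
  | .fldLe e f => decide (e.eval s ≤ f.eval s)
  | .neg b => !(b.eval s)
  | .and b c => b.eval s && c.eval s

/-- The cost of evaluating an expression: every node costs one plus the bit length of its value. -/
def NatExpr.cost {K : Type} (s : Store K) : NatExpr → ℕ
  | .const c => 1 + c.size
  | .var x => 1 + (s.natVar x).size
  | .get a e => e.cost s + 1 + (s.natArr a (e.eval s)).size
  | .op o e f => e.cost s + f.cost s + 1 + (o.apply (e.eval s) (f.eval s)).size

/-- The cost of evaluating an expression: every node costs one plus the size of its value, where the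
size of elements of `K` is measured by `w`. -/
def FldExpr.cost {K : Type} [Field K] (w : K → ℕ) (s : Store K) : FldExpr → ℕ
  | .ofNat e => e.cost s + 1 + w (e.eval s : K)
  | .var x => 1 + w (s.fldVar x)
  | .get a e => e.cost s + 1 + w (s.fldArr a (e.eval s))
  | .op o e f => e.cost w s + f.cost w s + 1 + w (o.apply (e.eval s) (f.eval s))

def Test.cost {K : Type} [Field K] (w : K → ℕ) (s : Store K) : Test → ℕ
  | .natLe e f => e.cost s + f.cost s + 1
  | .fldLe e f => e.cost w s + f.cost w s + 1
  | .neg b => b.cost w s + 1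
  | .and b c => b.cost w s + c.cost w s + 1

/-- `Exec w P s t s'`: started in the memory state `s`, the program `P` halts in the state `s'`, and
the run has total cost `t`, with the elements of `K` measured by `w`. -/
inductive Exec {K : Type} [Field K] [LinearOrder K] (w : K → ℕ) :
    Prog → Store K → ℕ → Store K → Prop
  | skip (s : Store K) : Exec w .skip s 1 s
  | natSet (x : ℕ) (e : NatExpr) (s : Store K) :
      Exec w (.natSet x e) s (e.cost s + 1)
        { s with natVar := Function.update s.natVar x (e.eval s) }
  | natPut (a : ℕ) (i e : NatExpr) (s : Store K) :
      Exec w (.natPut a i e) s (i.cost s + e.cost s + 1)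
        { s with natArr := Function.update s.natArr a
                    (Function.update (s.natArr a) (i.eval s) (e.eval s)) }
  | fldSet (x : ℕ) (e : FldExpr) (s : Store K) :
      Exec w (.fldSet x e) s (e.cost w s + 1)
        { s with fldVar := Function.update s.fldVar x (e.eval s) }
  | fldPut (a : ℕ) (i : NatExpr) (e : FldExpr) (s : Store K) :
      Exec w (.fldPut a i e) s (i.cost s + e.cost w s + 1)
        { s with fldArr := Function.update s.fldArr a
                    (Function.update (s.fldArr a) (i.eval s) (e.eval s)) }
  | seq {P Q : Prog} {s₀ s₁ s₂ : Store K} {t₁ t₂ : ℕ} :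
      Exec w P s₀ t₁ s₁ → Exec w Q s₁ t₂ s₂ → Exec w (.seq P Q) s₀ (t₁ + t₂) s₂
  | ite_true {b : Test} {P Q : Prog} {s s' : Store K} {t : ℕ} :
      b.eval s = true → Exec w P s t s' → Exec w (.ite b P Q) s (b.cost w s + 1 + t) s'
  | ite_false {b : Test} {P Q : Prog} {s s' : Store K} {t : ℕ} :
      b.eval s = false → Exec w Q s t s' → Exec w (.ite b P Q) s (b.cost w s + 1 + t) s'
  | loop_done {b : Test} {P : Prog} {s : Store K} :
      b.eval s = false → Exec w (.loop b P) s (b.cost w s + 1) s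
  | loop_step {b : Test} {P : Prog} {s₀ s₁ s₂ : Store K} {t₁ t₂ : ℕ} :
      b.eval s₀ = true → Exec w P s₀ t₁ s₁ → Exec w (.loop b P) s₁ t₂ s₂ →
        Exec w (.loop b P) s₀ (b.cost w s₀ + 1 + t₁ + t₂) s₂

/-- Bit length of a rational number: the bits of the numerator and of the denominator in lowest
terms. -/
def ratBits (q : ℚ) : ℕ := q.num.natAbs.size + q.den.size

/-! ### Algorithms for the problem -/

/-- The entries of a matrix row by row, followed by zeros. -/
def rowMajor {K : Type} [Field K] {n : ℕ} (M : Matrix (Fin n) (Fin n) K) (a : ℕ) : K :=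
  if h : a / n < n ∧ a % n < n then M ⟨a / n, h.1⟩ ⟨a % n, h.2⟩ else 0

/-- The initial memory for the instance `(A, B)`: the natural variable `0` holds the order `n`, the
field arrays `0` and `1` hold the matrices row by row, everything else is zero. -/
def inputStore {K : Type} [Field K] {n : ℕ} (A B : Matrix (Fin n) (Fin n) K) : Store K where
  natVar := fun x => if x = 0 then n else 0
  natArr := fun _ _ => 0
  fldVar := fun _ => 0
  fldArr := fun m a => if m = 0 then rowMajor A a else if m = 1 then rowMajor B a else 0

/-- The size of the representation of the instance `(A, B)`: one plus the sum, over all entries of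
both matrices, of one plus the size of the entry. -/
def inputSize {K : Type} (w : K → ℕ) {n : ℕ} (A B : Matrix (Fin n) (Fin n) K) : ℕ :=
  1 + ∑ i, ∑ j, (1 + w (A i j)) + ∑ i, ∑ j, (1 + w (B i j))

/-- The final memory state `s` holds a solution of the instance `(A, B)`: the natural array `0`
lists the values of a permutation `π` that minimizes the objective, and the field variable `0` holds
the square of the minimum (the minimum itself need not be in `K`). -/
def HoldsSolution {K : Type} [Field K] (ι : K →+* ℝ) {n : ℕ}
    (A B : Matrix (Fin n) (Fin n) K) (s : Store K) : Prop :=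
  ∃ π : Equiv.Perm (Fin n), (∀ i : Fin n, s.natArr 0 i = π i) ∧
    (∀ σ : Equiv.Perm (Fin n), frobDist (A.map ι) (B.map ι) π ≤ frobDist (A.map ι) (B.map ι) σ) ∧
    ι (s.fldVar 0) = frobDist (A.map ι) (B.map ι) π ^ 2

/-- For all symmetric positive semidefinite `n × n` matrices `A`, `B` over the subfield `K` of `ℝ`
with ranks at most `k`, where `B` has clustering number `p`, the program `P` halts with a solution of
the instance `(A, B)`, at a cost of at most `T n k p L`, where `L` is the size of the instance. -/
def SolvesPSDWithin {K : Type} [Field K] [LinearOrder K] (ι : K →+* ℝ) (w : K → ℕ) (P : Prog)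
    (T : ℕ → ℕ → ℕ → ℕ → ℕ) : Prop :=
  ∀ (n k p : ℕ) (A B : Matrix (Fin n) (Fin n) K),
    (A.map ι).PosSemidef → (B.map ι).PosSemidef → (A.map ι).rank ≤ k → (B.map ι).rank ≤ k →
    IsClusteringNumber (B.map ι) p →
    ∃ (t : ℕ) (s : Store K), Exec w P (inputStore A B) t s ∧
      t ≤ T n k p (inputSize w A B) ∧ HoldsSolution ι A B s

end MatSim

set_option linter.unusedSectionVars false

namespace MatSim

/-! ### Memory updates -/

namespace Store

variable {K : Type}

/-! Expanding the squares, the objective of π is a constant minus 2⟨π,π⟩, where ⟨σ,π⟩ is the form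
`cross` (`objPerm_eq_cross`). Since A and B are positive semidefinite, this form is a sum of
products ℓ(π)ℓ(σ), so 2⟨σ,π⟩ ≤ ⟨σ,σ⟩ + ⟨π,π⟩ (`two_mul_cross_le`). Hence if σ is optimal, every π
that maximizes the linear function ⟨σ,·⟩ is optimal too. A linear function of a permutation can be
studied by transpositions: at a maximizer π, with ties broken by a second linear function, the rows
of A that π assigns to one cluster of B lie strictly on one side of those assigned to another
cluster, in the lexicographic order of a linear functional and the row index
(`exists_sorted_optimum`). After each row of A is extended by a 1 and by its index, this becomes
strict separation by a hyperplane through the origin, in a space of dimension at most k + 2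
(`exists_separation`, `rk_extRows_le`).

So only labellings of the rows whose classes are pairwise linearly separable need to be tried. Such
a labelling has a short description. Flip the signs of one class; the vectors then lie in an open
half space, and the cone they generate has an extreme ray (`exists_extreme`). Eliminate with a row
on this ray: rows parallel to it become zero and are classified by the sign of their coefficient,
the others remain separated, and the rank drops by one. Thus rank many pivots separate two classes
(`exists_labels`). A tournament over all pairs of clusters then produces the whole labelling with at
most rank · p · p instructions, each from a list of polynomial length (`exists_tournament`).

The algorithm enumerates all sequences of instructions, computes the labels, matches labels with
clusters greedily and keeps the best permutation. A correct labelling leaves no relevant choice to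
the greedy matching, because B does not change when indices within a cluster are permuted
(`labels_eq`, `exists_goodCandidate`).

For the cost, the programs are verified with total-correctness triples `Tri`, which carry a bound on
all values in memory. A pivot multiplies the heights of the entries by at most 5, so they grow by a
factor exponential in the number of instructions, which is of the same kind as the number of
candidates; `growth_le` absorbs both into a power of n with exponent O(k p²). -/

def setN (s : Store K) (x v : ℕ) : Store K :=
  { s with natVar := Function.update s.natVar x v }

def setNA (s : Store K) (a i v : ℕ) : Store K :=
  { s with natArr := Function.update s.natArr a (Function.update (s.natArr a) i v) }

def setF (s : Store K) (x : ℕ) (v : K) : Store K :=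
  { s with fldVar := Function.update s.fldVar x v }

def setFA (s : Store K) (a i : ℕ) (v : K) : Store K :=
  { s with fldArr := Function.update s.fldArr a (Function.update (s.fldArr a) i v) }

variable (s : Store K) (x a i v : ℕ) (z : K)

theorem natVar_setN (y : ℕ) : (s.setN x v).natVar y = if y = x then v else s.natVar y := by
  simp [setN, Function.update_apply]
@[simp] theorem natArr_setN : (s.setN x v).natArr = s.natArr := rfl
@[simp] theorem fldVar_setN : (s.setN x v).fldVar = s.fldVar := rfl
@[simp] theorem fldArr_setN : (s.setN x v).fldArr = s.fldArr := rfl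

@[simp] theorem natVar_setNA : (s.setNA a i v).natVar = s.natVar := rfl
theorem natArr_setNA (b j : ℕ) :
    (s.setNA a i v).natArr b j = if b = a ∧ j = i then v else s.natArr b j := by
  by_cases hb : b = a
  · subst hb; simp [setNA, Function.update_apply]
  · simp [setNA, hb]
@[simp] theorem fldVar_setNA : (s.setNA a i v).fldVar = s.fldVar := rfl
@[simp] theorem fldArr_setNA : (s.setNA a i v).fldArr = s.fldArr := rfl

@[simp] theorem natVar_setF : (s.setF x z).natVar = s.natVar := rfl
@[simp] theorem natArr_setF : (s.setF x z).natArr = s.natArr := rfl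
theorem fldVar_setF (y : ℕ) : (s.setF x z).fldVar y = if y = x then z else s.fldVar y := by
  simp [setF, Function.update_apply]
@[simp] theorem fldArr_setF : (s.setF x z).fldArr = s.fldArr := rfl

@[simp] theorem natVar_setFA : (s.setFA a i z).natVar = s.natVar := rfl
@[simp] theorem natArr_setFA : (s.setFA a i z).natArr = s.natArr := rfl
@[simp] theorem fldVar_setFA : (s.setFA a i z).fldVar = s.fldVar := rfl
theorem fldArr_setFA (b j : ℕ) :
    (s.setFA a i z).fldArr b j = if b = a ∧ j = i then z else s.fldArr b j := by
  by_cases hb : b = a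
  · subst hb; simp [setFA, Function.update_apply]
  · simp [setFA, hb]

end Store

/-! ### Size measures -/

/-- A height function `h` that is additive up to constants and equivalent to the measure `w`. -/
structure IsHeight {K : Type} [Field K] (w h : K → ℕ) : Prop where
  le_two_mul : ∀ x, w x ≤ 2 * h x
  le_size : ∀ x, h x ≤ w x
  add_le : ∀ x y, h (x + y) ≤ h x + h y + 1
  sub_le : ∀ x y, h (x - y) ≤ h x + h y + 1
  mul_le : ∀ x y, h (x * y) ≤ h x + h y
  div_le : ∀ x y, h (x / y) ≤ h x + h y
  natCast_le : ∀ n : ℕ, h (n : K) ≤ n.size + 1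

theorem size_le_self (n : ℕ) : n.size ≤ n := Nat.size_le.2 n.lt_two_pow_self

theorem size_add_le (m n : ℕ) : (m + n).size ≤ m.size + n.size + 1 := by
  rw [Nat.size_le]
  have hm := Nat.lt_size_self m
  have hn := Nat.lt_size_self n
  have h1 : 2 ^ m.size ≤ 2 ^ (m.size + n.size) := Nat.pow_le_pow_right (by simp) (by simp)
  have h2 : 2 ^ n.size ≤ 2 ^ (m.size + n.size) := Nat.pow_le_pow_right (by simp) (by simp)
  rw [pow_succ]
  omega

theorem size_mul_le (m n : ℕ) : (m * n).size ≤ m.size + n.size := by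
  rw [Nat.size_le, pow_add]
  exact Nat.mul_lt_mul'' (Nat.lt_size_self m) (Nat.lt_size_self n)

theorem isHeight_zero : IsHeight (fun _ : ℝ => 0) (fun _ => 0) := by
  constructor <;> simp

/-- Taking the maximum instead of the sum of the two bit lengths makes sums cost only one extra bit
and products none, while staying within a factor 2 of `ratBits`. -/
def ratHeight (q : ℚ) : ℕ := (max q.num.natAbs q.den).size

theorem natAbs_lt_two_pow (q : ℚ) : q.num.natAbs < 2 ^ ratHeight q :=
  lt_of_le_of_lt (le_max_left _ _) (Nat.lt_size_self _)

theorem den_lt_two_pow (q : ℚ) : q.den < 2 ^ ratHeight q :=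
  lt_of_le_of_lt (le_max_right _ _) (Nat.lt_size_self _)

theorem ratHeight_le {q : ℚ} {m : ℕ} (h1 : q.num.natAbs < 2 ^ m) (h2 : q.den < 2 ^ m) :
    ratHeight q ≤ m := Nat.size_le.2 (max_lt h1 h2)

/-- Reduction to lowest terms only shrinks numerator and denominator, so any representation as a
fraction bounds the height. -/
theorem ratHeight_div_le {a b : ℤ} {m : ℕ} (hb : b ≠ 0) (h1 : a.natAbs < 2 ^ m)
    (h2 : b.natAbs < 2 ^ m) : ratHeight (a / b : ℚ) ≤ m := by
  rw [← Rat.divInt_eq_div]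
  refine ratHeight_le ?_ ?_
  · by_cases ha : a = 0
    · subst ha; simp
    · exact lt_of_le_of_lt (Nat.le_of_dvd (Int.natAbs_pos.2 ha)
        (Int.natAbs_dvd_natAbs.2 (Rat.num_dvd a hb))) h1
  · have := Int.natAbs_dvd_natAbs.2 (Rat.den_dvd a b)
    exact lt_of_le_of_lt (Nat.le_of_dvd (Int.natAbs_pos.2 hb) (by simpa using this)) h2

theorem ratHeight_add_le (x y : ℚ) : ratHeight (x + y) ≤ ratHeight x + ratHeight y + 1 := by
  have hx : (x.den : ℚ) ≠ 0 := by exact_mod_cast x.den_nz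
  have hy : (y.den : ℚ) ≠ 0 := by exact_mod_cast y.den_nz
  have e : x + y = ((x.num * y.den + y.num * x.den : ℤ) : ℚ) / ((x.den * y.den : ℤ) : ℚ) := by
    push_cast
    conv_lhs => rw [← Rat.num_div_den x, ← Rat.num_div_den y]
    field_simp
  have h1 := Nat.mul_lt_mul'' (natAbs_lt_two_pow x) (den_lt_two_pow y)
  have h2 := Nat.mul_lt_mul'' (natAbs_lt_two_pow y) (den_lt_two_pow x)
  have h3 := Nat.mul_lt_mul'' (den_lt_two_pow x) (den_lt_two_pow y)
  rw [e]
  refine ratHeight_div_le (by exact_mod_cast mul_ne_zero x.den_nz y.den_nz) ?_ ?_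
  · refine lt_of_le_of_lt (Int.natAbs_add_le _ _) ?_
    rw [Int.natAbs_mul, Int.natAbs_mul, Int.natAbs_natCast, Int.natAbs_natCast, pow_succ, pow_add]
    rw [mul_comm (2 ^ ratHeight y)] at h2
    omega
  · rw [Int.natAbs_mul, Int.natAbs_natCast, Int.natAbs_natCast, pow_succ, pow_add]
    omega

theorem ratHeight_neg (x : ℚ) : ratHeight (-x) = ratHeight x := by simp [ratHeight]

theorem ratHeight_mul_le (x y : ℚ) : ratHeight (x * y) ≤ ratHeight x + ratHeight y := by
  have e : x * y = ((x.num * y.num : ℤ) : ℚ) / ((x.den * y.den : ℤ) : ℚ) := by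
    push_cast
    conv_lhs => rw [← Rat.num_div_den x, ← Rat.num_div_den y]
    rw [div_mul_div_comm]
  have h1 := Nat.mul_lt_mul'' (natAbs_lt_two_pow x) (natAbs_lt_two_pow y)
  have h3 := Nat.mul_lt_mul'' (den_lt_two_pow x) (den_lt_two_pow y)
  rw [e]
  refine ratHeight_div_le (by exact_mod_cast mul_ne_zero x.den_nz y.den_nz) ?_ ?_
  · rwa [Int.natAbs_mul, pow_add]
  · rwa [Int.natAbs_mul, Int.natAbs_natCast, Int.natAbs_natCast, pow_add]

theorem ratHeight_inv_le (x : ℚ) : ratHeight x⁻¹ ≤ ratHeight x := by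
  by_cases hx : x = 0
  · subst hx; simp
  have e : x⁻¹ = ((x.den : ℤ) : ℚ) / (x.num : ℚ) := by
    conv_lhs => rw [← Rat.num_div_den x]
    rw [inv_div]; simp
  rw [e]
  exact ratHeight_div_le (Rat.num_ne_zero.2 hx) (by simpa using den_lt_two_pow x)
    (natAbs_lt_two_pow x)

theorem isHeight_ratBits : IsHeight ratBits ratHeight where
  le_two_mul x := by
    have h1 := Nat.size_le_size (le_max_left x.num.natAbs x.den)
    have h2 := Nat.size_le_size (le_max_right x.num.natAbs x.den)
    unfold ratBits ratHeight; omega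
  le_size x := by
    unfold ratBits ratHeight
    rcases max_choice x.num.natAbs x.den with h | h <;> rw [h] <;> omega
  add_le := ratHeight_add_le
  sub_le x y := by
    rw [sub_eq_add_neg, ← ratHeight_neg y]; exact ratHeight_add_le _ _
  mul_le := ratHeight_mul_le
  div_le x y := by
    rw [div_eq_mul_inv]
    exact (ratHeight_mul_le _ _).trans (Nat.add_le_add_left (ratHeight_inv_le y) _)
  natCast_le n := by
    refine ratHeight_le ?_ ?_
    · simpa using n.lt_size_self.trans (Nat.pow_lt_pow_right (by simp) (by simp))
    · simp

/-! ### Costs of expressions in bounded states -/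

/-- A size measure, a height function, a bound for natural numbers and a bound for heights. -/
structure Bounds (K : Type) where
  w : K → ℕ
  h : K → ℕ
  X : ℕ
  F : ℕ

/-- The unit in which costs are measured. -/
def Bounds.U {K : Type} (c : Bounds K) : ℕ := c.X + c.F + 1

/-- All values in the memory respect the bounds. -/
structure Bdd {K : Type} (c : Bounds K) (s : Store K) : Prop where
  natVar : ∀ x, s.natVar x ≤ c.X
  natArr : ∀ a i, s.natArr a i ≤ c.X
  fldVar : ∀ x, c.h (s.fldVar x) ≤ c.F
  fldArr : ∀ a i, c.h (s.fldArr a i) ≤ c.F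

theorem Bounds.one_le_U {K : Type} (c : Bounds K) : 1 ≤ c.U := by simp [Bounds.U]

/-- Heights and weights depend on the syntax alone. They bound sizes and costs in multiples of the
unit `Bounds.U`, which also covers intermediate values that exceed the memory bounds. -/
def NatExpr.height : NatExpr → ℕ
  | .const k => k.size
  | .var _ => 1
  | .get _ _ => 1
  | .op _ e f => e.height + f.height + 1

def NatExpr.weight : NatExpr → ℕ
  | .const k => 1 + k.size
  | .var _ => 2
  | .get _ e => e.weight + 2
  | .op o e f => e.weight + f.weight + 1 + (NatExpr.op o e f).height

def FldExpr.height : FldExpr → ℕ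
  | .ofNat e => e.height + 1
  | .var _ => 1
  | .get _ _ => 1
  | .op _ e f => e.height + f.height + 1

def FldExpr.weight : FldExpr → ℕ
  | .ofNat e => e.weight + 1 + 2 * e.height + 2
  | .var _ => 3
  | .get _ e => e.weight + 3
  | .op o e f => e.weight + f.weight + 1 + 2 * (FldExpr.op o e f).height

def Test.weight : Test → ℕ
  | .natLe e f => e.weight + f.weight + 1
  | .fldLe e f => e.weight + f.weight + 1
  | .neg b => b.weight + 1
  | .and b c => b.weight + c.weight + 1

/-- A loop counts its body once; the number of iterations enters through the second factor in `Tri`.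
-/
def Prog.weight : Prog → ℕ
  | .skip => 1
  | .natSet _ e => e.weight + 1
  | .natPut _ i e => i.weight + e.weight + 1
  | .fldSet _ e => e.weight + 1
  | .fldPut _ i e => i.weight + e.weight + 1
  | .seq P Q => P.weight + Q.weight
  | .ite b P Q => b.weight + 1 + P.weight + Q.weight
  | .loop b P => b.weight + 1 + P.weight

section Costs

variable {K : Type} [Field K] {c : Bounds K} {s : Store K}

theorem size_apply_le (o : NatOp) (a b : ℕ) : (o.apply a b).size ≤ a.size + b.size + 1 := by
  cases o
  · exact size_add_le a b
  · exact (Nat.size_le_size (Nat.sub_le a b)).trans (by omega)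
  · exact (size_mul_le a b).trans (by omega)
  · exact (Nat.size_le_size (Nat.div_le_self a b)).trans (by omega)
  · exact (Nat.size_le_size (Nat.mod_le a b)).trans (by omega)

theorem height_apply_le (hh : IsHeight c.w c.h) (o : FldOp) (a b : K) :
    c.h (o.apply a b) ≤ c.h a + c.h b + 1 := by
  cases o
  · exact hh.add_le a b
  · exact hh.sub_le a b
  · exact (hh.mul_le a b).trans (by omega)
  · exact (hh.div_le a b).trans (by omega)

theorem NatExpr.size_eval_le (hB : Bdd c s) (e : NatExpr) :
    (e.eval s).size ≤ e.height * c.U := by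
  have hU := c.one_le_U
  have hX : c.X ≤ c.U := by unfold Bounds.U; omega
  induction e with
  | const k => exact Nat.le_mul_of_pos_right _ hU
  | var x =>
    have := (size_le_self _).trans (hB.natVar x)
    simp only [NatExpr.eval, NatExpr.height]; omega
  | get a e _ =>
    have := (size_le_self _).trans (hB.natArr a (e.eval s))
    simp only [NatExpr.eval, NatExpr.height]; omega
  | op o e f he hf =>
    have := size_apply_le o (e.eval s) (f.eval s)
    simp only [NatExpr.eval, NatExpr.height, add_mul, one_mul]; omega

/-- The size of a stored number is estimated by the number itself rather than by its logarithm. This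
wastes a factor comparable to the number of candidates, which only doubles the final exponent. -/
theorem NatExpr.cost_le (hB : Bdd c s) (e : NatExpr) : e.cost s ≤ e.weight * c.U := by
  have hU := c.one_le_U
  have hX : c.X ≤ c.U := by unfold Bounds.U; omega
  induction e with
  | const k =>
    have := Nat.le_mul_of_pos_right k.size hU
    simp only [NatExpr.cost, NatExpr.weight, add_mul, one_mul]; omega
  | var x =>
    have := (size_le_self _).trans (hB.natVar x)
    simp only [NatExpr.cost, NatExpr.weight]; omega
  | get a e he =>
    have := (size_le_self _).trans (hB.natArr a (e.eval s))
    simp only [NatExpr.cost, NatExpr.weight, add_mul]; omega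
  | op o e f he hf =>
    have := NatExpr.size_eval_le hB (.op o e f)
    simp only [NatExpr.eval] at this
    simp only [NatExpr.cost, NatExpr.weight, add_mul, one_mul]; omega

theorem FldExpr.height_eval_le (hh : IsHeight c.w c.h) (hB : Bdd c s) (e : FldExpr) :
    c.h (e.eval s) ≤ e.height * c.U := by
  have hU := c.one_le_U
  have hF : c.F ≤ c.U := by unfold Bounds.U; omega
  induction e with
  | ofNat e =>
    have h1 := hh.natCast_le (e.eval s)
    have h2 := e.size_eval_le hB
    simp only [FldExpr.eval, FldExpr.height, add_mul, one_mul]; omega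
  | var x =>
    have := hB.fldVar x
    simp only [FldExpr.eval, FldExpr.height]; omega
  | get a e =>
    have := hB.fldArr a (e.eval s)
    simp only [FldExpr.eval, FldExpr.height]; omega
  | op o e f he hf =>
    have := height_apply_le hh o (e.eval s) (f.eval s)
    simp only [FldExpr.eval, FldExpr.height, add_mul, one_mul]; omega

theorem FldExpr.cost_le (hh : IsHeight c.w c.h) (hB : Bdd c s) (e : FldExpr) :
    e.cost c.w s ≤ e.weight * c.U := by
  have hU := c.one_le_U
  have hF : c.F ≤ c.U := by unfold Bounds.U; omega
  induction e with
  | ofNat e =>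
    have h0 := hh.le_two_mul (e.eval s : K)
    have h1 := hh.natCast_le (e.eval s)
    have h2 := e.size_eval_le hB
    have h3 := e.cost_le hB
    simp only [FldExpr.cost, FldExpr.weight, add_mul, one_mul, mul_assoc]; omega
  | var x =>
    have h0 := hh.le_two_mul (s.fldVar x)
    have := hB.fldVar x
    have : 2 * c.F + 1 ≤ 3 * c.U := by unfold Bounds.U; omega
    simp only [FldExpr.cost, FldExpr.weight]; omega
  | get a e =>
    have h0 := hh.le_two_mul (s.fldArr a (e.eval s))
    have := hB.fldArr a (e.eval s)
    have h3 := e.cost_le hB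
    have : 2 * c.F + 1 ≤ 3 * c.U := by unfold Bounds.U; omega
    simp only [FldExpr.cost, FldExpr.weight, add_mul]; omega
  | op o e f he hf =>
    have h0 := hh.le_two_mul (o.apply (e.eval s) (f.eval s))
    have h1 := FldExpr.height_eval_le hh hB (.op o e f)
    simp only [FldExpr.eval] at h1
    simp only [FldExpr.cost, FldExpr.weight, add_mul, one_mul, mul_assoc]; omega

theorem Test.cost_le (hh : IsHeight c.w c.h) (hB : Bdd c s) (b : Test) :
    b.cost c.w s ≤ b.weight * c.U := by
  have hU := c.one_le_U
  induction b with
  | natLe e f =>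
    have h1 := e.cost_le hB
    have h2 := f.cost_le hB
    simp only [Test.cost, Test.weight, add_mul, one_mul]; omega
  | fldLe e f =>
    have h1 := e.cost_le hh hB
    have h2 := f.cost_le hh hB
    simp only [Test.cost, Test.weight, add_mul, one_mul]; omega
  | neg b hb => simp only [Test.cost, Test.weight, add_mul, one_mul]; omega
  | and b b' h1 h2 => simp only [Test.cost, Test.weight, add_mul, one_mul]; omega

end Costs

section Updates

variable {K : Type} {c : Bounds K} {s : Store K}

theorem Bdd.setN (hB : Bdd c s) {x v : ℕ} (hv : v ≤ c.X) : Bdd c (s.setN x v) where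
  natVar y := by rw [Store.natVar_setN]; split_ifs; exacts [hv, hB.natVar y]
  natArr := hB.natArr
  fldVar := hB.fldVar
  fldArr := hB.fldArr

theorem Bdd.setNA (hB : Bdd c s) {a i v : ℕ} (hv : v ≤ c.X) : Bdd c (s.setNA a i v) where
  natVar := hB.natVar
  natArr b j := by rw [Store.natArr_setNA]; split_ifs; exacts [hv, hB.natArr b j]
  fldVar := hB.fldVar
  fldArr := hB.fldArr

theorem Bdd.setF (hB : Bdd c s) {x : ℕ} {v : K} (hv : c.h v ≤ c.F) : Bdd c (s.setF x v) where
  natVar := hB.natVar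
  natArr := hB.natArr
  fldVar y := by rw [Store.fldVar_setF]; split_ifs; exacts [hv, hB.fldVar y]
  fldArr := hB.fldArr

theorem Bdd.setFA (hB : Bdd c s) {a i : ℕ} {v : K} (hv : c.h v ≤ c.F) :
    Bdd c (s.setFA a i v) where
  natVar := hB.natVar
  natArr := hB.natArr
  fldVar := hB.fldVar
  fldArr b j := by rw [Store.fldArr_setFA]; split_ifs; exacts [hv, hB.fldArr b j]

end Updates

/-! ### Frames -/

/-- The natural variables a program may change; similarly for the other parts of the memory. -/
def Prog.natVars : Prog → List ℕ
  | .natSet x _ => [x]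
  | .seq P Q => P.natVars ++ Q.natVars
  | .ite _ P Q => P.natVars ++ Q.natVars
  | .loop _ P => P.natVars
  | _ => []

def Prog.natArrs : Prog → List ℕ
  | .natPut a _ _ => [a]
  | .seq P Q => P.natArrs ++ Q.natArrs
  | .ite _ P Q => P.natArrs ++ Q.natArrs
  | .loop _ P => P.natArrs
  | _ => []

def Prog.fldVars : Prog → List ℕ
  | .fldSet x _ => [x]
  | .seq P Q => P.fldVars ++ Q.fldVars
  | .ite _ P Q => P.fldVars ++ Q.fldVars
  | .loop _ P => P.fldVars
  | _ => []

def Prog.fldArrs : Prog → List ℕ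
  | .fldPut a _ _ => [a]
  | .seq P Q => P.fldArrs ++ Q.fldArrs
  | .ite _ P Q => P.fldArrs ++ Q.fldArrs
  | .loop _ P => P.fldArrs
  | _ => []

/-- The two states agree wherever the program does not write. -/
structure Agree {K : Type} (P : Prog) (s s' : Store K) : Prop where
  natVar : ∀ x, x ∉ P.natVars → s'.natVar x = s.natVar x
  natArr : ∀ a, a ∉ P.natArrs → s'.natArr a = s.natArr a
  fldVar : ∀ x, x ∉ P.fldVars → s'.fldVar x = s.fldVar x
  fldArr : ∀ a, a ∉ P.fldArrs → s'.fldArr a = s.fldArr a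

theorem Agree.refl {K : Type} (P : Prog) (s : Store K) : Agree P s s :=
  ⟨fun _ _ => rfl, fun _ _ => rfl, fun _ _ => rfl, fun _ _ => rfl⟩

theorem Agree.trans {K : Type} {P : Prog} {s s' s'' : Store K} (h : Agree P s s')
    (h' : Agree P s' s'') : Agree P s s'' :=
  ⟨fun x hx => (h'.natVar x hx).trans (h.natVar x hx),
   fun x hx => (h'.natArr x hx).trans (h.natArr x hx),
   fun x hx => (h'.fldVar x hx).trans (h.fldVar x hx),
   fun x hx => (h'.fldArr x hx).trans (h.fldArr x hx)⟩

theorem Agree.mono {K : Type} {P Q : Prog} {s s' : Store K} (h : Agree P s s')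
    (h1 : P.natVars ⊆ Q.natVars) (h2 : P.natArrs ⊆ Q.natArrs) (h3 : P.fldVars ⊆ Q.fldVars)
    (h4 : P.fldArrs ⊆ Q.fldArrs) : Agree Q s s' :=
  ⟨fun x hx => h.natVar x (fun h' => hx (h1 h')), fun x hx => h.natArr x (fun h' => hx (h2 h')),
   fun x hx => h.fldVar x (fun h' => hx (h3 h')), fun x hx => h.fldArr x (fun h' => hx (h4 h'))⟩

section Triples

variable {K : Type} [Field K] [LinearOrder K]

/-- The frame is read off the syntax, so for a concrete program the preservation of a variable is a
decidable list membership. -/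
theorem Exec.agree {w : K → ℕ} {P : Prog} {s s' : Store K} {t : ℕ} (h : Exec w P s t s') :
    Agree P s s' := by
  induction h with
  | skip s => exact Agree.refl _ _
  | natSet x e s =>
    refine ⟨fun y hy => ?_, fun _ _ => rfl, fun _ _ => rfl, fun _ _ => rfl⟩
    exact Function.update_of_ne (by simpa [Prog.natVars] using hy) _ _
  | natPut a i e s =>
    refine ⟨fun _ _ => rfl, fun y hy => ?_, fun _ _ => rfl, fun _ _ => rfl⟩
    exact Function.update_of_ne (by simpa [Prog.natArrs] using hy) _ _
  | fldSet x e s =>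
    refine ⟨fun _ _ => rfl, fun _ _ => rfl, fun y hy => ?_, fun _ _ => rfl⟩
    exact Function.update_of_ne (by simpa [Prog.fldVars] using hy) _ _
  | fldPut a i e s =>
    refine ⟨fun _ _ => rfl, fun _ _ => rfl, fun _ _ => rfl, fun y hy => ?_⟩
    exact Function.update_of_ne (by simpa [Prog.fldArrs] using hy) _ _
  | seq _ _ h1 h2 =>
    refine Agree.trans (h1.mono ?_ ?_ ?_ ?_) (h2.mono ?_ ?_ ?_ ?_) <;>
      simp [Prog.natVars, Prog.natArrs, Prog.fldVars, Prog.fldArrs]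
  | ite_true _ _ h1 =>
    refine h1.mono ?_ ?_ ?_ ?_ <;>
      simp [Prog.natVars, Prog.natArrs, Prog.fldVars, Prog.fldArrs]
  | ite_false _ _ h1 =>
    refine h1.mono ?_ ?_ ?_ ?_ <;>
      simp [Prog.natVars, Prog.natArrs, Prog.fldVars, Prog.fldArrs]
  | loop_done _ => exact Agree.refl _ _
  | loop_step _ _ _ h1 h2 =>
    refine Agree.trans (h1.mono ?_ ?_ ?_ ?_) h2 <;>
      simp [Prog.natVars, Prog.natArrs, Prog.fldVars, Prog.fldArrs]

/-! ### Triples -/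

/-- Started in `s`, the program halts in a state that satisfies `Q` and respects the bounds; the
cost is at most the weight of the program times `Z`. -/
def Tri (c : Bounds K) (P : Prog) (s : Store K) (Z : ℕ) (Q : Store K → Prop) : Prop :=
  ∃ t s', Exec c.w P s t s' ∧ t ≤ P.weight * Z ∧ Bdd c s' ∧ Q s'

variable {c : Bounds K} {s : Store K} {Z : ℕ} {Q : Store K → Prop} {P : Prog}

theorem Tri.mono {Z' : ℕ} {Q' : Store K → Prop} (h : Tri c P s Z Q) (hZ : Z ≤ Z')
    (hQ : ∀ s', Bdd c s' → Agree P s s' → Q s' → Q' s') : Tri c P s Z' Q' := by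
  obtain ⟨t, s', h1, h2, h3, h4⟩ := h
  exact ⟨t, s', h1, h2.trans (Nat.mul_le_mul_left _ hZ), h3, hQ s' h3 h1.agree h4⟩

theorem Tri.skip (hB : Bdd c s) (hZ : 1 ≤ Z) (hQ : Q s) : Tri c .skip s Z Q :=
  ⟨1, s, .skip s, by simpa [Prog.weight] using hZ, hB, hQ⟩

theorem Tri.natSet {x : ℕ} {e : NatExpr} (hB : Bdd c s) (hZ : c.U ≤ Z) (v : ℕ)
    (hv : e.eval s = v) (hX : v ≤ c.X) (hQ : Q (s.setN x v)) : Tri c (.natSet x e) s Z Q := by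
  refine ⟨_, _, .natSet x e s, ?_, ?_, ?_⟩
  · have h1 := e.cost_le hB
    have h2 := c.one_le_U
    refine le_trans ?_ (Nat.mul_le_mul_left _ hZ)
    simp only [Prog.weight, add_mul, one_mul]; omega
  · rw [hv]; exact hB.setN hX
  · rw [hv]; exact hQ

theorem Tri.natPut {a : ℕ} {i e : NatExpr} (hB : Bdd c s) (hZ : c.U ≤ Z) (j v : ℕ)
    (hi : i.eval s = j) (hv : e.eval s = v) (hX : v ≤ c.X) (hQ : Q (s.setNA a j v)) :
    Tri c (.natPut a i e) s Z Q := by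
  refine ⟨_, _, .natPut a i e s, ?_, ?_, ?_⟩
  · have h1 := e.cost_le hB
    have h3 := i.cost_le hB
    have h2 := c.one_le_U
    refine le_trans ?_ (Nat.mul_le_mul_left _ hZ)
    simp only [Prog.weight, add_mul, one_mul]; omega
  · rw [hv, hi]; exact hB.setNA hX
  · rw [hv, hi]; exact hQ

theorem Tri.fldSet (hh : IsHeight c.w c.h) {x : ℕ} {e : FldExpr} (hB : Bdd c s) (hZ : c.U ≤ Z)
    (v : K) (hv : e.eval s = v) (hX : c.h v ≤ c.F) (hQ : Q (s.setF x v)) :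
    Tri c (.fldSet x e) s Z Q := by
  refine ⟨_, _, .fldSet x e s, ?_, ?_, ?_⟩
  · have h1 := e.cost_le hh hB
    have h2 := c.one_le_U
    refine le_trans ?_ (Nat.mul_le_mul_left _ hZ)
    simp only [Prog.weight, add_mul, one_mul]; omega
  · rw [hv]; exact hB.setF hX
  · rw [hv]; exact hQ

theorem Tri.fldPut (hh : IsHeight c.w c.h) {a : ℕ} {i : NatExpr} {e : FldExpr} (hB : Bdd c s)
    (hZ : c.U ≤ Z) (j : ℕ) (v : K) (hi : i.eval s = j) (hv : e.eval s = v) (hX : c.h v ≤ c.F)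
    (hQ : Q (s.setFA a j v)) : Tri c (.fldPut a i e) s Z Q := by
  refine ⟨_, _, .fldPut a i e s, ?_, ?_, ?_⟩
  · have h1 := e.cost_le hh hB
    have h3 := i.cost_le hB
    have h2 := c.one_le_U
    refine le_trans ?_ (Nat.mul_le_mul_left _ hZ)
    simp only [Prog.weight, add_mul, one_mul]; omega
  · rw [hv, hi]; exact hB.setFA hX
  · rw [hv, hi]; exact hQ

/-- Weights add under composition, so both parts can share the factor `Z`; shorter parts are first
relaxed to the common `Z` by `Tri.mono`. -/
theorem Tri.seq {P' : Prog} {R : Store K → Prop} (h : Tri c P s Z R)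
    (h' : ∀ s', Bdd c s' → Agree P s s' → R s' → Tri c P' s' Z Q) : Tri c (.seq P P') s Z Q := by
  obtain ⟨t, s', h1, h2, h3, h4⟩ := h
  obtain ⟨t', s'', h1', h2', h3', h4'⟩ := h' s' h3 h1.agree h4
  exact ⟨_, _, .seq h1 h1', by simp only [Prog.weight, add_mul]; omega, h3', h4'⟩

theorem Tri.ite (hh : IsHeight c.w c.h) {b : Test} {P' : Prog} (hB : Bdd c s) (hZ : c.U ≤ Z)
    (h : b.eval s = true → Tri c P s Z Q) (h' : b.eval s = false → Tri c P' s Z Q) :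
    Tri c (.ite b P P') s Z Q := by
  have h1 := (b.cost_le hh hB).trans (Nat.mul_le_mul_left _ hZ)
  have h2 := c.one_le_U.trans hZ
  cases hb : b.eval s with
  | true =>
    obtain ⟨t, s', h3, h4, h5, h6⟩ := h hb
    exact ⟨_, s', .ite_true hb h3, by simp only [Prog.weight, add_mul, one_mul]; omega, h5, h6⟩
  | false =>
    obtain ⟨t, s', h3, h4, h5, h6⟩ := h' hb
    exact ⟨_, s', .ite_false hb h3, by simp only [Prog.weight, add_mul, one_mul]; omega, h5, h6⟩

/-- `for x in [0, y) do P`, where `x` and `y` are variables. -/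
def Prog.forTo (x y : ℕ) (P : Prog) : Prog :=
  .seq (.natSet x (.const 0))
    (.loop (.neg (.natLe (.var y) (.var x)))
      (.seq P (.natSet x (.op .add (.var x) (.const 1)))))

/-- The factor is N + 1 because the test is evaluated once more than the body. The invariant is
required after the increment, hence the `setN` in the postcondition of the step. -/
theorem Tri.forTo (hh : IsHeight c.w c.h) {x y N : ℕ} (I : ℕ → Store K → Prop) (hB : Bdd c s)
    (hN : s.natVar y = N) (hZ : c.U ≤ Z) (hx : x ∉ P.natVars) (hy : y ∉ P.natVars) (hxy : y ≠ x)
    (h0 : I 0 (s.setN x 0))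
    (hstep : ∀ i < N, ∀ s', Bdd c s' → s'.natVar x = i → Agree (Prog.forTo x y P) s s' →
      I i s' → Tri c P s' Z fun s'' => I (i + 1) (s''.setN x (i + 1))) :
    Tri c (Prog.forTo x y P) s ((N + 1) * Z) fun s' => I N s' := by
  set b : Test := .neg (.natLe (.var y) (.var x)) with hb
  set inc : Prog := .natSet x (.op .add (.var x) (.const 1)) with hinc
  have hy' : y ∉ (Prog.forTo x y P).natVars := by
    simp [Prog.forTo, Prog.natVars, hy, hxy]
  -- Induction on the number m of remaining iterations.
  have key : ∀ m i, i + m = N → ∀ s', Bdd c s' → s'.natVar x = i →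
      Agree (Prog.forTo x y P) s s' → I i s' →
      ∃ t s'', Exec c.w (.loop b (.seq P inc)) s' t s'' ∧
        t ≤ m * ((b.weight + 1 + P.weight + inc.weight) * Z) + (b.weight + 1) * Z ∧
        Bdd c s'' ∧ I N s'' := by
    intro m
    induction m with
    | zero =>
      intro i hi s' hB' hx' hA hI
      have hyN := (hA.natVar y hy').trans hN
      have h1 := (b.cost_le hh hB').trans (Nat.mul_le_mul_left _ hZ)
      have h2 := c.one_le_U.trans hZ
      refine ⟨_, s', .loop_done ?_, ?_, hB', ?_⟩
      · simp [hb, Test.eval, NatExpr.eval, hyN, hx', ← hi]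
      · simp only [add_mul, one_mul]; omega
      · rwa [← hi]
    | succ m ih =>
      intro i hi s' hB' hx' hA hI
      have hyN := (hA.natVar y hy').trans hN
      have h1 := (b.cost_le hh hB').trans (Nat.mul_le_mul_left _ hZ)
      have h2 := c.one_le_U.trans hZ
      obtain ⟨t1, s1, e1, c1, B1, I1⟩ := hstep i (by omega) s' hB' hx' hA hI
      have hx1 : s1.natVar x = i := (e1.agree.natVar x hx).trans hx'
      have hNX : N ≤ c.X := hN ▸ hB.natVar y
      obtain ⟨t2, s2, e2, c2, B2, I2⟩ : Tri c inc s1 Z fun s2 => s2 = s1.setN x (i + 1) :=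
        Tri.natSet B1 hZ (i + 1) (by simp [NatExpr.eval, NatOp.apply, hx1]) (by omega) rfl
      have hA1 : Agree (Prog.forTo x y P) s1 s2 := by
        refine e2.agree.mono ?_ ?_ ?_ ?_ <;>
          simp [hinc, Prog.forTo, Prog.natVars, Prog.natArrs, Prog.fldVars, Prog.fldArrs]
      have hA0 : Agree (Prog.forTo x y P) s' s1 := by
        refine e1.agree.mono ?_ ?_ ?_ ?_ <;>
          simp [Prog.forTo, Prog.natVars, Prog.natArrs, Prog.fldVars, Prog.fldArrs]
      obtain ⟨t3, s3, e3, c3, B3, I3⟩ := ih (i + 1) (by omega) s2 B2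
        (by rw [I2, Store.natVar_setN, if_pos rfl]) ((hA.trans hA0).trans hA1) (I2 ▸ I1)
      refine ⟨_, s3, .loop_step ?_ (.seq e1 e2) e3, ?_, B3, I3⟩
      · simp [hb, Test.eval, NatExpr.eval, hyN, hx']; omega
      · rw [add_mul m 1, one_mul]
        simp only [add_mul, one_mul] at c3 ⊢
        omega
  obtain ⟨t0, s0, e0, c0, B0, I0⟩ :
      Tri c (.natSet x (.const 0)) s Z fun s0 => s0 = s.setN x 0 :=
    Tri.natSet hB hZ 0 (by simp [NatExpr.eval]) (by omega) rfl
  have hA0 : Agree (Prog.forTo x y P) s s0 := by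
    refine e0.agree.mono ?_ ?_ ?_ ?_ <;>
      simp [Prog.forTo, Prog.natVars, Prog.natArrs, Prog.fldVars, Prog.fldArrs]
  obtain ⟨t1, s1, e1, c1, B1, I1⟩ := key N 0 (by omega) s0 B0
    (by rw [I0, Store.natVar_setN, if_pos rfl]) hA0 (I0 ▸ h0)
  refine ⟨_, s1, .seq e0 e1, ?_, B1, I1⟩
  have hw : (Prog.forTo x y P).weight =
      (Prog.natSet x (.const 0)).weight + (b.weight + 1 + P.weight + inc.weight) := by
    simp only [Prog.forTo, Prog.weight, hinc, hb]; ring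
  rw [hw]
  have h3 : (b.weight + 1) * Z ≤ (b.weight + 1 + P.weight + inc.weight) * Z :=
    Nat.mul_le_mul_right _ (by omega)
  have h4 : (Prog.natSet x (.const 0)).weight * Z ≤
      (N + 1) * ((Prog.natSet x (.const 0)).weight * Z) := Nat.le_mul_of_pos_left _ (by omega)
  calc t0 + t1 ≤ (N + 1) * ((Prog.natSet x (.const 0)).weight * Z) +
        (N + 1) * ((b.weight + 1 + P.weight + inc.weight) * Z) := by
        rw [add_mul N 1 ((b.weight + 1 + P.weight + inc.weight) * Z)]; omega
    _ = _ := by ring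

end Triples

/-! ### Notation for programs -/

instance : Add NatExpr := ⟨.op .add⟩
instance : Sub NatExpr := ⟨.op .sub⟩
instance : Mul NatExpr := ⟨.op .mul⟩
instance : Div NatExpr := ⟨.op .div⟩
instance : Mod NatExpr := ⟨.op .mod⟩
instance : Add FldExpr := ⟨.op .add⟩
instance : Sub FldExpr := ⟨.op .sub⟩
instance : Mul FldExpr := ⟨.op .mul⟩
instance : Div FldExpr := ⟨.op .div⟩

infixr:60 " ⨟ " => Prog.seq

def Test.natLt (e f : NatExpr) : Test := .neg (.natLe f e)

def Test.natEq (e f : NatExpr) : Test := .and (.natLe e f) (.natLe f e)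

def Test.or (b b' : Test) : Test := .neg (.and (.neg b) (.neg b'))

section Eval

variable {K : Type} (s : Store K)

@[simp] theorem NatExpr.eval_const (k : ℕ) : (NatExpr.const k).eval s = k := rfl
@[simp] theorem NatExpr.eval_var (k : ℕ) : (NatExpr.var k).eval s = s.natVar k := rfl
@[simp] theorem NatExpr.eval_get (a : ℕ) (e : NatExpr) :
    (NatExpr.get a e).eval s = s.natArr a (e.eval s) := rfl
@[simp] theorem NatExpr.eval_add (e f : NatExpr) : (e + f).eval s = e.eval s + f.eval s := rfl
@[simp] theorem NatExpr.eval_sub (e f : NatExpr) : (e - f).eval s = e.eval s - f.eval s := rfl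
@[simp] theorem NatExpr.eval_mul (e f : NatExpr) : (e * f).eval s = e.eval s * f.eval s := rfl
@[simp] theorem NatExpr.eval_div (e f : NatExpr) : (e / f).eval s = e.eval s / f.eval s := rfl
@[simp] theorem NatExpr.eval_mod (e f : NatExpr) : (e % f).eval s = e.eval s % f.eval s := rfl

variable [Field K]

@[simp] theorem FldExpr.eval_ofNat (e : NatExpr) : (FldExpr.ofNat e).eval s = (e.eval s : K) := rfl
@[simp] theorem FldExpr.eval_var (k : ℕ) : (FldExpr.var k).eval s = s.fldVar k := rfl
@[simp] theorem FldExpr.eval_get (a : ℕ) (e : NatExpr) :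
    (FldExpr.get a e).eval s = s.fldArr a (e.eval s) := rfl
@[simp] theorem FldExpr.eval_add (e f : FldExpr) : (e + f).eval s = e.eval s + f.eval s := rfl
@[simp] theorem FldExpr.eval_sub (e f : FldExpr) : (e - f).eval s = e.eval s - f.eval s := rfl
@[simp] theorem FldExpr.eval_mul (e f : FldExpr) : (e * f).eval s = e.eval s * f.eval s := rfl
@[simp] theorem FldExpr.eval_div (e f : FldExpr) : (e / f).eval s = e.eval s / f.eval s := rfl

variable [LinearOrder K]

@[simp] theorem Test.eval_natLe (e f : NatExpr) :
    (Test.natLe e f).eval s = decide (e.eval s ≤ f.eval s) := rfl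
@[simp] theorem Test.eval_fldLe (e f : FldExpr) :
    (Test.fldLe e f).eval s = decide (e.eval s ≤ f.eval s) := rfl
@[simp] theorem Test.eval_neg (b : Test) : b.neg.eval s = !(b.eval s) := rfl
@[simp] theorem Test.eval_and (b b' : Test) :
    (b.and b').eval s = (b.eval s && b'.eval s) := rfl
@[simp] theorem Test.eval_natLt (e f : NatExpr) :
    (Test.natLt e f).eval s = decide (e.eval s < f.eval s) := by
  rw [Test.natLt, Test.eval_neg, Test.eval_natLe, ← decide_not]; simp only [not_le]
@[simp] theorem Test.eval_natEq (e f : NatExpr) :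
    (Test.natEq e f).eval s = decide (e.eval s = f.eval s) := by
  simp [Test.natEq, le_antisymm_iff]
@[simp] theorem Test.eval_or (b b' : Test) :
    (b.or b').eval s = (b.eval s || b'.eval s) := by
  simp [Test.or]

end Eval

attribute [simp] Store.natVar_setN Store.natArr_setNA Store.fldVar_setF Store.fldArr_setFA

/-! ### The elimination step -/

/-- Subtract multiples of the row `j₀` so that the column `x` vanishes. -/
def pivot {K : Type} [Field K] (R : ℕ → ℕ → K) (j₀ x : ℕ) : ℕ → ℕ → K :=
  fun j y => R j y - R j x / R j₀ x * R j₀ y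

/-- A label `c` or `r` is replaced according to the sign of `m`. -/
def relabel {K : Type} [Field K] [LinearOrder K] (q c r : ℕ) (m : K) : ℕ :=
  if q = c ∨ q = r then (if 0 < m then c else if m < 0 then r else q) else q

/-- The natural variables: `0` the order `n`, `1` the number `w` of columns of the working matrix,
`2` the number `n * w`, `3` a counter, `4` the offset of the source matrix, `5` the offset of the
target, `6` the offset of the source labels, `7` and `8` the two labels, `9` and `10` the row and
the column of the pivot, `11` a label. The field array `2` holds the working matrices, the natural
array `1` the labels. -/
def stepBody : Prog :=
  .fldSet 1 (.get 2 (.var 4 + (.var 3 / .var 1 * .var 1 + .var 10)) /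
    .get 2 (.var 4 + (.var 9 * .var 1 + .var 10))) ⨟
  .fldPut 2 (.var 5 + .var 3) (.get 2 (.var 4 + .var 3) -
    .var 1 * .get 2 (.var 4 + (.var 9 * .var 1 + .var 3 % .var 1))) ⨟
  .natSet 11 (.get 1 (.var 6 + .var 3)) ⨟
  .ite (.or (.natEq (.var 11) (.var 7)) (.natEq (.var 11) (.var 8)))
    (.ite (.neg (.fldLe (.var 1) (.ofNat (.const 0)))) (.natPut 1 (.var 5 + .var 3) (.var 7))
      (.ite (.neg (.fldLe (.ofNat (.const 0)) (.var 1))) (.natPut 1 (.var 5 + .var 3) (.var 8))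
        (.natPut 1 (.var 5 + .var 3) (.var 11))))
    (.natPut 1 (.var 5 + .var 3) (.var 11))

def step : Prog := .forTo 3 2 stepBody

section Step

variable {K : Type} [Field K] [LinearOrder K]

/-- The working matrix `R` with `n` rows and `w` columns is stored at the offset `o`. -/
def HoldsRows (n w o : ℕ) (R : ℕ → ℕ → K) (s : Store K) : Prop :=
  ∀ j < n, ∀ y < w, s.fldArr 2 (o + (j * w + y)) = R j y

/-- The labels are stored at the offset `o`, each of them `w` times. -/
def HoldsLabels (n w o : ℕ) (q : ℕ → ℕ) (s : Store K) : Prop :=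
  ∀ j < n, ∀ y < w, s.natArr 1 (o + (j * w + y)) = q j

theorem relabel_cases (q c r : ℕ) (m : K) :
    relabel q c r m = q ∨ relabel q c r m = c ∨ relabel q c r m = r := by
  unfold relabel; split_ifs <;> simp

theorem step_spec {c : Bounds K} (hh : IsHeight c.w c.h) {s : Store K} (hB : Bdd c s)
    {n w src dst lsrc p r j₀ x f : ℕ} {R : ℕ → ℕ → K} {q : ℕ → ℕ}
    (h1 : s.natVar 1 = w) (h2 : s.natVar 2 = n * w) (h4 : s.natVar 4 = src)
    (h5 : s.natVar 5 = dst) (h6 : s.natVar 6 = lsrc) (h7 : s.natVar 7 = p) (h8 : s.natVar 8 = r)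
    (h9 : s.natVar 9 = j₀) (h10 : s.natVar 10 = x) (hj : j₀ < n) (hx : x < w)
    (hs : src + n * w ≤ dst) (hl : lsrc + n * w ≤ dst)
    (hR : HoldsRows n w src R s) (hq : HoldsLabels n w lsrc q s)
    (hf : ∀ j < n, ∀ y < w, c.h (R j y) ≤ f) (hF : 4 * f + 1 ≤ c.F) :
    Tri c step s ((n * w + 1) * c.U) fun s' =>
      (∀ y < dst, s'.fldArr 2 y = s.fldArr 2 y) ∧ (∀ y < dst, s'.natArr 1 y = s.natArr 1 y) ∧
      HoldsRows n w dst (pivot R j₀ x) s' ∧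
      HoldsLabels n w dst (fun j => relabel (q j) p r (R j x / R j₀ x)) s' := by
  have hw : 0 < w := by omega
  refine Tri.mono (Tri.forTo hh (fun a s' =>
      (∀ y < dst, s'.fldArr 2 y = s.fldArr 2 y) ∧ (∀ y < dst, s'.natArr 1 y = s.natArr 1 y) ∧
      ∀ i < a, s'.fldArr 2 (dst + i) = pivot R j₀ x (i / w) (i % w) ∧
        s'.natArr 1 (dst + i) = relabel (q (i / w)) p r (R (i / w) x / R j₀ x))
    hB h2 le_rfl (by decide) (by decide) (by decide) ?_ ?_) le_rfl ?_
  · exact ⟨fun _ _ => rfl, fun _ _ => rfl, fun _ h => absurd h (by omega)⟩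
  · rintro a ha s' hB' h3' hA ⟨I1, I2, I3⟩
    have g1 := (hA.natVar 1 (by decide)).trans h1
    have g4 := (hA.natVar 4 (by decide)).trans h4
    have g5 := (hA.natVar 5 (by decide)).trans h5
    have g6 := (hA.natVar 6 (by decide)).trans h6
    have g7 := (hA.natVar 7 (by decide)).trans h7
    have g8 := (hA.natVar 8 (by decide)).trans h8
    have g9 := (hA.natVar 9 (by decide)).trans h9
    have g10 := (hA.natVar 10 (by decide)).trans h10
    have hr : a / w < n := Nat.div_lt_of_lt_mul (by rwa [mul_comm])
    have hc : a % w < w := Nat.mod_lt _ hw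
    -- The target lies beyond the source, so the writes done so far have not destroyed the source
    -- matrix.
    have hR' : ∀ j < n, ∀ y < w, s'.fldArr 2 (src + (j * w + y)) = R j y := by
      intro j hj y hy
      rw [I1 _ ?_, hR j hj y hy]
      have : j * w + w ≤ n * w := by rw [← Nat.succ_mul]; exact Nat.mul_le_mul_right _ hj
      omega
    have ha' : a / w * w + a % w = a := by rw [mul_comm]; exact Nat.div_add_mod a w
    have hRa : s'.fldArr 2 (src + a) = R (a / w) (a % w) := by
      conv_lhs => rw [← ha']
      exact hR' _ hr _ hc
    have hqa : s'.natArr 1 (lsrc + a) = q (a / w) := by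
      conv_lhs => rw [← ha']
      rw [ha', I2 _ (by omega), ← hq _ hr _ hc, ha']
    -- The quotient has height at most 2f, its product with an entry 3f, and the difference 4f + 1.
    -- Division by zero gives zero, so this also holds for useless pivots.
    have hm : c.h (R (a / w) x / R j₀ x) ≤ 2 * f :=
      (hh.div_le _ _).trans (by have := hf _ hr _ hx; have := hf _ hj _ hx; omega)
    refine Tri.seq (R := fun s1 => s1 = s'.setF 1 (R (a / w) x / R j₀ x)) ?_ ?_
    · refine Tri.fldSet hh hB' le_rfl _ ?_ (by omega) rfl
      simp [g1, g4, g9, g10, h3', hR' _ hr _ hx, hR' _ hj _ hx]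
    rintro s1 B1 - rfl
    refine Tri.seq (R := fun s2 => s2 = (s'.setF 1 (R (a / w) x / R j₀ x)).setFA 2 (dst + a)
      (pivot R j₀ x (a / w) (a % w))) ?_ ?_
    · refine Tri.fldPut hh B1 le_rfl _ _ ?_ ?_ ?_ rfl
      · simp [g5, h3']
      · simp [g1, g4, g9, h3', hR' _ hj _ hc, hRa, pivot]
      · refine (hh.sub_le _ _).trans ?_
        have e1 := hh.mul_le (R (a / w) x / R j₀ x) (R j₀ (a % w))
        have e2 := hf _ hr _ hc
        have e3 := hf _ hj _ hc
        omega
    rintro s2 B2 - rfl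
    refine Tri.seq (R := fun s3 => s3 = ((s'.setF 1 (R (a / w) x / R j₀ x)).setFA 2 (dst + a)
      (pivot R j₀ x (a / w) (a % w))).setN 11 (q (a / w))) ?_ ?_
    · refine Tri.natSet B2 le_rfl _ ?_ ?_ rfl
      · simp [g6, h3', hqa]
      · rw [← hqa]; exact hB'.natArr _ _
    rintro s3 B3 - rfl
    -- All four branches end with a write to the same address and differ only in the expression
    -- written.
    have fin : ∀ e : NatExpr, e.eval (((s'.setF 1 (R (a / w) x / R j₀ x)).setFA 2 (dst + a)
        (pivot R j₀ x (a / w) (a % w))).setN 11 (q (a / w))) =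
          relabel (q (a / w)) p r (R (a / w) x / R j₀ x) →
        Tri c (.natPut 1 (.var 5 + .var 3) e) (((s'.setF 1 (R (a / w) x / R j₀ x)).setFA 2 (dst + a)
        (pivot R j₀ x (a / w) (a % w))).setN 11 (q (a / w))) c.U (fun s'' =>
          (∀ y < dst, (s''.setN 3 (a + 1)).fldArr 2 y = s.fldArr 2 y) ∧
          (∀ y < dst, (s''.setN 3 (a + 1)).natArr 1 y = s.natArr 1 y) ∧
          ∀ i < a + 1, (s''.setN 3 (a + 1)).fldArr 2 (dst + i) = pivot R j₀ x (i / w) (i % w) ∧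
            (s''.setN 3 (a + 1)).natArr 1 (dst + i) =
              relabel (q (i / w)) p r (R (i / w) x / R j₀ x)) := by
      intro e he
      refine Tri.natPut B3 le_rfl (dst + a) _ (by simp [g5, h3']) he ?_ ?_
      · rcases relabel_cases (q (a / w)) p r (R (a / w) x / R j₀ x) with h | h | h <;> rw [h]
        · rw [← hqa]; exact hB'.natArr _ _
        · rw [← g7]; exact hB'.natVar _
        · rw [← g8]; exact hB'.natVar _
      · refine ⟨fun y hy => ?_, fun y hy => ?_, fun i hi => ?_⟩
        · have : y ≠ dst + a := by omega
          simp [this, I1 y hy]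
        · have : y ≠ dst + a := by omega
          simp [this, I2 y hy]
        · rcases Nat.lt_succ_iff_lt_or_eq.1 hi with h | h
          · have : i ≠ a := by omega
            simp [this, I3 i h]
          · subst h; simp
    refine Tri.ite hh B3 le_rfl (fun hb => ?_) (fun hb => ?_)
    · refine Tri.ite hh B3 le_rfl (fun hb1 => ?_) (fun hb1 => ?_)
      · refine fin _ ?_
        simp [g7, g8] at hb hb1 ⊢
        simp [relabel, hb, hb1]
      · refine Tri.ite hh B3 le_rfl (fun hb2 => ?_) (fun hb2 => ?_)
        · refine fin _ ?_
          simp [g7, g8] at hb hb1 hb2 ⊢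
          simp [relabel, hb, hb1.not_gt, hb2]
        · refine fin _ ?_
          simp [g7, g8] at hb hb1 hb2 ⊢
          simp [relabel, hb1.not_gt, hb2.not_gt]
    · refine fin _ ?_
      simp [g7, g8] at hb ⊢
      simp [relabel, hb]
  · rintro s' - - ⟨I1, I2, I3⟩
    have e : ∀ j < n, ∀ y < w, j * w + y < n * w ∧ (j * w + y) / w = j ∧ (j * w + y) % w = y := by
      intro j hj y hy
      refine ⟨?_, ?_, ?_⟩
      · have : j * w + w ≤ n * w := by rw [← Nat.succ_mul]; exact Nat.mul_le_mul_right _ hj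
        omega
      · rw [mul_comm, Nat.mul_add_div hw, Nat.div_eq_of_lt hy, add_zero]
      · rw [mul_comm, Nat.mul_add_mod, Nat.mod_eq_of_lt hy]
    refine ⟨I1, I2, fun j hj y hy => ?_, fun j hj y hy => ?_⟩
    · obtain ⟨e1, e2, e3⟩ := e j hj y hy
      rw [(I3 _ e1).1, e2, e3]
    · obtain ⟨e1, e2, e3⟩ := e j hj y hy
      rw [(I3 _ e1).2, e2]

end Step

/-! ### Ranks and elimination -/

section Rank

variable {K : Type} [Field K]

/-- The rank of the upper left `n × w` part. -/
noncomputable def rk (n w : ℕ) (R : ℕ → ℕ → K) : ℕ :=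
  Module.finrank K (Submodule.span K (Set.range fun (j : Fin n) (y : Fin w) => R j y))

theorem rk_eq_zero {n w : ℕ} {R : ℕ → ℕ → K} (h : ∀ j < n, ∀ y < w, R j y = 0) :
    rk n w R = 0 := by
  have : Submodule.span K (Set.range fun (j : Fin n) (y : Fin w) => R j y) = ⊥ := by
    rw [Submodule.span_eq_bot]
    rintro _ ⟨j, rfl⟩
    funext y
    exact h j j.2 y y.2
  rw [rk, this, finrank_bot]

theorem rk_le (n w : ℕ) (R : ℕ → ℕ → K) : rk n w R ≤ n := by
  have := finrank_range_le_card (R := K) (fun (j : Fin n) (y : Fin w) => R j y)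
  rwa [Fintype.card_fin] at this

/-- The new row space lies in the old one and in the hyperplane where coordinate x vanishes, which
excludes the pivot row; together with the pivot row it spans the old one. -/
theorem rk_pivot {n w j₀ x : ℕ} {R : ℕ → ℕ → K} (hj : j₀ < n) (hx : x < w) (h : R j₀ x ≠ 0) :
    rk n w (pivot R j₀ x) + 1 = rk n w R := by
  set V := Submodule.span K (Set.range fun (j : Fin n) (y : Fin w) => R j y)
  set V' := Submodule.span K (Set.range fun (j : Fin n) (y : Fin w) => pivot R j₀ x j y)
  set e : Fin w → K := fun y => R j₀ y
  have he : e ∈ V := Submodule.subset_span ⟨⟨j₀, hj⟩, rfl⟩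
  have hle : V' ≤ V := by
    rw [Submodule.span_le]
    rintro _ ⟨j, rfl⟩
    exact V.sub_mem (Submodule.subset_span ⟨j, rfl⟩)
      (V.smul_mem (R j x / R j₀ x) he)
  have hx0 : ∀ v ∈ V', v ⟨x, hx⟩ = 0 := by
    intro v hv
    have : V' ≤ LinearMap.ker (LinearMap.proj (⟨x, hx⟩ : Fin w) : (Fin w → K) →ₗ[K] K) := by
      rw [Submodule.span_le]
      rintro _ ⟨j, rfl⟩
      simp [pivot, h]
    simpa using this hv
  have hlt : V' < V := lt_of_le_of_ne hle fun heq => h (hx0 e (heq ▸ he))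
  have hsup : V ≤ V' ⊔ Submodule.span K {e} := by
    rw [Submodule.span_le]
    rintro _ ⟨j, rfl⟩
    refine Submodule.mem_sup.2 ⟨_, Submodule.subset_span ⟨j, rfl⟩, (R j x / R j₀ x) • e,
      Submodule.smul_mem _ _ (Submodule.mem_span_singleton_self e), ?_⟩
    funext y
    simp [pivot, e]
  have h1 : Module.finrank K V' < Module.finrank K V := Submodule.finrank_lt_finrank_of_lt hlt
  have h2 : Module.finrank K V ≤ Module.finrank K V' + 1 := by
    refine (Submodule.finrank_mono hsup).trans ((Submodule.finrank_add_le_finrank_add_finrank _ _).trans ?_)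
    have := finrank_span_le_card (R := K) ({e} : Set (Fin w → K))
    simp at this
    omega
  change Module.finrank K V' + 1 = Module.finrank K V
  omega

theorem pivot_self {R : ℕ → ℕ → K} {j₀ x : ℕ} (h : R j₀ x ≠ 0) (y : ℕ) :
    pivot R j₀ x j₀ y = 0 := by
  simp [pivot, h]

theorem pivot_of_eq_zero {R : ℕ → ℕ → K} {j₀ x j : ℕ} (h : R j x = 0) (y : ℕ) :
    pivot R j₀ x j y = R j y := by
  simp [pivot, h]

end Rank

/-! ### Labels from a separating functional -/

section Separation

variable {K : Type} [Field K] [LinearOrder K] [IsStrictOrderedRing K]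

def dot (w : ℕ) (u v : ℕ → K) : K := ∑ y ∈ Finset.range w, u y * v y

theorem dot_sub_mul (w : ℕ) (u v v' : ℕ → K) (a : K) :
    dot w u (fun y => v y - a * v' y) = dot w u v - a * dot w u v' := by
  simp only [dot, Finset.mul_sum, ← Finset.sum_sub_distrib]
  exact Finset.sum_congr rfl fun y _ => by ring

theorem dot_mul (w : ℕ) (u v : ℕ → K) (a : K) :
    dot w u (fun y => a * v y) = a * dot w u v := by
  simp only [dot, Finset.mul_sum]
  exact Finset.sum_congr rfl fun y _ => by ring

theorem dot_sub_left (w : ℕ) (u u' v : ℕ → K) (a b : K) :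
    dot w (fun y => a * u y - b * u' y) v = a * dot w u v - b * dot w u' v := by
  simp only [dot, Finset.mul_sum, ← Finset.sum_sub_distrib]
  exact Finset.sum_congr rfl fun y _ => by ring

theorem dot_comm (w : ℕ) (u v : ℕ → K) : dot w u v = dot w v u := by
  simp [dot, mul_comm]

theorem dot_congr {w : ℕ} {u v v' : ℕ → K} (h : ∀ y < w, v y = v' y) : dot w u v = dot w u v' :=
  Finset.sum_congr rfl fun y hy => by rw [h y (Finset.mem_range.1 hy)]

/-- The cone generated by finitely many vectors in an open half space has an extreme ray. -/
theorem exists_extreme (w : ℕ) (S : Finset ℕ) (hS : S.Nonempty) (e : ℕ → ℕ → K) (v : ℕ → K)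
    (hv : ∀ j ∈ S, 0 < dot w v (e j)) :
    ∃ i ∈ S, ∃ v' : ℕ → K, dot w v' (e i) = 0 ∧ ∀ j ∈ S, 0 ≤ dot w v' (e j) ∧
      (dot w v' (e j) = 0 → ∀ y < w, e j y = dot w v (e j) / dot w v (e i) * e i y) := by
  -- Scale all vectors to the affine hyperplane v = 1. A longest vector there is a vertex of the
  -- convex hull.
  set E : ℕ → ℕ → K := fun j y => (dot w v (e j))⁻¹ * e j y with hE
  obtain ⟨i, hi, hmax⟩ := S.exists_max_image (fun j => dot w (E j) (E j)) hS
  have hdot : ∀ j ∈ S, ∀ u, dot w u (e j) = dot w v (e j) * dot w u (E j) := by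
    intro j hj u
    rw [hE, dot_mul, mul_inv_cancel_left₀ (hv j hj).ne']
  have hvE : ∀ j ∈ S, dot w v (E j) = 1 := by
    intro j hj
    rw [hE, dot_mul, inv_mul_cancel₀ (hv j hj).ne']
  -- At E j this functional takes the value |E i|² - ⟨E i, E j⟩, which is at least |E i - E j|² / 2
  -- because E i is longest. No square roots are used, so this works over any ordered field.
  refine ⟨i, hi, fun y => dot w (E i) (E i) * v y - 1 * E i y, ?_, ?_⟩
  · rw [hdot i hi, dot_sub_left, hvE i hi]; ring
  · intro j hj
    have hsq : dot w (fun y => 1 * E i y - 1 * E j y) (fun y => E i y - 1 * E j y) =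
        dot w (E i) (E i) - 2 * dot w (E i) (E j) + dot w (E j) (E j) := by
      rw [dot_sub_left, dot_sub_mul, dot_sub_mul, dot_comm w (E j) (E i)]; ring
    have hsum : dot w (fun y => 1 * E i y - 1 * E j y) (fun y => E i y - 1 * E j y) =
        ∑ y ∈ Finset.range w, (E i y - E j y) ^ 2 :=
      Finset.sum_congr rfl fun y _ => by ring
    have h0 : 0 ≤ ∑ y ∈ Finset.range w, (E i y - E j y) ^ 2 :=
      Finset.sum_nonneg fun _ _ => sq_nonneg _
    have hle := hmax j hj
    have hval : dot w (fun y => dot w (E i) (E i) * v y - 1 * E i y) (e j) =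
        dot w v (e j) * (dot w (E i) (E i) - dot w (E i) (E j)) := by
      rw [hdot j hj, dot_sub_left, hvE j hj]; ring
    rw [hval]
    refine ⟨mul_nonneg (hv j hj).le (by linarith), fun hz y hy => ?_⟩
    have hz' : dot w (E i) (E i) - dot w (E i) (E j) = 0 :=
      (mul_eq_zero.1 hz).resolve_left (hv j hj).ne'
    have hs0 : ∑ y ∈ Finset.range w, (E i y - E j y) ^ 2 = 0 := by
      apply le_antisymm _ h0
      rw [← hsum, hsq]; linarith
    have hy0 := (Finset.sum_eq_zero_iff_of_nonneg fun _ _ => sq_nonneg _).1 hs0 y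
      (Finset.mem_range.2 hy)
    have hij : E i y = E j y := sub_eq_zero.1 (pow_eq_zero_iff two_ne_zero |>.1 hy0)
    have hi0 := (hv i hi).ne'
    have hj0 := (hv j hj).ne'
    simp only [hE] at hij
    field_simp at hij ⊢
    linarith

/-- An instruction of the nondeterministic labelling procedure. -/
structure Instr where
  c : ℕ
  r : ℕ
  j : ℕ
  x : ℕ
  keep : Bool

/-- One elimination step, starting over from `R₀` if `keep` is false. -/
def Instr.apply (R₀ : ℕ → ℕ → K) (I : Instr) (st : (ℕ → ℕ → K) × (ℕ → ℕ)) :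
    (ℕ → ℕ → K) × (ℕ → ℕ) :=
  (pivot (if I.keep then st.1 else R₀) I.j I.x, fun i => relabel (st.2 i) I.c I.r
    ((if I.keep then st.1 else R₀) i I.x / (if I.keep then st.1 else R₀) I.j I.x))

def runInstrs (R₀ : ℕ → ℕ → K) (l : List Instr) (st : (ℕ → ℕ → K) × (ℕ → ℕ)) :
    (ℕ → ℕ → K) × (ℕ → ℕ) :=
  l.foldl (fun st I => I.apply R₀ st) st

theorem relabel_zero (q c r : ℕ) : relabel q c r (0 : K) = q := by simp [relabel]

theorem relabel_of_not_mem {q c r : ℕ} (m : K) (h : ¬ (q = c ∨ q = r)) : relabel q c r m = q := by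
  simp only [relabel, if_neg h]

theorem relabel_mem {q c r : ℕ} (m : K) (h : q = c ∨ q = r) :
    relabel q c r m = c ∨ relabel q c r m = r := by
  rcases relabel_cases q c r m with h' | h' | h' <;> rw [h'] <;> simp [h]

/-- If the rows with indices in `S` are separated by a functional then a sequence of at most `rk R`
elimination steps separates them by labels. -/
theorem exists_labels (R₀ : ℕ → ℕ → K) (n w p r : ℕ) (S : Finset ℕ) (hS : ∀ j ∈ S, j < n)
    (σ : ℕ → Prop) :
    ∀ (d : ℕ) (R : ℕ → ℕ → K) (q : ℕ → ℕ) (v : ℕ → K), rk n w R ≤ d →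
      (∀ j ∈ S, (∃ y < w, R j y ≠ 0) →
        (σ j → 0 < dot w v (R j)) ∧ (¬ σ j → dot w v (R j) < 0)) →
      ∃ l : List Instr, l.length ≤ d ∧
        (∀ I ∈ l, (I.c = p ∨ I.c = r) ∧ (I.r = p ∨ I.r = r) ∧ I.j < n ∧ I.x < w ∧ I.keep) ∧
        (∀ j, ¬ (q j = p ∨ q j = r) → (runInstrs R₀ l (R, q)).2 j = q j) ∧
        (∀ j, (q j = p ∨ q j = r) →
          ((runInstrs R₀ l (R, q)).2 j = p ∨ (runInstrs R₀ l (R, q)).2 j = r)) ∧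
        (∀ j, (∀ y < w, R j y = 0) → (runInstrs R₀ l (R, q)).2 j = q j) ∧
        (∀ j ∈ S, (q j = p ∨ q j = r) → (∃ y < w, R j y ≠ 0) →
          (σ j → (runInstrs R₀ l (R, q)).2 j = p) ∧
          (¬ σ j → (runInstrs R₀ l (R, q)).2 j = r)) := by
  classical
  intro d
  induction d with
  | zero =>
    intro R q v hd hv
    have hz : ∀ j < n, ∀ y < w, R j y = 0 := by
      intro j hj y hy
      by_contra h
      have := rk_pivot hj hy h
      omega
    refine ⟨[], le_rfl, by simp, fun _ _ => rfl, fun _ h => h, fun _ _ => rfl, ?_⟩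
    rintro j hj - ⟨y, hy, h⟩
    exact absurd (hz j (hS j hj) y hy) h
  | succ d ih =>
    intro R q v hd hv
    set S' := S.filter fun j => ∃ y < w, R j y ≠ 0 with hS'
    by_cases hne : S'.Nonempty
    swap
    · refine ⟨[], by simp, by simp, fun _ _ => rfl, fun _ h => h, fun _ _ => rfl, ?_⟩
      intro j hj _ h
      exact absurd ⟨j, Finset.mem_filter.2 ⟨hj, h⟩⟩ hne
    -- After these sign changes all nonzero rows of S lie in the open half space v > 0.
    set sg : ℕ → K := fun j => if σ j then 1 else -1 with hsg
    have hsg2 : ∀ j, sg j * sg j = 1 := by intro j; simp only [hsg]; split_ifs <;> norm_num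
    obtain ⟨i, hi, v', hv'i, hv'⟩ := exists_extreme w S' hne (fun j y => sg j * R j y) v (by
      intro j hj
      obtain ⟨h1, h2⟩ := Finset.mem_filter.1 hj
      rw [dot_mul]
      simp only [hsg]
      split_ifs with h
      · linarith [(hv j h1 h2).1 h]
      · linarith [(hv j h1 h2).2 h])
    obtain ⟨hiS, x, hx, hix⟩ := Finset.mem_filter.1 hi
    have hin := hS i hiS
    have hrk := rk_pivot hin hx hix
    have hv'0 : dot w v' (R i) = 0 := by
      rw [dot_mul] at hv'i
      refine (mul_eq_zero.1 hv'i).resolve_left fun h => ?_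
      have := hsg2 i
      rw [h] at this; simp at this
    -- Positive multiples of row i belong to the class of i and negative multiples to the other one.
    set c₁ := if σ i then p else r with hc₁
    set r₁ := if σ i then r else p with hr₁
    have hcr : ∀ a, (a = c₁ ∨ a = r₁) ↔ (a = p ∨ a = r) := by
      intro a; simp only [hc₁, hr₁]; split_ifs
      · rfl
      · exact or_comm
    set q' : ℕ → ℕ := fun j => relabel (q j) c₁ r₁ (R j x / R i x) with hq'
    have hzero : ∀ j, (∀ y < w, R j y = 0) → ∀ y < w, pivot R i x j y = 0 := by
      intro j h y hy
      rw [pivot_of_eq_zero (h x hx), h y hy]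
    have hdotp : ∀ j, dot w v' (pivot R i x j) = dot w v' (R j) := by
      intro j
      show dot w v' (fun y => R j y - R j x / R i x * R i y) = _
      rw [dot_sub_mul, hv'0, mul_zero, sub_zero]
    -- Rows on the extreme ray, up to sign, are eliminated completely. All other nonzero rows have a
    -- nonzero value under v', which is unchanged by the pivot because v' vanishes on row i.
    have hpar : ∀ j ∈ S', dot w v' (fun y => sg j * R j y) = 0 →
        ∀ y < w, pivot R i x j y = 0 := by
      intro j hj h y hy
      obtain ⟨a, ha⟩ : ∃ a, ∀ y < w, R j y = a * R i y := by
        refine ⟨sg j * (dot w v (fun y => sg j * R j y) / dot w v (fun y => sg i * R i y) * sg i),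
          fun y hy => ?_⟩
        have := (hv' j hj).2 h y hy
        calc R j y = sg j * (sg j * R j y) := by rw [← mul_assoc, hsg2, one_mul]
          _ = _ := by rw [this]; ring
      simp only [pivot]
      rw [ha y hy, ha x hx]
      field_simp
      ring
    obtain ⟨l, h1, h2, h3, h4, h5, h6⟩ := ih (pivot R i x) q' v' (by omega) (by
      intro j hj hn
      have hn' : ∃ y < w, R j y ≠ 0 := by
        by_contra hcon
        push Not at hcon
        obtain ⟨y, hy, hne⟩ := hn
        exact hne (hzero j hcon y hy)
      have hjS' : j ∈ S' := Finset.mem_filter.2 ⟨hj, hn'⟩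
      have hpos : 0 < dot w v' (fun y => sg j * R j y) := by
        refine lt_of_le_of_ne (hv' j hjS').1 fun h => ?_
        obtain ⟨y, hy, hne⟩ := hn
        exact hne (hpar j hjS' h.symm y hy)
      rw [dot_mul] at hpos
      rw [hdotp]
      simp only [hsg] at hpos
      refine ⟨fun h => ?_, fun h => ?_⟩
      · simpa [h] using hpos
      · simpa [h] using hpos)
    have hrun : runInstrs R₀ (⟨c₁, r₁, i, x, true⟩ :: l) (R, q) =
        runInstrs R₀ l (pivot R i x, q') := rfl
    refine ⟨⟨c₁, r₁, i, x, true⟩ :: l, by simp; omega, ?_, ?_, ?_, ?_, ?_⟩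
    · intro I hI
      rcases List.mem_cons.1 hI with rfl | hI
      · exact ⟨(hcr _).1 (Or.inl rfl), (hcr _).1 (Or.inr rfl), hin, hx, rfl⟩
      · exact h2 I hI
    · intro j hj
      have : q' j = q j := relabel_of_not_mem _ (by rwa [hcr])
      rw [hrun, h3 j (by rwa [this]), this]
    · intro j hj
      rw [hrun]
      exact h4 j ((hcr _).1 (relabel_mem _ ((hcr _).2 hj)))
    · intro j hj
      rw [hrun, h5 j (hzero j hj)]
      simp only [hq', hj x hx, zero_div, relabel_zero]
    · intro j hj hqj hn
      have hq'j : q' j = p ∨ q' j = r := (hcr _).1 (relabel_mem _ ((hcr _).2 hqj))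
      rw [hrun]
      by_cases hp : ∃ y < w, pivot R i x j y ≠ 0
      · exact h6 j hj hq'j hp
      push Not at hp
      -- Row j becomes zero in this step. Its label is final, since a zero row has coefficient 0 in
      -- all later steps; so the sign of the coefficient must give the right label now.
      rw [h5 j hp]
      have hRj : ∀ y < w, R j y = R j x / R i x * R i y := fun y hy => sub_eq_zero.1 (hp y hy)
      have hm0 : R j x / R i x ≠ 0 := by
        intro h0
        obtain ⟨y, hy, hne⟩ := hn
        exact hne (by rw [hRj y hy, h0, zero_mul])
      have hvj : dot w v (R j) = R j x / R i x * dot w v (R i) := by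
        rw [dot_congr hRj, dot_mul]
      have hvi := hv i hiS ⟨x, hx, hix⟩
      have hvj' := hv j hj hn
      simp only [hq', relabel, if_pos ((hcr _).2 hqj)]
      rw [hvj] at hvj'
      rcases lt_or_gt_of_ne hm0 with hm | hm
      · rw [if_neg hm.not_gt, if_pos hm]
        refine ⟨fun hσ => ?_, fun hσ => ?_⟩
        · by_cases hσi : σ i
          · have := mul_neg_of_neg_of_pos hm (hvi.1 hσi)
            linarith [hvj'.1 hσ]
          · simp [hr₁, hσi]
        · by_cases hσi : σ i
          · simp [hr₁, hσi]
          · have := mul_pos_of_neg_of_neg hm (hvi.2 hσi)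
            linarith [hvj'.2 hσ]
      · rw [if_pos hm]
        refine ⟨fun hσ => ?_, fun hσ => ?_⟩
        · by_cases hσi : σ i
          · simp [hc₁, hσi]
          · have := mul_neg_of_pos_of_neg hm (hvi.2 hσi)
            linarith [hvj'.1 hσ]
        · by_cases hσi : σ i
          · have := mul_pos hm (hvi.1 hσi)
            linarith [hvj'.2 hσ]
          · simp [hc₁, hσi]

end Separation

/-! ### Sequencing rules -/

section Seq

variable {K : Type} [Field K] [LinearOrder K] {c : Bounds K} {s : Store K} {Z : ℕ}
  {Q : Store K → Prop} {P : Prog}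

theorem Tri.natSet_seq {x : ℕ} {e : NatExpr} (hB : Bdd c s) (hZ : c.U ≤ Z) (v : ℕ)
    (hv : e.eval s = v) (hX : v ≤ c.X) (h : Bdd c (s.setN x v) → Tri c P (s.setN x v) Z Q) :
    Tri c (.natSet x e ⨟ P) s Z Q :=
  Tri.seq (R := fun s' => s' = s.setN x v) (Tri.natSet hB hZ v hv hX rfl)
    (by rintro s' hB' - rfl; exact h hB')

theorem Tri.natPut_seq {a : ℕ} {i e : NatExpr} (hB : Bdd c s) (hZ : c.U ≤ Z) (j v : ℕ)
    (hi : i.eval s = j) (hv : e.eval s = v) (hX : v ≤ c.X)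
    (h : Bdd c (s.setNA a j v) → Tri c P (s.setNA a j v) Z Q) :
    Tri c (.natPut a i e ⨟ P) s Z Q :=
  Tri.seq (R := fun s' => s' = s.setNA a j v) (Tri.natPut hB hZ j v hi hv hX rfl)
    (by rintro s' hB' - rfl; exact h hB')

theorem Tri.fldSet_seq (hh : IsHeight c.w c.h) {x : ℕ} {e : FldExpr} (hB : Bdd c s)
    (hZ : c.U ≤ Z) (v : K) (hv : e.eval s = v) (hX : c.h v ≤ c.F)
    (h : Bdd c (s.setF x v) → Tri c P (s.setF x v) Z Q) :
    Tri c (.fldSet x e ⨟ P) s Z Q :=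
  Tri.seq (R := fun s' => s' = s.setF x v) (Tri.fldSet hh hB hZ v hv hX rfl)
    (by rintro s' hB' - rfl; exact h hB')

end Seq

/-! ### The program -/

/-- The number of instructions: two labels, a pivot row, a pivot column of the extended matrix, and
the bit that decides about restarting. -/
def baseOf (n : ℕ) : ℕ := n * n * n * (n + 2) * 2

/-- The variable `12` holds `n * n` and the variable `18` the number of instructions. -/
def setupP : Prog :=
  .natSet 1 (.var 0 + .const 2) ⨟ .natSet 2 (.var 0 * .var 1) ⨟ .natSet 12 (.var 0 * .var 0) ⨟
  .natSet 18 (.var 0 * .var 0 * .var 0 * .var 1 * .const 2)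

/-- The natural array `3` receives the last index of an equal row of `B`. -/
def clusterP : Prog :=
  .forTo 13 12 (.ite
    (.fldLe (.get 1 (.var 13 / .var 0 * .var 0 + .var 13 / .var 0) +
      .get 1 (.var 13 % .var 0 * .var 0 + .var 13 % .var 0)) (.get 1 (.var 13) + .get 1 (.var 13)))
    (.natPut 3 (.var 13 / .var 0) (.var 13 % .var 0)) .skip)

/-- The variable `14` receives the number of clusters. -/
def countP : Prog :=
  .natSet 14 (.const 0) ⨟ .forTo 13 0 (.ite (.natEq (.get 3 (.var 13)) (.var 13))
    (.natSet 14 (.var 14 + .const 1)) .skip)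

/-- The working matrix: the rows of `A`, a constant column and the row index. -/
def rowsP : Prog :=
  .forTo 13 2 (.ite (.natLt (.var 13 % .var 1) (.var 0))
    (.fldPut 2 (.var 13) (.get 0 (.var 13 / .var 1 * .var 0 + .var 13 % .var 1)))
    (.ite (.natEq (.var 13 % .var 1) (.var 0)) (.fldPut 2 (.var 13) (.ofNat (.const 1)))
      (.fldPut 2 (.var 13) (.ofNat (.var 13 / .var 1)))))

/-- The variable `15` receives the rank of the working matrix. -/
def rankP : Prog :=
  .natSet 15 (.const 0) ⨟ .natSet 4 (.const 0) ⨟ .forTo 13 2 (.ite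
    (.neg (.and (.fldLe (.get 2 (.var 4 + .var 13)) (.ofNat (.const 0)))
      (.fldLe (.ofNat (.const 0)) (.get 2 (.var 4 + .var 13)))))
    (.natSet 9 (.var 13 / .var 1) ⨟ .natSet 10 (.var 13 % .var 1) ⨟
      .natSet 5 (.var 4 + .var 2) ⨟ .natSet 6 (.var 4) ⨟ step ⨟ .natSet 4 (.var 5) ⨟
      .natSet 15 (.var 15 + .const 1)) .skip)

/-- The variable `16` receives the number of steps and the variable `17` the number of candidates. -/
def boundP : Prog :=
  .natSet 16 (.var 15 * .var 14 * .var 14) ⨟ .natSet 17 (.const 1) ⨟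
  .forTo 13 16 (.natSet 17 (.var 17 * .var 18))

/-- The labels that belong to the candidate in the variable `19`. -/
def labelsP : Prog :=
  .natSet 20 (.var 19) ⨟ .forTo 13 2 (.natPut 1 (.var 13) (.get 3 (.const 0))) ⨟
  .forTo 21 16 (.natSet 22 (.var 20 % .var 18) ⨟ .natSet 20 (.var 20 / .var 18) ⨟
    .natSet 7 (.var 22 % .var 0) ⨟ .natSet 8 (.var 22 / .var 0 % .var 0) ⨟
    .natSet 9 (.var 22 / .var 0 / .var 0 % .var 0) ⨟
    .natSet 10 (.var 22 / .var 0 / .var 0 / .var 0 % .var 1) ⨟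
    .natSet 6 (.var 21 * .var 2) ⨟
    .natSet 4 (.var 22 / .var 0 / .var 0 / .var 0 / .var 1 % .const 2 * .var 6) ⨟
    .natSet 5 (.var 6 + .var 2) ⨟ step)

/-- The natural array `2` receives a permutation that matches labels with clusters. -/
def permP : Prog :=
  .forTo 13 0 (.natPut 2 (.var 13) (.var 13)) ⨟
  .forTo 13 12 (.ite (.and (.natLe (.var 13 / .var 0) (.var 13 % .var 0))
      (.natEq (.get 1 (.var 16 * .var 2 + .get 2 (.var 13 % .var 0) * .var 1))
        (.get 3 (.var 13 / .var 0))))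
    (.natSet 11 (.get 2 (.var 13 / .var 0)) ⨟
      .natPut 2 (.var 13 / .var 0) (.get 2 (.var 13 % .var 0)) ⨟
      .natPut 2 (.var 13 % .var 0) (.var 11)) .skip)

/-- The objective of the permutation in the natural array `2`. -/
def objP : Prog :=
  .fldSet 2 (.ofNat (.const 0)) ⨟ .forTo 13 12
    (.fldSet 1 (.get 0 (.get 2 (.var 13 / .var 0) * .var 0 + .get 2 (.var 13 % .var 0)) -
      .get 1 (.var 13)) ⨟ .fldSet 2 (.var 2 + .var 1 * .var 1))

/-- Replace the best permutation found so far. -/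
def bestP : Prog :=
  .ite (.or (.natLe (.var 19) (.const 0)) (.neg (.fldLe (.var 0) (.var 2))))
    (.fldSet 0 (.var 2) ⨟ .forTo 13 0 (.natPut 0 (.var 13) (.get 2 (.var 13)))) .skip

def searchP : Prog := .forTo 19 17 (labelsP ⨟ permP ⨟ objP ⨟ bestP)

def solveP : Prog :=
  setupP ⨟ clusterP ⨟ countP ⨟ rowsP ⨟ rankP ⨟ boundP ⨟ searchP

/-! ### Specifications -/

section Specs

variable {K : Type} [Field K] [LinearOrder K]

/-- The data that stay in the memory during the whole run. -/
structure Env (n : ℕ) (A B : ℕ → K) (s : Store K) : Prop where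
  order : s.natVar 0 = n
  width : s.natVar 1 = n + 2
  area : s.natVar 2 = n * (n + 2)
  square : s.natVar 12 = n * n
  base : s.natVar 18 = baseOf n
  fst : s.fldArr 0 = A
  snd : s.fldArr 1 = B

theorem Env.agree {n : ℕ} {A B : ℕ → K} {s s' : Store K} {P : Prog} (h : Env n A B s)
    (hA : Agree P s s') (h1 : ∀ x ∈ [0, 1, 2, 12, 18], x ∉ P.natVars)
    (h2 : ∀ a ∈ [0, 1], a ∉ P.fldArrs) : Env n A B s' where
  order := (hA.natVar 0 (h1 0 (by simp))).trans h.order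
  width := (hA.natVar 1 (h1 1 (by simp))).trans h.width
  area := (hA.natVar 2 (h1 2 (by simp))).trans h.area
  square := (hA.natVar 12 (h1 12 (by simp))).trans h.square
  base := (hA.natVar 18 (h1 18 (by simp))).trans h.base
  fst := (hA.fldArr 0 (h2 0 (by simp))).trans h.fst
  snd := (hA.fldArr 1 (h2 1 (by simp))).trans h.snd

variable {c : Bounds K} {s : Store K} {n : ℕ} {A B : ℕ → K}

theorem setup_spec (hB : Bdd c s) (h0 : s.natVar 0 = n) (hA : s.fldArr 0 = A)
    (hB' : s.fldArr 1 = B) (h1 : n + 2 ≤ c.X) (h2 : n * (n + 2) ≤ c.X) (h3 : n * n ≤ c.X)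
    (h4 : baseOf n ≤ c.X) :
    Tri c setupP s c.U fun s' => Env n A B s' := by
  refine Tri.natSet_seq hB le_rfl (n + 2) (by simp [h0]) h1 fun B1 => ?_
  refine Tri.natSet_seq B1 le_rfl (n * (n + 2)) (by simp [h0]) h2 fun B2 => ?_
  refine Tri.natSet_seq B2 le_rfl (n * n) (by simp [h0]) h3 fun B3 => ?_
  refine Tri.natSet B3 le_rfl (baseOf n) (by simp [h0, baseOf]) h4 ?_
  constructor <;> simp [h0, hA, hB']

theorem row_lt {n w a : ℕ} (h : a < n * w) : a / w < n :=
  Nat.div_lt_of_lt_mul (by rwa [mul_comm])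

theorem col_lt {n w a : ℕ} (h : a < n * w) : a % w < w :=
  Nat.mod_lt _ (by rcases Nat.eq_zero_or_pos w with rfl | h' <;> simp_all)

theorem row_col (a w : ℕ) : a / w * w + a % w = a := by
  rw [mul_comm]; exact Nat.div_add_mod a w

theorem flat_lt {n w j y : ℕ} (hj : j < n) (hy : y < w) : j * w + y < n * w := by
  have : j * w + w ≤ n * w := by rw [← Nat.succ_mul]; exact Nat.mul_le_mul_right _ hj
  omega

theorem flat_row {w j y : ℕ} (hy : y < w) : (j * w + y) / w = j := by
  rw [mul_comm, Nat.mul_add_div (by omega), Nat.div_eq_of_lt hy, add_zero]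

theorem flat_col {w j y : ℕ} (hy : y < w) : (j * w + y) % w = y := by
  rw [mul_comm, Nat.mul_add_mod, Nat.mod_eq_of_lt hy]

/-- The test for equality of two rows of a positive semidefinite matrix. -/
def SameRow (n : ℕ) (B : ℕ → K) (i j : ℕ) : Prop :=
  B (i * n + i) + B (j * n + j) ≤ B (i * n + j) + B (i * n + j)

/-- `cl i` is the last index of a row that equals the row `i`. -/
def IsRep (n : ℕ) (B : ℕ → K) (cl : ℕ → ℕ) : Prop :=
  ∀ i < n, cl i < n ∧ SameRow n B i (cl i) ∧ ∀ j < n, SameRow n B i j → j ≤ cl i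

theorem cluster_spec (hh : IsHeight c.w c.h) (hB : Bdd c s) (hE : Env n A B s) :
    Tri c clusterP s ((n * n + 1) * c.U) fun s' => IsRep n B (s'.natArr 3) := by
  -- Later hits overwrite earlier ones, so the last index of an equal row survives; this makes the
  -- representative canonical.
  refine Tri.mono (Tri.forTo hh (fun a s' => ∀ i < n, ∀ j < n, i * n + j < a → SameRow n B i j →
    s'.natArr 3 i < n ∧ SameRow n B i (s'.natArr 3 i) ∧ j ≤ s'.natArr 3 i) hB hE.square le_rfl
    (by decide) (by decide) (by decide) (fun i _ j _ h => absurd h (by omega)) ?_) le_rfl ?_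
  · intro a ha s' hB' h13 hA' I
    have hE' := hE.agree hA' (by decide) (by decide)
    have hr := row_lt ha
    have hc := col_lt ha
    have hrc := row_col a n
    refine Tri.ite hh hB' le_rfl (fun hb => ?_) (fun hb => ?_)
    · refine Tri.natPut hB' le_rfl (a / n) (a % n) (by simp [hE'.order, h13])
        (by simp [hE'.order, h13]) ?_ ?_
      · have := hB'.natVar 0
        rw [hE'.order] at this
        omega
      have hb' : SameRow n B (a / n) (a % n) := by
        simpa [hE'.order, h13, hE'.snd, SameRow, hrc] using hb
      intro i hi j hj hij hs
      by_cases hia : i = a / n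
      · subst hia
        refine ⟨by simpa using hc, by simpa using hb', ?_⟩
        simp only [Store.natArr_setN, Store.natArr_setNA, and_self, if_true]
        omega
      · have hlt : i * n + j < a := by
          refine lt_of_le_of_ne (by omega) fun h => hia ?_
          rw [← h, flat_row hj]
        simpa [hia] using I i hi j hj hlt hs
    · refine Tri.skip hB' c.one_le_U ?_
      intro i hi j hj hij hs
      refine I i hi j hj (lt_of_le_of_ne (by omega) fun h => ?_) hs
      have h1 : i = a / n := by rw [← h, flat_row hj]
      have h2 : j = a % n := by rw [← h, flat_col hj]
      rw [h1, h2] at hs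
      simp [hE'.order, h13, hE'.snd] at hb
      rw [SameRow, hrc] at hs
      exact absurd hs hb.not_ge
  · intro s' _ _ I i hi
    have h1 := I i hi i hi (flat_lt hi hi) le_rfl
    exact ⟨h1.1, h1.2.1, fun j hj hs => (I i hi j hj (flat_lt hi hj) hs).2.2⟩

theorem count_spec (hh : IsHeight c.w c.h) (hB : Bdd c s) (hE : Env n A B s) :
    Tri c countP s ((n + 1) * c.U) fun s' =>
      s'.natVar 14 = ((Finset.range n).filter fun i => s.natArr 3 i = i).card := by
  have hU : c.U ≤ (n + 1) * c.U := Nat.le_mul_of_pos_left _ (by omega)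
  refine Tri.natSet_seq hB hU 0 rfl (by omega) fun B1 => ?_
  refine Tri.forTo hh (fun a s' => s'.natVar 14 =
      ((Finset.range a).filter fun i => s.natArr 3 i = i).card) B1 (by simp [hE.order]) le_rfl
    (by decide) (by decide) (by decide) (by simp) ?_
  intro a ha s' hB' h13 hA' I
  have h3 : s'.natArr 3 = s.natArr 3 := by
    rw [hA'.natArr 3 (by decide), Store.natArr_setN]
  have hle : ((Finset.range a).filter fun i => s.natArr 3 i = i).card ≤ a := by
    simpa using Finset.card_filter_le (Finset.range a) fun i => s.natArr 3 i = i
  have hnX : n ≤ c.X := by rw [← hE.order]; exact hB.natVar 0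
  refine Tri.ite hh hB' le_rfl (fun hb => ?_) (fun hb => ?_)
  · refine Tri.natSet hB' le_rfl _ rfl ?_ ?_
    · simp [I]; omega
    · simp [h13, h3] at hb
      simp [I, Finset.range_add_one, Finset.filter_insert, hb]
  · refine Tri.skip hB' c.one_le_U ?_
    simp [h13, h3] at hb
    simp [I, Finset.range_add_one, Finset.filter_insert, hb]

/-- The rows of `A`, extended by a constant column and the row index. -/
def extRows (n : ℕ) (A : ℕ → K) (j y : ℕ) : K :=
  if y < n then A (j * n + y) else if y = n then 1 else (j : K)

theorem rows_spec (hh : IsHeight c.w c.h) (hB : Bdd c s) (hE : Env n A B s) (hF : n + 2 ≤ c.F) :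
    Tri c rowsP s ((n * (n + 2) + 1) * c.U) fun s' => HoldsRows n (n + 2) 0 (extRows n A) s' := by
  have hcast : ∀ m : ℕ, m < n + 2 → c.h (m : K) ≤ c.F := fun m hm =>
    (hh.natCast_le m).trans (by have := size_le_self m; omega)
  refine Tri.mono (Tri.forTo hh (fun a s' => ∀ i < a, s'.fldArr 2 i =
    extRows n A (i / (n + 2)) (i % (n + 2))) hB hE.area le_rfl (by decide) (by decide) (by decide)
    (fun i h => absurd h (by omega)) ?_) le_rfl ?_
  · intro a ha s' hB' h13 hA' I
    have hE' := hE.agree hA' (by decide) (by decide)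
    have hr := row_lt ha
    have hc := col_lt ha
    have fin : ∀ e : FldExpr, e.eval s' = extRows n A (a / (n + 2)) (a % (n + 2)) →
        c.h (e.eval s') ≤ c.F → Tri c (.fldPut 2 (.var 13) e) s' c.U (fun s'' =>
          ∀ i < a + 1, (s''.setN 13 (a + 1)).fldArr 2 i =
            extRows n A (i / (n + 2)) (i % (n + 2))) := by
      intro e he hF
      refine Tri.fldPut hh hB' le_rfl a _ (by simp [h13]) rfl hF ?_
      intro i hi
      rcases Nat.lt_succ_iff_lt_or_eq.1 hi with h | h
      · simp [h.ne, I i h]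
      · subst h; simp [he]
    refine Tri.ite hh hB' le_rfl (fun hb => ?_) (fun hb => ?_)
    · simp [h13, hE'.order, hE'.width] at hb
      refine fin _ ?_ ?_
      · simp [h13, hE'.order, hE'.width, hE'.fst, extRows, hb]
      · exact hB'.fldArr _ _
    refine Tri.ite hh hB' le_rfl (fun hb1 => ?_) (fun hb1 => ?_)
    · simp [h13, hE'.order, hE'.width] at hb hb1
      refine fin _ ?_ ?_
      · simp [extRows, hb1]
      · exact hcast 1 (by omega)
    · simp [h13, hE'.order, hE'.width] at hb hb1
      refine fin _ ?_ ?_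
      · simp [h13, hE'.width, extRows, hb.not_gt, hb1]
      · simp only [FldExpr.eval_ofNat, NatExpr.eval_div, NatExpr.eval_var, h13, hE'.width]
        exact hcast _ (by omega)
  · intro s' _ _ I j hj y hy
    rw [zero_add, I _ (flat_lt hj hy), flat_row hy, flat_col hy]

/-- The crude factor 5 per pivot suffices: with M pivots the growth 5 ^ M is of the same kind as the
number of candidates, so no determinant bounds are needed. -/
theorem height_pivot_le (hh : IsHeight c.w c.h) {R : ℕ → ℕ → K} {w j₀ x f : ℕ} (hf1 : 1 ≤ f)
    (hj : j₀ < n) (hx : x < w) (hf : ∀ j < n, ∀ y < w, c.h (R j y) ≤ f) :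
    ∀ j < n, ∀ y < w, c.h (pivot R j₀ x j y) ≤ 5 * f := by
  intro j hj' y hy
  have h1 := hh.sub_le (R j y) (R j x / R j₀ x * R j₀ y)
  have h2 := hh.mul_le (R j x / R j₀ x) (R j₀ y)
  have h3 := hh.div_le (R j x) (R j₀ x)
  have := hf j hj' y hy
  have := hf j hj' x hx
  have := hf j₀ hj x hx
  have := hf j₀ hj y hy
  unfold pivot
  omega

/-- One scan of the entries suffices: a pivot annihilates its own row and leaves zero rows zero, so
everything already passed stays zero. Each pivot lowers the rank by one, until nothing is left. The
labels that `step` moves along play no role here. -/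
theorem rank_spec (hh : IsHeight c.w c.h) (hB : Bdd c s) (hE : Env n A B s) {R : ℕ → ℕ → K}
    {f : ℕ} (hf1 : 1 ≤ f) (hR : HoldsRows n (n + 2) 0 R s)
    (hq : HoldsLabels n (n + 2) 0 (fun _ => 0) s) (h7 : s.natVar 7 = 0) (h8 : s.natVar 8 = 0)
    (hf : ∀ j < n, ∀ y < n + 2, c.h (R j y) ≤ f) (hF : 5 ^ (rk n (n + 2) R) * f ≤ c.F)
    (hX : rk n (n + 2) R * (n * (n + 2)) ≤ c.X) (hX' : rk n (n + 2) R ≤ c.X) :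
    Tri c rankP s ((n * (n + 2) + 1) * ((n * (n + 2) + 1) * c.U)) fun s' =>
      s'.natVar 15 = rk n (n + 2) R ∧
      ∀ y < n * (n + 2), s'.fldArr 2 y = s.fldArr 2 y := by
  set D := n * (n + 2) with hD
  set rr := rk n (n + 2) R with hrr
  have hU : c.U ≤ (D + 1) * c.U := Nat.le_mul_of_pos_left _ (by omega)
  have hU' : c.U ≤ (D + 1) * ((D + 1) * c.U) := hU.trans (Nat.le_mul_of_pos_left _ (by omega))
  refine Tri.natSet_seq hB hU' 0 rfl (by omega) fun B1 => ?_
  refine Tri.natSet_seq B1 hU' 0 rfl (by omega) fun B2 => ?_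
  set s₂ := (s.setN 15 0).setN 4 0 with hs₂
  have hE₂ : Env n A B s₂ := by
    constructor <;> simp [hs₂, hE.order, hE.width, hE.area, hE.square, hE.base, hE.fst, hE.snd]
  -- The k-th matrix is stored at offset k * D, so the original at offset 0 remains available for
  -- the search.
  refine Tri.mono (Tri.forTo hh (fun a s' => ∃ (k : ℕ) (R' : ℕ → ℕ → K) (q : ℕ → ℕ),
      s'.natVar 15 = k ∧ s'.natVar 4 = k * D ∧ HoldsRows n (n + 2) (k * D) R' s' ∧
      HoldsLabels n (n + 2) (k * D) q s' ∧ rk n (n + 2) R' + k = rr ∧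
      (∀ i < a, R' (i / (n + 2)) (i % (n + 2)) = 0) ∧
      (∀ j < n, ∀ y < n + 2, c.h (R' j y) ≤ 5 ^ k * f) ∧
      (∀ y < D, s'.fldArr 2 y = s.fldArr 2 y)) B2 hE₂.area hU
    (by decide) (by decide) (by decide) ?_ ?_) le_rfl ?_
  · refine ⟨0, R, fun _ => 0, by simp [hs₂], by simp [hs₂], by rwa [zero_mul], by rwa [zero_mul],
      by simp [hrr], fun i h => absurd h (by omega), by simpa using hf, fun _ _ => rfl⟩
  · rintro a ha s' hB' h13 hA' ⟨k, R', q, i15, i4, iR, iq, irk, iz, ih, i0⟩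
    have hE' := hE₂.agree hA' (by decide) (by decide)
    have g7 : s'.natVar 7 = 0 := (hA'.natVar 7 (by decide)).trans (by simp [hs₂, h7])
    have g8 : s'.natVar 8 = 0 := (hA'.natVar 8 (by decide)).trans (by simp [hs₂, h8])
    have hr := row_lt ha
    have hc := col_lt ha
    have hrc := row_col a (n + 2)
    have hval : s'.fldArr 2 (k * D + a) = R' (a / (n + 2)) (a % (n + 2)) := by
      conv_lhs => rw [← hrc]
      exact iR _ hr _ hc
    refine Tri.ite hh hB' hU (fun hb => ?_) (fun hb => ?_)
    · have hne : R' (a / (n + 2)) (a % (n + 2)) ≠ 0 := by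
        intro h0
        simp [i4, h13, hval, h0] at hb
      have hrk := rk_pivot hr hc hne
      have hk : (k + 1) * D ≤ rr * D := Nat.mul_le_mul_right _ (by omega)
      have hkD : (k + 1) * D = k * D + D := by ring
      have hnD : n ≤ D := by rw [hD]; nlinarith
      have hnX : n + 2 ≤ c.X := hE'.width ▸ hB'.natVar 1
      refine Tri.natSet_seq hB' hU (a / (n + 2)) (by simp [h13, hE'.width]) (by omega) fun B3 => ?_
      refine Tri.natSet_seq B3 hU (a % (n + 2)) (by simp [h13, hE'.width]) (by omega) fun B4 => ?_
      refine Tri.natSet_seq B4 hU ((k + 1) * D) (by simp [hE'.area, i4, hD]; ring)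
        (by omega) fun B5 => ?_
      refine Tri.natSet_seq B5 hU (k * D) (by simp [i4]) (by omega) fun B6 => ?_
      set s₃ := (((s'.setN 9 (a / (n + 2))).setN 10 (a % (n + 2))).setN 5 ((k + 1) * D)).setN 6
        (k * D) with hs₃
      have hpow : 5 ^ (k + 1) * f ≤ 5 ^ rr * f :=
        Nat.mul_le_mul_right _ (Nat.pow_le_pow_right (by norm_num) (by omega))
      have hf5 : 4 * (5 ^ k * f) + 1 ≤ c.F := by
        have h1 : 1 ≤ 5 ^ k * f := Nat.mul_pos (by positivity) hf1
        have h2 : 5 ^ (k + 1) * f = 5 * (5 ^ k * f) := by rw [pow_succ]; ring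
        omega
      refine Tri.seq (step_spec hh B6 (n := n) (w := n + 2) (src := k * D) (dst := (k + 1) * D)
        (lsrc := k * D) (p := 0) (r := 0) (j₀ := a / (n + 2)) (x := a % (n + 2)) (f := 5 ^ k * f)
        (R := R') (q := q)
        (by simp [hs₃, hE'.width]) (by simp [hs₃, hE'.area]) (by simp [hs₃, i4]) (by simp [hs₃])
        (by simp [hs₃]) (by simp [hs₃, g7]) (by simp [hs₃, g8]) (by simp [hs₃]) (by simp [hs₃])
        hr hc (by omega) (by omega) iR iq ih hf5) ?_
      rintro s₄ B7 A7 ⟨j1, j2, j3, j4⟩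
      have k5 : s₄.natVar 5 = (k + 1) * D := (A7.natVar 5 (by decide)).trans (by simp [hs₃])
      have k15 : s₄.natVar 15 = k := (A7.natVar 15 (by decide)).trans (by simp [hs₃, i15])
      refine Tri.natSet_seq B7 hU ((k + 1) * D) (by simp [k5]) (by omega) fun B8 => ?_
      refine Tri.natSet B8 hU (k + 1) (by simp [k15]) (by omega) ?_
      refine ⟨k + 1, pivot R' (a / (n + 2)) (a % (n + 2)), _, by simp, by simp, j3, j4,
        by omega, ?_, ?_, ?_⟩
      · intro i hi
        by_cases hrow : i / (n + 2) = a / (n + 2)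
        · rw [hrow]; exact pivot_self hne _
        · have hlt : i / (n + 2) < a / (n + 2) := by
            have : i / (n + 2) ≤ a / (n + 2) := Nat.div_le_div_right (by omega)
            omega
          have hz : ∀ y < n + 2, R' (i / (n + 2)) y = 0 := by
            intro y hy
            have hlt' : i / (n + 2) * (n + 2) + y < a := by
              have : (i / (n + 2)) * (n + 2) + (n + 2) ≤ a / (n + 2) * (n + 2) := by
                rw [← Nat.succ_mul]; exact Nat.mul_le_mul_right _ hlt
              omega
            have := iz _ hlt'
            rwa [flat_row hy, flat_col hy] at this
          rw [pivot_of_eq_zero (hz _ hc)]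
          exact hz _ (Nat.mod_lt _ (by omega))
      · intro j hj y hy
        have := height_pivot_le hh (Nat.mul_pos (by positivity) hf1) hr hc ih j hj y hy
        rw [pow_succ]; linarith
      · intro y hy
        have h1 : s₄.fldArr 2 y = s₃.fldArr 2 y := j1 y (by omega)
        simpa [h1, hs₃] using i0 y hy
    · refine Tri.skip hB' (c.one_le_U.trans hU) ?_
      refine ⟨k, R', q, by simpa using i15, by simpa using i4, iR, iq, irk, ?_, ih, i0⟩
      intro i hi
      rcases Nat.lt_succ_iff_lt_or_eq.1 hi with h | h
      · exact iz i h
      · subst h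
        simp [i4, h13, hval] at hb
        exact le_antisymm hb.1 hb.2
  · rintro s' - - ⟨k, R', q, i15, i4, iR, iq, irk, iz, ih, i0⟩
    refine ⟨?_, i0⟩
    have : rk n (n + 2) R' = 0 := rk_eq_zero fun j hj y hy => by
      have := iz _ (flat_lt hj hy)
      rwa [flat_row hy, flat_col hy] at this
    omega

theorem bound_spec (hh : IsHeight c.w c.h) (hB : Bdd c s) (hE : Env n A B s) {k p : ℕ}
    (h15 : s.natVar 15 = k) (h14 : s.natVar 14 = p) (hX1 : k * p * p ≤ c.X)
    (hX : ∀ t ≤ k * p * p, baseOf n ^ t ≤ c.X) :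
    Tri c boundP s ((k * p * p + 1) * c.U) fun s' =>
      s'.natVar 16 = k * p * p ∧ s'.natVar 17 = baseOf n ^ (k * p * p) := by
  have hU : c.U ≤ (k * p * p + 1) * c.U := Nat.le_mul_of_pos_left _ (by omega)
  refine Tri.natSet_seq hB hU (k * p * p) (by simp [h15, h14]) hX1 fun B1 => ?_
  refine Tri.natSet_seq B1 hU 1 rfl (by simpa using hX 0 (by omega)) fun B2 => ?_
  set s₂ := (s.setN 16 (k * p * p)).setN 17 1 with hs₂
  have hE₂ : Env n A B s₂ := by
    constructor <;> simp [hs₂, hE.order, hE.width, hE.area, hE.square, hE.base, hE.fst, hE.snd]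
  refine Tri.mono (Tri.forTo hh (fun t s' => s'.natVar 17 = baseOf n ^ t) B2 (N := k * p * p)
    (by simp [hs₂]) le_rfl (by decide) (by decide) (by decide) (by simp [hs₂]) ?_) le_rfl ?_
  · intro t ht s' hB' h13 hA' I
    have hE' := hE₂.agree hA' (by decide) (by decide)
    refine Tri.natSet hB' le_rfl (baseOf n ^ (t + 1)) ?_ (hX _ ht) (by simp)
    simp [I, hE'.base, pow_succ]
  · intro s' _ hA' h
    exact ⟨(hA'.natVar 16 (by decide)).trans (by simp [hs₂]), h⟩

end Specs

/-! ### Correctness and cost of evaluating one candidate -/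

section Search

variable {K : Type} [Field K] [LinearOrder K]

/-- The instruction with a given code. -/
def decode (n u : ℕ) : Instr where
  c := u % n
  r := u / n % n
  j := u / n / n % n
  x := u / n / n / n % (n + 2)
  keep := u / n / n / n / (n + 2) % 2 = 1

/-- The state of the labelling procedure after `t` steps of the candidate `g`. -/
def stage (n : ℕ) (R₀ : ℕ → ℕ → K) (q₀ : ℕ → ℕ) (g : ℕ) : ℕ → (ℕ → ℕ → K) × (ℕ → ℕ)
  | 0 => (R₀, q₀)
  | t + 1 => (decode n (g / baseOf n ^ t % baseOf n)).apply R₀ (stage n R₀ q₀ g t)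

variable {c : Bounds K} {s : Store K} {n : ℕ} {A B : ℕ → K}

theorem height_stage_le (hh : IsHeight c.w c.h) (hn : 0 < n) {R₀ : ℕ → ℕ → K} {q₀ : ℕ → ℕ}
    {g f : ℕ} (hf1 : 1 ≤ f) (hf : ∀ j < n, ∀ y < n + 2, c.h (R₀ j y) ≤ f) (t : ℕ) :
    ∀ j < n, ∀ y < n + 2, c.h ((stage n R₀ q₀ g t).1 j y) ≤ 5 ^ t * f := by
  induction t with
  | zero => simpa [stage] using hf
  | succ t ih =>
    intro j hj y hy
    have hpos : 1 ≤ 5 ^ t := Nat.one_le_pow _ _ (by norm_num)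
    have h1 : 1 ≤ 5 ^ t * f := Nat.mul_pos hpos hf1
    have h2 : f ≤ 5 ^ t * f := Nat.le_mul_of_pos_left _ hpos
    have h3 := height_pivot_le hh (n := n) (w := n + 2) h1
      (R := if (decode n (g / baseOf n ^ t % baseOf n)).keep then (stage n R₀ q₀ g t).1 else R₀)
      (j₀ := (decode n (g / baseOf n ^ t % baseOf n)).j)
      (x := (decode n (g / baseOf n ^ t % baseOf n)).x) (Nat.mod_lt _ hn)
      (Nat.mod_lt _ (by omega)) (by
        intro j hj y hy
        split_ifs
        · exact ih j hj y hy
        · exact (hf j hj y hy).trans h2) j hj y hy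
    rw [pow_succ, mul_comm (5 ^ t), mul_assoc]
    exact h3

theorem labels_spec (hh : IsHeight c.w c.h) (hB : Bdd c s) (hE : Env n A B s) {R₀ : ℕ → ℕ → K}
    {g M f : ℕ} (hf1 : 1 ≤ f) (hR : HoldsRows n (n + 2) 0 R₀ s) (hg : s.natVar 19 = g)
    (hM : s.natVar 16 = M) (hMn : 0 < M → 0 < n)
    (hf : ∀ j < n, ∀ y < n + 2, c.h (R₀ j y) ≤ f) (hF : 5 ^ M * f ≤ c.F)
    (hX : M * (n * (n + 2)) ≤ c.X) :
    Tri c labelsP s ((M + 1) * ((n * (n + 2) + 1) * c.U)) fun s' =>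
      HoldsLabels n (n + 2) (M * (n * (n + 2))) (stage n R₀ (fun _ => s.natArr 3 0) g M).2 s' ∧
      ∀ y < n * (n + 2), s'.fldArr 2 y = s.fldArr 2 y := by
  set D := n * (n + 2) with hD
  set q₀ : ℕ → ℕ := fun _ => s.natArr 3 0 with hq₀
  have hU : c.U ≤ (D + 1) * c.U := Nat.le_mul_of_pos_left _ (by omega)
  have hU' : (D + 1) * c.U ≤ (M + 1) * ((D + 1) * c.U) := Nat.le_mul_of_pos_left _ (by omega)
  refine Tri.natSet_seq hB (hU.trans hU') g (by simp [hg]) (hg ▸ hB.natVar 19) fun B1 => ?_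
  have hE₁ : Env n A B (s.setN 20 g) := by
    constructor <;> simp [hE.order, hE.width, hE.area, hE.square, hE.base, hE.fst, hE.snd]
  refine Tri.seq (R := fun s' => ∀ i < D, s'.natArr 1 i = s.natArr 3 0)
    ((Tri.forTo hh (fun a s' => ∀ i < a, s'.natArr 1 i = s.natArr 3 0) B1 hE₁.area le_rfl
      (by decide) (by decide) (by decide) (fun i h => absurd h (by omega)) ?_).mono hU'
      fun _ _ _ h => h) ?_
  · intro a ha s' hB' h13 hA' I
    have h3 : s'.natArr 3 0 = s.natArr 3 0 := by
      rw [hA'.natArr 3 (by decide)]; rfl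
    refine Tri.natPut hB' le_rfl a _ (by simp [h13]) (by simp [h3]) (h3 ▸ hB'.natArr 3 0) ?_
    intro i hi
    rcases Nat.lt_succ_iff_lt_or_eq.1 hi with h | h
    · simp [h.ne, I i h]
    · subst h; simp
  intro s₁ B2 A1 hl
  have hE₂ := hE₁.agree A1 (by decide) (by decide)
  have hM₂ : s₁.natVar 16 = M := (A1.natVar 16 (by decide)).trans (by simp [hM])
  have h20 : s₁.natVar 20 = g := (A1.natVar 20 (by decide)).trans (by simp)
  have hS₂ : s₁.fldArr 2 = s.fldArr 2 := A1.fldArr 2 (by decide)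
  refine Tri.mono (Tri.forTo hh (fun t s' => s'.natVar 20 = g / baseOf n ^ t ∧
      HoldsRows n (n + 2) (t * D) (stage n R₀ q₀ g t).1 s' ∧
      HoldsLabels n (n + 2) (t * D) (stage n R₀ q₀ g t).2 s' ∧
      ∀ y < D, s'.fldArr 2 y = s.fldArr 2 y) B2 hM₂ hU (by decide) (by decide) (by decide)
      ?_ ?_) le_rfl ?_
  · refine ⟨by simp [h20], ?_, ?_, fun y _ => by simp [hS₂]⟩
    · intro j hj y hy
      simpa [hS₂, stage] using hR j hj y hy
    · intro j hj y hy
      simpa [stage, hq₀] using hl _ (flat_lt hj hy)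
  · rintro t ht s' hB' h21 hA' ⟨i20, iR, iq, i0⟩
    have hE' := hE₂.agree hA' (by decide) (by decide)
    have hn : 0 < n := hMn (by omega)
    set u := g / baseOf n ^ t % baseOf n with hu
    set I := decode n u with hI
    have hgX : g ≤ c.X := hg ▸ hB.natVar 19
    have hnX : n + 2 ≤ c.X := hE'.width ▸ hB'.natVar 1
    have huX : u ≤ c.X := (Nat.mod_le _ _).trans ((Nat.div_le_self _ _).trans hgX)
    have htM : (t + 1) * D ≤ M * D := Nat.mul_le_mul_right _ ht
    have htD : (t + 1) * D = t * D + D := by ring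
    have hI1 : u % n ≤ c.X := (Nat.mod_le _ _).trans huX
    have hI2 : u / n % n < n := Nat.mod_lt _ hn
    have hI3 : u / n / n % n < n := Nat.mod_lt _ hn
    have hI4 : u / n / n / n % (n + 2) < n + 2 := Nat.mod_lt _ (by omega)
    refine Tri.natSet_seq hB' hU u (by simp [i20, hE'.base, hu]) huX fun B3 => ?_
    refine Tri.natSet_seq B3 hU (g / baseOf n ^ (t + 1))
      (by simp [i20, hE'.base, Nat.div_div_eq_div_mul, pow_succ])
      ((Nat.div_le_self _ _).trans hgX) fun B4 => ?_
    refine Tri.natSet_seq B4 hU (u % n) (by simp [hE'.order]) hI1 fun B5 => ?_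
    refine Tri.natSet_seq B5 hU (u / n % n) (by simp [hE'.order]) (by omega) fun B6 => ?_
    refine Tri.natSet_seq B6 hU (u / n / n % n) (by simp [hE'.order]) (by omega) fun B7 => ?_
    refine Tri.natSet_seq B7 hU (u / n / n / n % (n + 2)) (by simp [hE'.order, hE'.width])
      (by omega) fun B8 => ?_
    refine Tri.natSet_seq B8 hU (t * D) (by simp [h21, hE'.area, hD]) (by omega) fun B9 => ?_
    refine Tri.natSet_seq B9 hU (u / n / n / n / (n + 2) % 2 * (t * D))
      (by simp [hE'.order, hE'.width]) ?_ fun B10 => ?_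
    · have : u / n / n / n / (n + 2) % 2 * (t * D) ≤ 1 * (t * D) :=
        Nat.mul_le_mul_right _ (by omega)
      omega
    refine Tri.natSet_seq B10 hU ((t + 1) * D) (by simp [hE'.area, hD]; ring) (by omega)
      fun B11 => ?_
    set R := if I.keep then (stage n R₀ q₀ g t).1 else R₀ with hRdef
    -- Multiplying by the last digit selects the offset of the current matrix or offset 0, where the
    -- initial matrix is kept; this replaces a conditional.
    set src := u / n / n / n / (n + 2) % 2 * (t * D) with hsrc
    have hsrc_le : src ≤ t * D := by
      have : u / n / n / n / (n + 2) % 2 * (t * D) ≤ 1 * (t * D) :=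
        Nat.mul_le_mul_right _ (by omega)
      omega
    have hRs : HoldsRows n (n + 2) src R s' := by
      have hk : I.keep = decide (u / n / n / n / (n + 2) % 2 = 1) := rfl
      by_cases h1 : u / n / n / n / (n + 2) % 2 = 1
      · simp only [hRdef, hk, h1, decide_true, if_true, hsrc, one_mul]
        exact iR
      · have h0 : u / n / n / n / (n + 2) % 2 = 0 := by omega
        simp only [hRdef, hk, hsrc, h0, zero_mul]
        intro j hj y hy
        have := hR j hj y hy
        rw [zero_add] at this ⊢
        simpa [i0 _ (flat_lt hj hy)] using this
    have hfR : ∀ j < n, ∀ y < n + 2, c.h (R j y) ≤ 5 ^ t * f := by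
      intro j hj y hy
      simp only [hRdef]
      split_ifs
      · exact height_stage_le hh hn hf1 hf t j hj y hy
      · exact (hf j hj y hy).trans (Nat.le_mul_of_pos_left _ (by positivity))
    have hf5 : 4 * (5 ^ t * f) + 1 ≤ c.F := by
      have h1 : 1 ≤ 5 ^ t * f := Nat.mul_pos (by positivity) hf1
      have h2 : 5 ^ (t + 1) * f = 5 * (5 ^ t * f) := by rw [pow_succ]; ring
      have h3 : 5 ^ (t + 1) * f ≤ 5 ^ M * f :=
        Nat.mul_le_mul_right _ (Nat.pow_le_pow_right (by norm_num) (by omega))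
      omega
    refine Tri.mono (step_spec hh B11 (n := n) (w := n + 2) (src := src) (dst := (t + 1) * D)
      (lsrc := t * D) (p := I.c) (r := I.r) (j₀ := I.j) (x := I.x) (f := 5 ^ t * f)
      (R := R) (q := (stage n R₀ q₀ g t).2)
      (by simp [hE'.width]) (by simp [hE'.area, hD]) (by simp) (by simp) (by simp)
      (by simp [hI, decode]) (by simp [hI, decode]) (by simp [hI, decode]) (by simp [hI, decode])
      hI3 hI4 (by omega) (by omega) hRs iq hfR hf5) le_rfl ?_
    rintro s₄ B12 A12 ⟨j1, j2, j3, j4⟩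
    refine ⟨?_, j3, j4, ?_⟩
    · have := A12.natVar 20 (by decide)
      simpa using this
    · intro y hy
      have := j1 y (by omega)
      simp only [Store.fldArr_setN] at this ⊢
      rw [this, i0 y hy]
  · rintro s' - - ⟨-, -, iq, i0⟩
    exact ⟨iq, i0⟩

/-- The greedy matching is specified for arbitrary labels, because most candidates are wrong: a
position is served, or no later position holds a suitable row. -/
theorem perm_spec (hh : IsHeight c.w c.h) (hB : Bdd c s) (hE : Env n A B s) {M : ℕ} {q : ℕ → ℕ}
    (hM : s.natVar 16 = M) (hq : HoldsLabels n (n + 2) (M * (n * (n + 2))) q s) :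
    Tri c permP s ((n * n + 1) * c.U) fun s' => ∃ π : Equiv.Perm (Fin n),
      (∀ i : Fin n, s'.natArr 2 i = π i) ∧
      ∀ i j : Fin n, i ≤ j → q (π i) = s.natArr 3 i ∨ q (π j) ≠ s.natArr 3 i := by
  have hU : (n + 1) * c.U ≤ (n * n + 1) * c.U := Nat.mul_le_mul_right _ (by nlinarith)
  refine Tri.seq (R := fun s' => ∀ i < n, s'.natArr 2 i = i)
    ((Tri.forTo hh (fun a s' => ∀ i < a, s'.natArr 2 i = i) hB hE.order le_rfl
      (by decide) (by decide) (by decide) (fun i h => absurd h (by omega)) ?_).mono hU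
      fun _ _ _ h => h) ?_
  · intro a ha s' hB' h13 hA' I
    refine Tri.natPut hB' le_rfl a a (by simp [h13]) (by simp [h13]) (h13 ▸ hB'.natVar 13) ?_
    intro i hi
    rcases Nat.lt_succ_iff_lt_or_eq.1 hi with h | h
    · simp [h.ne, I i h]
    · subst h; simp
  intro s₁ B1 A1 hid
  have hE₁ := hE.agree A1 (by decide) (by decide)
  have h1 : s₁.natArr 1 = s.natArr 1 := A1.natArr 1 (by decide)
  have h3 : s₁.natArr 3 = s.natArr 3 := A1.natArr 3 (by decide)
  have hM₁ : s₁.natVar 16 = M := (A1.natVar 16 (by decide)).trans hM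
  refine Tri.mono (Tri.forTo hh (fun a s' => ∃ π : Equiv.Perm (Fin n),
      (∀ i : Fin n, s'.natArr 2 i = π i) ∧ ∀ i j : Fin n, i ≤ j → (i : ℕ) * n + j < a →
        q (π i) = s.natArr 3 i ∨ q (π j) ≠ s.natArr 3 i) B1 hE₁.square le_rfl
    (by decide) (by decide) (by decide) ?_ ?_) le_rfl ?_
  · exact ⟨1, fun i => by simpa using hid i i.2, fun i j _ h => absurd h (by omega)⟩
  · rintro a ha s' hB' h13 hA' ⟨π, hπ, I⟩
    have hE' := hE₁.agree hA' (by decide) (by decide)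
    have g1 : s'.natArr 1 = s.natArr 1 := (hA'.natArr 1 (by decide)).trans h1
    have g3 : s'.natArr 3 = s.natArr 3 := (hA'.natArr 3 (by decide)).trans h3
    have g16 : s'.natVar 16 = M := (hA'.natVar 16 (by decide)).trans hM₁
    set i₀ : Fin n := ⟨a / n, row_lt ha⟩ with hi₀
    set j₀ : Fin n := ⟨a % n, col_lt ha⟩ with hj₀
    have hrc : (i₀ : ℕ) * n + j₀ = a := row_col a n
    have hpi : s'.natArr 2 (a / n) = π i₀ := hπ i₀
    have hpj : s'.natArr 2 (a % n) = π j₀ := hπ j₀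
    have hlab : s'.natArr 1 (M * (n * (n + 2)) + (π j₀ : ℕ) * (n + 2)) = q (π j₀) := by
      rw [g1]; exact hq (π j₀) (π j₀).2 0 (by omega)
    have hlast : ∀ i j : Fin n, (i : ℕ) * n + j < a + 1 → (i : ℕ) * n + j < a ∨
        (i = i₀ ∧ j = j₀) := by
      intro i j h
      by_cases hlt : (i : ℕ) * n + j < a
      · exact Or.inl hlt
      · right
        have he : (i : ℕ) * n + j = a := by omega
        constructor
        · apply Fin.ext
          simp only [hi₀, ← he]
          rw [flat_row j.2]
        · apply Fin.ext
          simp only [hj₀, ← he]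
          rw [flat_col j.2]
    refine Tri.ite hh hB' le_rfl (fun hb => ?_) (fun hb => ?_)
    · simp [h13, hE'.order, hE'.width, hE'.area, g16, hpj, hlab, g3] at hb
      obtain ⟨hij, hqj⟩ := hb
      have hle : i₀ ≤ j₀ := hij
      refine Tri.natSet_seq hB' le_rfl (π i₀ : ℕ) (by simp [h13, hE'.order, hpi])
        (hpi ▸ hB'.natArr 2 _) fun B2 => ?_
      refine Tri.natPut_seq B2 le_rfl (a / n) (π j₀ : ℕ) (by simp [h13, hE'.order])
        (by simp [h13, hE'.order, hpj]) (hpj ▸ hB'.natArr 2 _) fun B3 => ?_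
      refine Tri.natPut B3 le_rfl (a % n) (π i₀ : ℕ) (by simp [h13, hE'.order])
        (by simp) (hpi ▸ hB'.natArr 2 _) ?_
      refine ⟨π * Equiv.swap i₀ j₀, fun i => ?_, fun i j hle' hlt => ?_⟩
      · by_cases hij0 : i = j₀
        · subst hij0
          simp [hj₀]
        · have hij0' : (i : ℕ) ≠ a % n := fun h => hij0 (Fin.ext h)
          by_cases hii0 : i = i₀
          · subst hii0
            have : a / n ≠ a % n := hij0'
            simp [hi₀, this]
          · have hii0' : (i : ℕ) ≠ a / n := fun h => hii0 (Fin.ext h)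
            simp [hij0', hii0', hπ, Equiv.swap_apply_of_ne_of_ne hii0 hij0]
      · by_cases hii0 : i = i₀
        · left
          subst hii0
          simp only [Equiv.Perm.coe_mul, Function.comp, Equiv.swap_apply_left]
          exact hqj
        · have hlti : i < i₀ := by
            refine lt_of_le_of_ne ?_ hii0
            rcases hlast i j hlt with h | h
            · show (i : ℕ) ≤ a / n
              rw [Nat.le_div_iff_mul_le i.pos]
              omega
            · exact absurd h.1 hii0
          have hnej : i ≠ j₀ := (lt_of_lt_of_le hlti hle).ne
          -- Position i has been compared with all its successors. The swap moves only positions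
          -- beyond i, so it merely permutes the conditions for i.
          have hall : ∀ j' : Fin n, (i : ℕ) * n + j' < a := by
            intro j'
            have : (i : ℕ) * n + n ≤ i₀ * n := by
              rw [← Nat.succ_mul]; exact Nat.mul_le_mul_right _ hlti
            have := j'.2
            omega
          simp only [Equiv.Perm.coe_mul, Function.comp, Equiv.swap_apply_of_ne_of_ne hii0 hnej]
          refine I i _ ?_ (hall _)
          rcases eq_or_ne j i₀ with rfl | h1
          · rw [Equiv.swap_apply_left]; exact (lt_of_lt_of_le hlti hle).le
          · rcases eq_or_ne j j₀ with rfl | h2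
            · rw [Equiv.swap_apply_right]; exact hlti.le
            · rw [Equiv.swap_apply_of_ne_of_ne h1 h2]; exact hle'
    · refine Tri.skip hB' c.one_le_U ⟨π, by simpa using hπ, fun i j hle hlt => ?_⟩
      rcases hlast i j hlt with h | ⟨rfl, rfl⟩
      · exact I i j hle h
      · right
        simp [h13, hE'.order, hE'.width, hE'.area, g16, hpj, hlab, g3] at hb
        exact hb hle
  · rintro s' - - ⟨π, hπ, I⟩
    exact ⟨π, hπ, fun i j hle => I i j hle (flat_lt i.2 j.2)⟩

/-- The square of the objective. -/
def objSum (n : ℕ) (A B : ℕ → K) (π : ℕ → ℕ) : K :=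
  ∑ a ∈ Finset.range (n * n), (A (π (a / n) * n + π (a % n)) - B a) *
    (A (π (a / n) * n + π (a % n)) - B a)

theorem obj_spec (hh : IsHeight c.w c.h) (hB : Bdd c s) (hE : Env n A B s) {f : ℕ}
    (hA : ∀ a, c.h (A a) ≤ f) (hB' : ∀ a, c.h (B a) ≤ f)
    (hF : 1 + n * n * (4 * f + 3) ≤ c.F) (hF' : 2 * f + 1 ≤ c.F) :
    Tri c objP s ((n * n + 1) * c.U) fun s' => s'.fldVar 2 = objSum n A B (s.natArr 2) := by
  have hU : c.U ≤ (n * n + 1) * c.U := Nat.le_mul_of_pos_left _ (by omega)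
  have h0 : c.h (0 : K) ≤ 1 := by simpa using hh.natCast_le 0
  refine Tri.fldSet_seq hh hB hU 0 (by simp) (h0.trans (by omega)) fun B1 => ?_
  have hE₁ : Env n A B (s.setF 2 0) := by
    constructor <;> simp [hE.order, hE.width, hE.area, hE.square, hE.base, hE.fst, hE.snd]
  refine Tri.mono (Tri.forTo hh (fun a s' => s'.fldVar 2 =
      ∑ a ∈ Finset.range a, (A (s.natArr 2 (a / n) * n + s.natArr 2 (a % n)) - B a) *
        (A (s.natArr 2 (a / n) * n + s.natArr 2 (a % n)) - B a) ∧
      c.h (s'.fldVar 2) ≤ 1 + a * (4 * f + 3)) B1 hE₁.square le_rfl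
    (by decide) (by decide) (by decide) (by simpa using h0) ?_) le_rfl (fun s' _ _ h => h.1)
  rintro a ha s' B2 h13 hA' ⟨I1, I2⟩
  have hE' := hE₁.agree hA' (by decide) (by decide)
  have g2 : s'.natArr 2 = s.natArr 2 := hA'.natArr 2 (by decide)
  set x := A (s.natArr 2 (a / n) * n + s.natArr 2 (a % n)) - B a with hx
  have hhx : c.h x ≤ 2 * f + 1 := by
    have h1 := hh.sub_le (A (s.natArr 2 (a / n) * n + s.natArr 2 (a % n))) (B a)
    have h2 := hA (s.natArr 2 (a / n) * n + s.natArr 2 (a % n))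
    have h3 := hB' a
    rw [hx]
    omega
  have hsum : c.h (s'.fldVar 2 + x * x) ≤ 1 + (a + 1) * (4 * f + 3) := by
    have h1 := hh.add_le (s'.fldVar 2) (x * x)
    have h2 := hh.mul_le x x
    have h3 : (a + 1) * (4 * f + 3) = a * (4 * f + 3) + (4 * f + 3) := by ring
    omega
  refine Tri.fldSet_seq hh B2 le_rfl x (by simp [h13, hE'.order, hE'.fst, hE'.snd, g2, hx])
    (by omega) fun B3 => ?_
  refine Tri.fldSet hh B3 le_rfl (s'.fldVar 2 + x * x) (by simp) ?_ ⟨?_, by simpa using hsum⟩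
  · have : (a + 1) * (4 * f + 3) ≤ n * n * (4 * f + 3) := Nat.mul_le_mul_right _ ha
    omega
  · simp [Finset.sum_range_succ, I1, hx]

theorem best_spec (hh : IsHeight c.w c.h) (hB : Bdd c s) (hE : Env n A B s) :
    Tri c bestP s ((n + 1) * c.U) fun s' =>
      ((s.natVar 19 = 0 ∨ s.fldVar 2 < s.fldVar 0) ∧ s'.fldVar 0 = s.fldVar 2 ∧
        ∀ i < n, s'.natArr 0 i = s.natArr 2 i) ∨
      (¬ (s.natVar 19 = 0 ∨ s.fldVar 2 < s.fldVar 0) ∧ s' = s) := by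
  have hU : c.U ≤ (n + 1) * c.U := Nat.le_mul_of_pos_left _ (by omega)
  refine Tri.ite hh hB hU (fun hb => ?_) (fun hb => ?_)
  · simp at hb
    replace hb := hb.imp_right fun h => not_le.1 (of_decide_eq_false h)
    refine Tri.fldSet_seq hh hB hU (s.fldVar 2) (by simp) (hB.fldVar 2) fun B1 => ?_
    have hE₁ : Env n A B (s.setF 0 (s.fldVar 2)) := by
      constructor <;> simp [hE.order, hE.width, hE.area, hE.square, hE.base, hE.fst, hE.snd]
    refine Tri.mono (Tri.forTo hh (fun a s' => ∀ i < a, s'.natArr 0 i = s.natArr 2 i) B1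
      hE₁.order le_rfl (by decide) (by decide) (by decide) (fun i h => absurd h (by omega)) ?_)
      le_rfl ?_
    · intro a ha s' B2 h13 hA' I
      have g2 : s'.natArr 2 = s.natArr 2 := hA'.natArr 2 (by decide)
      refine Tri.natPut B2 le_rfl a (s'.natArr 2 a) (by simp [h13]) (by simp [h13]) ?_ ?_
      · exact B2.natArr 2 a
      intro i hi
      rcases Nat.lt_succ_iff_lt_or_eq.1 hi with h | h
      · simp [h.ne, I i h]
      · subst h; simp [g2]
    · intro s' _ hA' h
      exact Or.inl ⟨hb, (hA'.fldVar 0 (by decide)).trans (by simp), h⟩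
  · refine Tri.skip hB (c.one_le_U.trans hU) (Or.inr ⟨?_, rfl⟩)
    simp at hb
    exact not_or.2 ⟨hb.1, not_lt.2 (of_decide_eq_true hb.2)⟩

end Search

/-! ### Exhaustive search over all candidates -/

section Solve

variable {K : Type} [Field K] [LinearOrder K]

/-- The square of the objective of a permutation, for matrices stored row by row. -/
def objPerm (n : ℕ) (A B : ℕ → K) (π : Equiv.Perm (Fin n)) : K :=
  ∑ i : Fin n, ∑ j : Fin n, (A ((π i : ℕ) * n + π j) - B ((i : ℕ) * n + j)) ^ 2

theorem objSum_eq {n : ℕ} (A B : ℕ → K) {f : ℕ → ℕ} {π : Equiv.Perm (Fin n)}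
    (h : ∀ i : Fin n, f i = π i) : objSum n A B f = objPerm n A B π := by
  rw [objSum, objPerm, Finset.sum_range, ← finProdFinEquiv.sum_comp, Fintype.sum_prod_type]
  refine Finset.sum_congr rfl fun i _ => Finset.sum_congr rfl fun j _ => ?_
  have e : ((finProdFinEquiv (i, j) : Fin (n * n)) : ℕ) = i * n + j := by
    simp [finProdFinEquiv]; ring
  rw [e, flat_row j.2, flat_col j.2, h i, h j, sq]

/-- Every permutation that the search may derive from the labels of the candidate `g` is
optimal. -/
def GoodCandidate (n M : ℕ) (A B : ℕ → K) (cl : ℕ → ℕ) (g : ℕ) : Prop :=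
  ∀ π : Equiv.Perm (Fin n), (∀ i j : Fin n, i ≤ j →
      (stage n (extRows n A) (fun _ => cl 0) g M).2 (π i) = cl i ∨
      (stage n (extRows n A) (fun _ => cl 0) g M).2 (π j) ≠ cl i) →
    ∀ τ, objPerm n A B π ≤ objPerm n A B τ

/-- The memory holds a permutation, its objective, and both are optimal. -/
def HoldsOptimum (n : ℕ) (A B : ℕ → K) (s : Store K) : Prop :=
  ∃ π : Equiv.Perm (Fin n), (∀ i : Fin n, s.natArr 0 i = π i) ∧
    s.fldVar 0 = objPerm n A B π ∧ ∀ τ, objPerm n A B π ≤ objPerm n A B τ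

variable {c : Bounds K} {s : Store K} {n : ℕ} {A B : ℕ → K}

/-- The stored value is always attained by the stored permutation, and it drops to the optimum as
soon as a good candidate is met. Candidate 0 is accepted unconditionally, because no permutation is
stored before it. -/
theorem search_spec (hh : IsHeight c.w c.h) (hB : Bdd c s) (hE : Env n A B s)
    {N M f : ℕ} (hf1 : 1 ≤ f) (hR : HoldsRows n (n + 2) 0 (extRows n A) s)
    (hN : s.natVar 17 = N) (hM : s.natVar 16 = M) (hMn : 0 < M → 0 < n)
    (hf : ∀ j < n, ∀ y < n + 2, c.h (extRows n A j y) ≤ f) (hF : 5 ^ M * f ≤ c.F)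
    (hX : M * (n * (n + 2)) ≤ c.X) (hA : ∀ a, c.h (A a) ≤ f) (hB' : ∀ a, c.h (B a) ≤ f)
    (hF' : 1 + n * n * (4 * f + 3) ≤ c.F) (hF'' : 2 * f + 1 ≤ c.F)
    (hgood : ∃ g < N, GoodCandidate n M A B (s.natArr 3) g) :
    Tri c searchP s ((N + 1) * ((M + 1) * ((n * (n + 2) + 1) * c.U))) fun s' =>
      HoldsOptimum n A B s' := by
  set D := n * (n + 2) with hD
  have hnn : n * n ≤ D := by rw [hD]; nlinarith
  have hU1 : (D + 1) * c.U ≤ (M + 1) * ((D + 1) * c.U) := Nat.le_mul_of_pos_left _ (by omega)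
  have hU2 : (n * n + 1) * c.U ≤ (M + 1) * ((D + 1) * c.U) :=
    (Nat.mul_le_mul_right _ (by omega)).trans hU1
  have hU3 : (n + 1) * c.U ≤ (M + 1) * ((D + 1) * c.U) :=
    (Nat.mul_le_mul_right _ (by nlinarith)).trans hU2
  have hU0 : c.U ≤ (M + 1) * ((D + 1) * c.U) :=
    (Nat.le_mul_of_pos_left _ (by omega)).trans hU1
  refine Tri.mono (Tri.forTo hh (fun g s' =>
      (0 < g → ∃ π : Equiv.Perm (Fin n), (∀ i : Fin n, s'.natArr 0 i = π i) ∧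
        s'.fldVar 0 = objPerm n A B π) ∧
      ((∃ g' < g, GoodCandidate n M A B (s.natArr 3) g') →
        ∀ τ, s'.fldVar 0 ≤ objPerm n A B τ) ∧
      ∀ y < D, s'.fldArr 2 y = s.fldArr 2 y) hB hN hU0 (by decide) (by decide) (by decide)
      ?_ ?_) le_rfl ?_
  · exact ⟨fun h => absurd h (by omega), fun ⟨g', h, _⟩ => absurd h (by omega), fun _ _ => rfl⟩
  · rintro g hg s₀ B0 h19 A0 ⟨I1, I2, I3⟩
    have E0 := hE.agree A0 (by decide) (by decide)
    have cl0 : s₀.natArr 3 = s.natArr 3 := A0.natArr 3 (by decide)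
    have M0 : s₀.natVar 16 = M := (A0.natVar 16 (by decide)).trans hM
    have R0 : HoldsRows n (n + 2) 0 (extRows n A) s₀ := by
      intro j hj y hy
      have := hR j hj y hy
      rw [zero_add] at this ⊢
      rw [I3 _ (flat_lt hj hy), this]
    refine Tri.seq (labels_spec hh B0 E0 hf1 R0 h19 M0 hMn hf hF hX) ?_
    rintro s₁ B1 A1 ⟨L1, S1⟩
    have E1 := E0.agree A1 (by decide) (by decide)
    have cl1 : s₁.natArr 3 = s.natArr 3 := (A1.natArr 3 (by decide)).trans cl0
    have M1 : s₁.natVar 16 = M := (A1.natVar 16 (by decide)).trans M0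
    rw [cl0] at L1
    refine Tri.seq ((perm_spec hh B1 E1 M1 L1).mono hU2 fun _ _ _ h => h) ?_
    rintro s₂ B2 A2 ⟨π, hπ, hπ'⟩
    rw [cl1] at hπ'
    have E2 := E1.agree A2 (by decide) (by decide)
    refine Tri.seq ((obj_spec hh B2 E2 hA hB' hF' hF'').mono hU2 fun _ _ _ h => h) ?_
    intro s₃ B3 A3 hv
    have E3 := E2.agree A3 (by decide) (by decide)
    rw [objSum_eq A B hπ] at hv
    have g19 : s₃.natVar 19 = g := by
      rw [A3.natVar 19 (by decide), A2.natVar 19 (by decide), A1.natVar 19 (by decide), h19]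
    have hbest : s₃.fldVar 0 = s₀.fldVar 0 := by
      rw [A3.fldVar 0 (by decide), A2.fldVar 0 (by decide), A1.fldVar 0 (by decide)]
    have hres : s₃.natArr 0 = s₀.natArr 0 := by
      rw [A3.natArr 0 (by decide), A2.natArr 0 (by decide), A1.natArr 0 (by decide)]
    have hperm : s₃.natArr 2 = s₂.natArr 2 := A3.natArr 2 (by decide)
    have hS : ∀ y < D, s₃.fldArr 2 y = s.fldArr 2 y := by
      intro y hy
      rw [A3.fldArr 2 (by decide), A2.fldArr 2 (by decide), S1 y hy, I3 y hy]
    have hnew : GoodCandidate n M A B (s.natArr 3) g → ∀ τ, objPerm n A B π ≤ objPerm n A B τ :=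
      fun h => h π hπ'
    have hpos : 0 < g → s₀.fldVar 0 ≤ objPerm n A B π ∨ objPerm n A B π < s₀.fldVar 0 :=
      fun _ => le_or_gt _ _
    refine Tri.mono (best_spec hh B3 E3) hU3 ?_
    rintro s₄ B4 A4 (⟨h1, h2, h3⟩ | ⟨h1, rfl⟩)
    · refine ⟨fun _ => ⟨π, fun i => ?_, by simp [h2, hv]⟩, ?_, fun y hy => ?_⟩
      · rw [Store.natArr_setN, h3 i i.2, hperm, hπ]
      · rintro ⟨g', hg', hgd⟩ τ
        rw [Store.fldVar_setN, h2, hv]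
        rcases Nat.lt_succ_iff_lt_or_eq.1 hg' with h | rfl
        · have hlt : objPerm n A B π < s₀.fldVar 0 := by
            rcases h1 with h1 | h1
            · omega
            · rwa [hv, hbest] at h1
          exact hlt.le.trans (I2 ⟨g', h, hgd⟩ τ)
        · exact hnew hgd τ
      · rw [Store.fldArr_setN, A4.fldArr 2 (by decide), hS y hy]
    · push Not at h1
      rw [g19, hv, hbest] at h1
      obtain ⟨π', hπ1, hπ2⟩ := I1 (by omega)
      refine ⟨fun _ => ⟨π', fun i => by rw [Store.natArr_setN, hres, hπ1 i],
        by rw [Store.fldVar_setN, hbest, hπ2]⟩, ?_, hS⟩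
      rintro ⟨g', hg', hgd⟩ τ
      rw [Store.fldVar_setN, hbest]
      rcases Nat.lt_succ_iff_lt_or_eq.1 hg' with h | rfl
      · exact I2 ⟨g', h, hgd⟩ τ
      · exact h1.2.trans (hnew hgd τ)
  · rintro s' - - ⟨I1, I2, -⟩
    obtain ⟨g, hg, hgd⟩ := hgood
    obtain ⟨π, h1, h2⟩ := I1 (by omega)
    exact ⟨π, h1, h2, fun τ => h2 ▸ I2 ⟨g, hg, hgd⟩ τ⟩

/-- The number of clusters. -/
def repCount (n : ℕ) (cl : ℕ → ℕ) : ℕ := ((Finset.range n).filter fun i => cl i = i).card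

theorem solve_spec (hh : IsHeight c.w c.h) (hB : Bdd c s) {k p f : ℕ} (h0 : s.natVar 0 = n)
    (hA0 : s.fldArr 0 = A) (hB0 : s.fldArr 1 = B) (h7 : s.natVar 7 = 0) (h8 : s.natVar 8 = 0)
    (hl : s.natArr 1 = fun _ => 0) (hf1 : 1 ≤ f)
    (hk : rk n (n + 2) (extRows n A) = k) (hp : ∀ cl, IsRep n B cl → repCount n cl = p)
    (hf : ∀ j < n, ∀ y < n + 2, c.h (extRows n A j y) ≤ f)
    (hA : ∀ a, c.h (A a) ≤ f) (hB' : ∀ a, c.h (B a) ≤ f)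
    (hF1 : n + 2 ≤ c.F) (hF2 : 5 ^ k * f ≤ c.F) (hF3 : 5 ^ (k * p * p) * f ≤ c.F)
    (hF4 : 1 + n * n * (4 * f + 3) ≤ c.F) (hF5 : 2 * f + 1 ≤ c.F)
    (hX1 : n * (n + 2) ≤ c.X) (hX2 : n + 2 ≤ c.X) (hX3 : ∀ t ≤ k * p * p, baseOf n ^ t ≤ c.X)
    (hX4 : baseOf n ≤ c.X) (hX5 : k * (n * (n + 2)) ≤ c.X)
    (hX6 : k * p * p * (n * (n + 2)) ≤ c.X) (hX7 : k ≤ c.X) (hX8 : k * p * p ≤ c.X)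
    (hgood : ∀ cl, IsRep n B cl → ∃ g < baseOf n ^ (k * p * p),
      GoodCandidate n (k * p * p) A B cl g) :
    Tri c solveP s ((baseOf n ^ (k * p * p) + 1) * ((k * p * p + 1) *
      ((n * (n + 2) + 1) * ((n * (n + 2) + 1) * c.U)))) fun s' => HoldsOptimum n A B s' := by
  set D := n * (n + 2) with hD
  set M := k * p * p with hM
  set N := baseOf n ^ M with hN
  set Z := (N + 1) * ((M + 1) * ((D + 1) * ((D + 1) * c.U))) with hZ
  have hnn : n * n ≤ D := by rw [hD]; nlinarith
  have hz0 : (D + 1) * c.U ≤ (D + 1) * ((D + 1) * c.U) := Nat.le_mul_of_pos_left _ (by omega)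
  have hz1 : (M + 1) * ((D + 1) * ((D + 1) * c.U)) ≤ Z := Nat.le_mul_of_pos_left _ (by omega)
  have hz2 : (D + 1) * ((D + 1) * c.U) ≤ Z := (Nat.le_mul_of_pos_left _ (by omega)).trans hz1
  have hz3 : (D + 1) * c.U ≤ Z := hz0.trans hz2
  have hz4 : (n * n + 1) * c.U ≤ Z := (Nat.mul_le_mul_right _ (by omega)).trans hz3
  have hz5 : (n + 1) * c.U ≤ Z := (Nat.mul_le_mul_right _ (by nlinarith)).trans hz4
  have hz6 : c.U ≤ Z := (Nat.le_mul_of_pos_left _ (by omega)).trans hz5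
  have hz7 : (M + 1) * c.U ≤ Z := by
    refine le_trans (Nat.mul_le_mul_left _ ?_) hz1
    exact (Nat.le_mul_of_pos_left _ (by omega)).trans hz0
  have hz8 : (N + 1) * ((M + 1) * ((D + 1) * c.U)) ≤ Z :=
    Nat.mul_le_mul_left _ (Nat.mul_le_mul_left _ hz0)
  refine Tri.seq ((setup_spec hB h0 hA0 hB0 hX2 hX1 (hnn.trans hX1) hX4).mono hz6
    fun _ _ _ h => h) ?_
  intro s₁ B1 A1 E1
  refine Tri.seq ((cluster_spec hh B1 E1).mono hz4 fun _ _ _ h => h) ?_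
  intro s₂ B2 A2 hrep
  have E2 := E1.agree A2 (by decide) (by decide)
  set cl := s₂.natArr 3 with hcl
  refine Tri.seq ((count_spec hh B2 E2).mono hz5 fun _ _ _ h => h) ?_
  intro s₃ B3 A3 hcount
  have E3 := E2.agree A3 (by decide) (by decide)
  have hcount' : s₃.natVar 14 = p := hcount.trans (hp cl hrep)
  refine Tri.seq ((rows_spec hh B3 E3 hF1).mono hz3 fun _ _ _ h => h) ?_
  intro s₄ B4 A4 R4
  have E4 := E3.agree A4 (by decide) (by decide)
  have hl4 : s₄.natArr 1 = fun _ => 0 := by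
    rw [A4.natArr 1 (by decide), A3.natArr 1 (by decide), A2.natArr 1 (by decide),
      A1.natArr 1 (by decide), hl]
  have h7' : s₄.natVar 7 = 0 := by
    rw [A4.natVar 7 (by decide), A3.natVar 7 (by decide), A2.natVar 7 (by decide),
      A1.natVar 7 (by decide), h7]
  have h8' : s₄.natVar 8 = 0 := by
    rw [A4.natVar 8 (by decide), A3.natVar 8 (by decide), A2.natVar 8 (by decide),
      A1.natVar 8 (by decide), h8]
  refine Tri.seq ((rank_spec hh B4 E4 hf1 R4 (fun j _ y _ => by rw [hl4]) h7' h8' hf (hk ▸ hF2)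
    (hk ▸ hX5) (hk ▸ hX7)).mono hz2 fun _ _ _ h => h) ?_
  rintro s₅ B5 A5 ⟨h15, S5⟩
  have E5 := E4.agree A5 (by decide) (by decide)
  have h14 : s₅.natVar 14 = p := by
    rw [A5.natVar 14 (by decide), A4.natVar 14 (by decide), hcount']
  refine Tri.seq ((bound_spec hh B5 E5 (h15.trans hk) h14 hX8 hX3).mono hz7 fun _ _ _ h => h) ?_
  rintro s₆ B6 A6 ⟨h16, h17⟩
  have E6 := E5.agree A6 (by decide) (by decide)
  have cl6 : s₆.natArr 3 = cl := by
    rw [A6.natArr 3 (by decide), A5.natArr 3 (by decide), A4.natArr 3 (by decide),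
      A3.natArr 3 (by decide)]
  -- For n = 0 the remainders modulo n in the decoding are not bounded by n; the rank then vanishes,
  -- so no instruction is decoded.
  have hMn : 0 < M → 0 < n := by
    intro h
    rcases Nat.eq_zero_or_pos n with rfl | hn
    · have := rk_le 0 (0 + 2) (extRows 0 A)
      have hk0 : k = 0 := by omega
      simp [hM, hk0] at h
    · exact hn
  refine (search_spec hh B6 E6 hf1 ?_ h17 h16 hMn hf hF3 hX6 hA hB' hF4 hF5 ?_).mono hz8
    fun _ _ _ h => h
  · intro j hj y hy
    have := R4 j hj y hy
    rw [zero_add] at this ⊢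
    rw [A6.fldArr 2 (by decide), S5 _ (flat_lt hj hy), this]
  · rw [cl6]
    exact hgood cl hrep

end Solve

/-! ### Sequences of instructions as numbers -/

section Encoding

variable {K : Type} [Field K] [LinearOrder K]

structure Instr.Valid (n : ℕ) (I : Instr) : Prop where
  c_lt : I.c < n
  r_lt : I.r < n
  j_lt : I.j < n
  x_lt : I.x < n + 2

theorem exists_code {n : ℕ} {I : Instr} (h : I.Valid n) : ∃ u < baseOf n, decode n u = I := by
  obtain ⟨c, r, j, x, b⟩ := I
  obtain ⟨h1, h2, h3, h4⟩ := h
  simp only at h1 h2 h3 h4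
  have hn : 0 < n := by omega
  set e : ℕ := if b then 1 else 0 with he
  have he1 : e < 2 := by rw [he]; split_ifs <;> omega
  have g1 : e * (n + 2) + x < 2 * (n + 2) := flat_lt he1 h4
  have g2 := flat_lt g1 h3
  have g3 := flat_lt g2 h2
  have g4 := flat_lt g3 h1
  refine ⟨(((e * (n + 2) + x) * n + j) * n + r) * n + c, ?_, ?_⟩
  · refine lt_of_lt_of_eq g4 ?_
    rw [baseOf]; ring
  · simp only [decode, flat_row h1, flat_col h1, flat_row h2, flat_col h2, flat_row h3,
      flat_col h3, flat_row h4, flat_col h4]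
    cases b <;> simp [he]

/-- The least significant digit is executed first, so digits from position T on do not influence the
first T steps. -/
theorem stage_add {n : ℕ} (R₀ : ℕ → ℕ → K) (q₀ : ℕ → ℕ) (g u : ℕ) (hb : 0 < baseOf n) {T : ℕ} :
    ∀ t ≤ T, stage n R₀ q₀ (baseOf n ^ T * u + g) t = stage n R₀ q₀ g t := by
  intro t
  induction t with
  | zero => intro _; rfl
  | succ t ih =>
    intro ht
    have e : baseOf n ^ T * u = baseOf n ^ t * (baseOf n * (baseOf n ^ (T - (t + 1)) * u)) := by
      rw [← mul_assoc, ← mul_assoc, ← pow_succ, ← pow_add]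
      congr 2; omega
    have hd : (baseOf n ^ T * u + g) / baseOf n ^ t % baseOf n = g / baseOf n ^ t % baseOf n := by
      rw [e, Nat.mul_add_div (by positivity), Nat.mul_add_mod]
    simp only [stage, hd, ih (by omega)]

theorem exists_stage {n : ℕ} (R₀ : ℕ → ℕ → K) (q₀ : ℕ → ℕ) (l : List Instr)
    (hl : ∀ I ∈ l, I.Valid n) :
    ∃ g < baseOf n ^ l.length, stage n R₀ q₀ g l.length = runInstrs R₀ l (R₀, q₀) := by
  induction l using List.reverseRecOn with
  | nil => exact ⟨0, by simp, rfl⟩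
  | append_singleton l I ih =>
    obtain ⟨g, hg, hst⟩ := ih fun J hJ => hl J (by simp [hJ])
    obtain ⟨u, hu, hI⟩ := exists_code (hl I (by simp))
    have hb : 0 < baseOf n := by omega
    refine ⟨baseOf n ^ l.length * u + g, ?_, ?_⟩
    · rw [List.length_append, List.length_singleton, pow_succ]
      calc baseOf n ^ l.length * u + g < baseOf n ^ l.length * u + baseOf n ^ l.length := by omega
        _ = baseOf n ^ l.length * (u + 1) := by ring
        _ ≤ _ := Nat.mul_le_mul_left _ hu
    · rw [List.length_append, List.length_singleton]
      have hd : (baseOf n ^ l.length * u + g) / baseOf n ^ l.length % baseOf n = u := by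
        rw [Nat.mul_add_div (by positivity), Nat.div_eq_of_lt hg, add_zero, Nat.mod_eq_of_lt hu]
      simp only [stage, hd, hI, stage_add R₀ q₀ g u hb l.length le_rfl, hst]
      simp [runInstrs]

theorem runInstrs_append (R₀ : ℕ → ℕ → K) (l l' : List Instr) (st : (ℕ → ℕ → K) × (ℕ → ℕ)) :
    runInstrs R₀ (l ++ l') st = runInstrs R₀ l' (runInstrs R₀ l st) := by
  simp [runInstrs]

/-- With both labels equal to 0 the relabelling is the identity, whatever happens to the matrix.
These instructions pad a sequence to the prescribed length. -/
theorem runInstrs_replicate (R₀ : ℕ → ℕ → K) (m : ℕ) (st : (ℕ → ℕ → K) × (ℕ → ℕ)) :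
    (runInstrs R₀ (List.replicate m ⟨0, 0, 0, 0, false⟩) st).2 = st.2 := by
  induction m generalizing st with
  | zero => rfl
  | succ m ih =>
    rw [List.replicate_succ]
    refine (ih _).trans ?_
    funext i
    simp only [Instr.apply, relabel]
    split_ifs <;> simp_all

end Encoding

/-! ### All labels from pairwise separations -/

section Tournament

variable {K : Type} [Field K] [LinearOrder K] [IsStrictOrderedRing K]

theorem extRows_ne_zero (n : ℕ) (A : ℕ → K) (j : ℕ) : ∃ y < n + 2, extRows n A j y ≠ 0 :=
  ⟨n, by omega, by simp [extRows]⟩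

/-- Separating two clusters, starting from any state. -/
theorem exists_block {n c r : ℕ} (A : ℕ → K) (τ : ℕ → ℕ) (hc : c < n) (hr : r < n)
    (v : ℕ → K) (hv : ∀ j < n, (τ j = c → 0 < dot (n + 2) v (extRows n A j)) ∧
      (τ j = r → dot (n + 2) v (extRows n A j) < 0)) (st : (ℕ → ℕ → K) × (ℕ → ℕ)) :
    ∃ l : List Instr, l.length ≤ rk n (n + 2) (extRows n A) ∧ (∀ I ∈ l, I.Valid n) ∧
      (∀ j, ¬ (st.2 j = c ∨ st.2 j = r) → (runInstrs (extRows n A) l st).2 j = st.2 j) ∧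
      (∀ j, (st.2 j = c ∨ st.2 j = r) → ((runInstrs (extRows n A) l st).2 j = c ∨
        (runInstrs (extRows n A) l st).2 j = r)) ∧
      (∀ j < n, (st.2 j = c ∨ st.2 j = r) → (τ j = c ∨ τ j = r) →
        (runInstrs (extRows n A) l st).2 j = τ j) := by
  classical
  set R := extRows n A with hR
  set S := (Finset.range n).filter fun j => τ j = c ∨ τ j = r with hS
  have hSn : ∀ j ∈ S, j < n := fun j hj => Finset.mem_range.1 (Finset.mem_filter.1 hj).1
  obtain ⟨l, h1, h2, h3, h4, -, h6⟩ := exists_labels R n (n + 2) c r S hSn (fun j => τ j = c) _ R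
    st.2 v le_rfl (by
      intro j hj _
      refine ⟨(hv j (hSn j hj)).1, fun h => (hv j (hSn j hj)).2 ?_⟩
      exact ((Finset.mem_filter.1 hj).2).resolve_left h)
  have h6' : ∀ j < n, (st.2 j = c ∨ st.2 j = r) → (τ j = c ∨ τ j = r) →
      (runInstrs R l (R, st.2)).2 j = τ j := by
    intro j hj hq hτ
    have := h6 j (Finset.mem_filter.2 ⟨Finset.mem_range.2 hj, hτ⟩) hq (extRows_ne_zero n A j)
    by_cases h : τ j = c
    · rw [this.1 h, h]
    · rw [this.2 h, hτ.resolve_left h]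
  have hval : ∀ I ∈ l, I.Valid n := fun I hI => by
    obtain ⟨a, b, d, e, -⟩ := h2 I hI
    exact ⟨by rcases a with a | a <;> omega, by rcases b with b | b <;> omega, d, e⟩
  cases l with
  | nil => exact ⟨[], by simp, by simp, h3, h4, h6'⟩
  | cons I l =>
    have hk : I.keep = true := (h2 I (by simp)).2.2.2.2
    -- Clearing the bit of the first instruction discards the matrix left by earlier blocks but
    -- keeps the labels.
    have e : runInstrs R (⟨I.c, I.r, I.j, I.x, false⟩ :: l) st = runInstrs R (I :: l) (R, st.2) := by
      simp [runInstrs, Instr.apply, hk]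
    refine ⟨⟨I.c, I.r, I.j, I.x, false⟩ :: l, by simpa using h1, ?_, ?_, ?_, ?_⟩
    · intro J hJ
      rcases List.mem_cons.1 hJ with rfl | hJ
      · obtain ⟨a, b, c', d⟩ := hval I (by simp)
        exact ⟨a, b, c', d⟩
      · exact hval J (by simp [hJ])
    · rw [e]; exact h3
    · rw [e]; exact h4
    · rw [e]; exact h6'

theorem exists_tournament {n c₀ : ℕ} (A : ℕ → K) (τ : ℕ → ℕ) (C : Finset ℕ)
    (hC : ∀ c ∈ C, c < n) (hc₀ : c₀ ∈ C) (hτ : ∀ j < n, τ j ∈ C)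
    (hsep : ∀ c ∈ C, ∀ r ∈ C, c ≠ r → ∃ v : ℕ → K, ∀ j < n,
      (τ j = c → 0 < dot (n + 2) v (extRows n A j)) ∧
      (τ j = r → dot (n + 2) v (extRows n A j) < 0)) :
    ∃ l : List Instr, l.length ≤ rk n (n + 2) (extRows n A) * C.card * C.card ∧
      (∀ I ∈ l, I.Valid n) ∧
      ∀ j < n, (runInstrs (extRows n A) l (extRows n A, fun _ => c₀)).2 j = τ j := by
  classical
  set R := extRows n A with hR
  set k := rk n (n + 2) R with hk
  -- Clusters are introduced one at a time: rows of the clusters seen so far are already correct,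
  -- and the remaining rows carry an arbitrary label of a seen cluster.
  have outer : ∀ Q : Finset ℕ, Q ⊆ C → ∃ l : List Instr, l.length ≤ k * C.card * Q.card ∧
      (∀ I ∈ l, I.Valid n) ∧
      (∀ j < n, (runInstrs R l (R, fun _ => c₀)).2 j ∈ insert c₀ Q) ∧
      (∀ j < n, τ j ∈ insert c₀ Q → (runInstrs R l (R, fun _ => c₀)).2 j = τ j) := by
    intro Q
    induction Q using Finset.induction_on with
    | empty =>
      intro _
      refine ⟨[], by simp, by simp, fun j _ => by simp [runInstrs], fun j _ h => ?_⟩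
      simp only [insert_empty_eq, Finset.mem_singleton] at h
      simp [runInstrs, h]
    | insert r Q hrQ ih =>
      intro hQ
      obtain ⟨l, h1, h2, h3, h4⟩ := ih fun x hx => hQ (Finset.mem_insert_of_mem hx)
      have hcard : (insert r Q).card = Q.card + 1 := Finset.card_insert_of_notMem hrQ
      by_cases hr0 : r = c₀
      · subst hr0
        refine ⟨l, h1.trans (Nat.mul_le_mul_left _ (by omega)), h2, ?_, ?_⟩
        · simpa using h3
        · simpa using h4
      have hrC : r ∈ C := hQ (Finset.mem_insert_self _ _)
      have hrN : r ∉ insert c₀ Q := by simp [hr0, hrQ]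
      have hQC : insert c₀ Q ⊆ C := by
        intro x hx
        rcases Finset.mem_insert.1 hx with rfl | hx
        · exact hc₀
        · exact hQ (Finset.mem_insert_of_mem hx)
      set st := runInstrs R l (R, fun _ => c₀) with hst
      -- The new cluster r plays against each seen cluster c. A row of r cannot keep or regain a
      -- label in E, so after all games only the label r is left for it; correct rows of the seen
      -- clusters are never damaged.
      have inner : ∀ E : Finset ℕ, E ⊆ insert c₀ Q → ∃ l' : List Instr,
          l'.length ≤ k * E.card ∧ (∀ I ∈ l', I.Valid n) ∧
          (∀ j < n, (runInstrs R l' st).2 j = r ∨ (runInstrs R l' st).2 j ∈ insert c₀ Q) ∧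
          (∀ j < n, τ j ∈ insert c₀ Q → (runInstrs R l' st).2 j = τ j) ∧
          (∀ j < n, τ j = r → (runInstrs R l' st).2 j ∉ E) := by
        intro E
        induction E using Finset.induction_on with
        | empty =>
          intro _
          exact ⟨[], by simp, by simp, fun j hj => Or.inr (h3 j hj), h4, by simp⟩
        | insert c E hcE ihE =>
          intro hE
          obtain ⟨l', g1, g2, g3, g4, g5⟩ := ihE fun x hx => hE (Finset.mem_insert_of_mem hx)
          have hcQ : c ∈ insert c₀ Q := hE (Finset.mem_insert_self _ _)
          have hcr : c ≠ r := fun h => hrN (h ▸ hcQ)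
          obtain ⟨v, hv⟩ := hsep c (hQC hcQ) r hrC hcr
          obtain ⟨b, b1, b2, b3, b4, b5⟩ := exists_block A τ (hC c (hQC hcQ)) (hC r hrC) v hv
            (runInstrs R l' st)
          replace b1 : b.length ≤ k := b1
          refine ⟨l' ++ b, ?_, ?_, ?_, ?_, ?_⟩
          · rw [List.length_append, Finset.card_insert_of_notMem hcE, mul_add, mul_one]; omega
          · intro I hI
            rcases List.mem_append.1 hI with h | h
            exacts [g2 I h, b2 I h]
          · intro j hj
            rw [runInstrs_append]
            by_cases h : (runInstrs R l' st).2 j = c ∨ (runInstrs R l' st).2 j = r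
            · rcases b4 j h with h' | h' <;> rw [h']
              · exact Or.inr hcQ
              · exact Or.inl rfl
            · rw [b3 j h]; exact g3 j hj
          · intro j hj hτj
            rw [runInstrs_append]
            have hq := g4 j hj hτj
            have hτr : τ j ≠ r := fun h => hrN (h ▸ hτj)
            by_cases h : τ j = c
            · exact b5 j hj (Or.inl (hq.trans h)) (Or.inl h)
            · rw [b3 j (by rw [hq]; exact not_or.2 ⟨h, hτr⟩), hq]
          · intro j hj hτj
            rw [runInstrs_append]
            by_cases h : (runInstrs R l' st).2 j = c ∨ (runInstrs R l' st).2 j = r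
            · rw [b5 j hj h (Or.inr hτj), hτj]
              exact fun h' => hrN (hE h')
            · rw [b3 j h, Finset.mem_insert]
              exact not_or.2 ⟨fun h' => h (Or.inl h'), g5 j hj hτj⟩
      obtain ⟨l', g1, g2, g3, g4, g5⟩ := inner _ subset_rfl
      refine ⟨l ++ l', ?_, ?_, ?_, ?_⟩
      · rw [List.length_append, hcard, mul_add, mul_one]
        have := Nat.mul_le_mul_left k (Finset.card_le_card hQC)
        omega
      · intro I hI
        rcases List.mem_append.1 hI with h | h
        exacts [h2 I h, g2 I h]
      · intro j hj
        rw [runInstrs_append, Finset.insert_comm, Finset.mem_insert]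
        exact g3 j hj
      · intro j hj hτj
        rw [runInstrs_append]
        rw [Finset.insert_comm, Finset.mem_insert] at hτj
        rcases hτj with h | h
        · rw [h]; exact (g3 j hj).resolve_right (g5 j hj h)
        · exact g4 j hj h
  obtain ⟨l, h1, h2, -, h4⟩ := outer C subset_rfl
  exact ⟨l, h1, h2, fun j hj => h4 j hj (Finset.mem_insert_of_mem (hτ j hj))⟩

/-- The labels that the tournament computes are those of some candidate. -/
theorem exists_candidate {n c₀ : ℕ} (hn : 0 < n) (A : ℕ → K) (τ : ℕ → ℕ) (C : Finset ℕ)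
    (hC : ∀ c ∈ C, c < n) (hc₀ : c₀ ∈ C) (hτ : ∀ j < n, τ j ∈ C)
    (hsep : ∀ c ∈ C, ∀ r ∈ C, c ≠ r → ∃ v : ℕ → K, ∀ j < n,
      (τ j = c → 0 < dot (n + 2) v (extRows n A j)) ∧
      (τ j = r → dot (n + 2) v (extRows n A j) < 0)) :
    ∃ g < baseOf n ^ (rk n (n + 2) (extRows n A) * C.card * C.card), ∀ j < n,
      (stage n (extRows n A) (fun _ => c₀) g
        (rk n (n + 2) (extRows n A) * C.card * C.card)).2 j = τ j := by
  obtain ⟨l, h1, h2, h3⟩ := exists_tournament A τ C hC hc₀ hτ hsep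
  set M := rk n (n + 2) (extRows n A) * C.card * C.card
  obtain ⟨g, hg, hst⟩ := exists_stage (n := n) (extRows n A) (fun _ => c₀)
    (l ++ List.replicate (M - l.length) ⟨0, 0, 0, 0, false⟩) (by
      intro I hI
      rcases List.mem_append.1 hI with h | h
      · exact h2 I h
      · rw [List.eq_of_mem_replicate h]
        exact ⟨hn, hn, hn, by simp⟩)
  have hlen : (l ++ List.replicate (M - l.length)
      (⟨0, 0, 0, 0, false⟩ : Instr)).length = M := by simp; omega
  rw [hlen] at hg hst
  refine ⟨g, hg, fun j hj => ?_⟩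
  rw [hst, runInstrs_append, runInstrs_replicate, h3 j hj]

end Tournament

/-! ### Optimal permutations -/

section Optimum

variable {K : Type} [Field K] [LinearOrder K] [IsStrictOrderedRing K] {n : ℕ}
  (A B : Matrix (Fin n) (Fin n) K)

/-- The bilinear form behind the objective. -/
def cross (σ π : Equiv.Perm (Fin n)) : K := ∑ i, ∑ j, A (π i) (σ j) * B i j

theorem rowMajor_apply {K : Type} [Field K] {n : ℕ} (M : Matrix (Fin n) (Fin n) K) (i j : Fin n) :
    rowMajor M ((i : ℕ) * n + j) = M i j := by
  have h1 := flat_row (w := n) (j := (i : ℕ)) j.2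
  have h2 := flat_col (w := n) (j := (i : ℕ)) j.2
  simp only [rowMajor, h1, h2]
  rw [dif_pos ⟨i.2, j.2⟩]

theorem objPerm_rowMajor (π : Equiv.Perm (Fin n)) :
    objPerm n (rowMajor A) (rowMajor B) π = ∑ i, ∑ j, (A (π i) (π j) - B i j) ^ 2 := by
  simp only [objPerm, rowMajor_apply]

/-- The sum of the squares of the entries of A is invariant under π, so only the mixed term depends
on π. -/
theorem objPerm_eq_cross (π : Equiv.Perm (Fin n)) :
    objPerm n (rowMajor A) (rowMajor B) π =
      ∑ i, ∑ j, A i j ^ 2 + ∑ i, ∑ j, B i j ^ 2 - 2 * cross A B π π := by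
  have h : ∑ i, ∑ j, A i j ^ 2 = ∑ i, ∑ j, A (π i) (π j) ^ 2 := by
    rw [← Equiv.sum_comp π]
    exact Finset.sum_congr rfl fun i _ => (Equiv.sum_comp π fun j => A (π i) j ^ 2).symm
  rw [objPerm_rowMajor, h, cross]
  simp only [Finset.mul_sum, ← Finset.sum_add_distrib, ← Finset.sum_sub_distrib]
  exact Finset.sum_congr rfl fun i _ => Finset.sum_congr rfl fun j _ => by ring

/-- The effect of a transposition on a linear assignment problem. It is applied both to the
linearized objective and to the function that breaks ties. -/
theorem sum_mul_swap {M : Type} [AddCommGroup M] (H : Fin n → Fin n → M) (π : Equiv.Perm (Fin n))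
    {i i' : Fin n} (h : i ≠ i') :
    ∑ x, H ((π * Equiv.swap i i') x) x =
      ∑ x, H (π x) x - (H (π i) i + H (π i') i') + (H (π i') i + H (π i) i') := by
  have key : ∀ F : Fin n → M, ∑ x, F x = ∑ x ∈ Finset.univ \ {i, i'}, F x + (F i + F i') := by
    intro F
    rw [← Finset.sum_pair h, Finset.sum_sdiff (Finset.subset_univ _)]
  have hrest : ∑ x ∈ Finset.univ \ {i, i'}, H ((π * Equiv.swap i i') x) x =
      ∑ x ∈ Finset.univ \ {i, i'}, H (π x) x := by
    refine Finset.sum_congr rfl fun x hx => ?_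
    simp only [Finset.mem_sdiff, Finset.mem_univ, true_and, Finset.mem_insert,
      Finset.mem_singleton, not_or] at hx
    rw [Equiv.Perm.mul_apply, Equiv.swap_apply_of_ne_of_ne hx.1 hx.2]
  rw [key fun x => H ((π * Equiv.swap i i') x) x, key fun x => H (π x) x, hrest]
  simp only [Equiv.Perm.mul_apply, Equiv.swap_apply_left, Equiv.swap_apply_right]
  abel

/-- Strict lexicographic separation can be achieved by a perturbation and a threshold. -/
theorem exists_threshold (f : Fin n → K) (P Q : Finset (Fin n)) (hP : P.Nonempty)
    (hQ : Q.Nonempty) (h : ∀ j ∈ P, ∀ l ∈ Q, f l < f j ∨ (f l = f j ∧ l < j)) :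
    ∃ ε t : K, (∀ j ∈ P, t < f j + ε * (j : ℕ)) ∧ ∀ l ∈ Q, f l + ε * (l : ℕ) < t := by
  -- The smallest positive gap of f. With ε * n < δ the perturbation by ε times the index decides
  -- ties but never reverses a strict inequality.
  obtain ⟨δ, hδ, hgap⟩ : ∃ δ : K, 0 < δ ∧ ∀ j l, f l < f j → δ ≤ f j - f l := by
    set S := (Finset.univ : Finset (Fin n × Fin n)).filter fun x => f x.2 < f x.1 with hS
    by_cases hne : S.Nonempty
    · obtain ⟨x, hx, hmin⟩ := S.exists_min_image (fun x => f x.1 - f x.2) hne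
      refine ⟨f x.1 - f x.2, sub_pos.2 (Finset.mem_filter.1 hx).2, fun j l hjl => ?_⟩
      exact hmin (j, l) (Finset.mem_filter.2 ⟨Finset.mem_univ _, hjl⟩)
    · exact ⟨1, one_pos, fun j l hjl =>
        absurd ⟨(j, l), Finset.mem_filter.2 ⟨Finset.mem_univ _, hjl⟩⟩ hne⟩
  have hn1 : (0 : K) < n + 1 := by positivity
  set ε := δ / (n + 1) with hε
  have hε0 : 0 < ε := div_pos hδ hn1
  have hεδ : ε * n < δ := by
    rw [hε, div_mul_eq_mul_div, div_lt_iff₀ hn1]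
    nlinarith
  have hlt : ∀ j ∈ P, ∀ l ∈ Q, f l + ε * (l : ℕ) < f j + ε * (j : ℕ) := by
    intro j hj l hl
    have hj0 : (0 : K) ≤ (j : ℕ) := Nat.cast_nonneg _
    rcases h j hj l hl with h | ⟨h, h'⟩
    · have h1 := hgap j l h
      have h2 : ((l : ℕ) : K) ≤ n := Nat.cast_le.2 l.2.le
      have h3 := mul_le_mul_of_nonneg_left h2 hε0.le
      have h4 := mul_nonneg hε0.le hj0
      linarith
    · have h1 : ((l : ℕ) : K) < (j : ℕ) := Nat.cast_lt.2 h'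
      have := mul_lt_mul_of_pos_left h1 hε0
      linarith
  obtain ⟨j₀, hj₀, hmin⟩ := P.exists_min_image (fun j => f j + ε * (j : ℕ)) hP
  obtain ⟨l₀, hl₀, hmax⟩ := Q.exists_max_image (fun l => f l + ε * (l : ℕ)) hQ
  have h0 := hlt j₀ hj₀ l₀ hl₀
  refine ⟨ε, ((f j₀ + ε * (j₀ : ℕ)) + (f l₀ + ε * (l₀ : ℕ))) / 2, fun j hj => ?_, fun l hl => ?_⟩
  · have := hmin j hj
    linarith
  · have := hmax l hl
    linarith

variable {A B}

/-- An optimal permutation that sorts the clusters lexicographically. -/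
theorem exists_sorted_optimum (cl : Fin n → ℕ)
    (hconv : ∀ σ π, 2 * cross A B σ π ≤ cross A B σ σ + cross A B π π) :
    ∃ σ π : Equiv.Perm (Fin n), (∀ τ, cross A B τ τ ≤ cross A B π π) ∧
      ∀ i i', cl i' < cl i →
        ∑ l, A (π i) (σ l) * B i' l + ∑ l, A (π i') (σ l) * B i l <
          ∑ l, A (π i) (σ l) * B i l + ∑ l, A (π i') (σ l) * B i' l ∨
        (∑ l, A (π i) (σ l) * B i' l + ∑ l, A (π i') (σ l) * B i l =
          ∑ l, A (π i) (σ l) * B i l + ∑ l, A (π i') (σ l) * B i' l ∧ π i' < π i) := by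
  obtain ⟨σ, -, hσ⟩ := Finset.exists_max_image (Finset.univ : Finset (Equiv.Perm (Fin n)))
    (fun π => cross A B π π) Finset.univ_nonempty
  obtain ⟨π₀, -, hπ₀⟩ := Finset.exists_max_image (Finset.univ : Finset (Equiv.Perm (Fin n)))
    (fun π => cross A B σ π) Finset.univ_nonempty
  -- Among the maximizers of the linear function, choose one that puts larger clusters at larger
  -- indices; this turns weak exchange inequalities into strict lexicographic ones.
  obtain ⟨π, hπ, hmax⟩ := Finset.exists_max_image
    ((Finset.univ : Finset (Equiv.Perm (Fin n))).filter fun π => cross A B σ π = cross A B σ π₀)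
    (fun π => ∑ x, ((π x : ℕ) : ℤ) * (cl x : ℤ)) ⟨π₀, by simp⟩
  have hππ₀ : cross A B σ π = cross A B σ π₀ := (Finset.mem_filter.1 hπ).2
  have hlin : ∀ τ, cross A B σ τ ≤ cross A B σ π := fun τ => by
    rw [hππ₀]; exact hπ₀ τ (Finset.mem_univ _)
  refine ⟨σ, π, fun τ => ?_, fun i i' hcl => ?_⟩
  -- Convexity: ⟨π,π⟩ ≥ 2⟨σ,π⟩ - ⟨σ,σ⟩ ≥ ⟨σ,σ⟩, so π is optimal as well.
  · have h1 := hσ τ (Finset.mem_univ _)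
    have h2 := hconv σ π
    have h3 := hlin σ
    linarith
  · have hne : i ≠ i' := by rintro rfl; exact lt_irrefl _ hcl
    have hsw := sum_mul_swap (fun a x => ∑ l, A a (σ l) * B x l) π hne
    have hle := hlin (π * Equiv.swap i i')
    simp only [cross] at hle
    rw [hsw] at hle
    rcases lt_or_eq_of_le hle with hlt | heq
    · left; linarith
    · right
      refine ⟨by linarith, ?_⟩
      have hmem : π * Equiv.swap i i' ∈ (Finset.univ : Finset (Equiv.Perm (Fin n))).filter
          fun π => cross A B σ π = cross A B σ π₀ := by
        refine Finset.mem_filter.2 ⟨Finset.mem_univ _, ?_⟩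
        rw [← hππ₀]
        simp only [cross]
        rw [hsw, heq]
      have h1 := hmax _ hmem
      have h2 := sum_mul_swap (fun a x => ((a : ℕ) : ℤ) * (cl x : ℤ)) π hne
      rw [h2] at h1
      have h3 : (((π i : ℕ) : ℤ) - (π i' : ℕ)) * ((cl i : ℤ) - cl i') ≥ 0 := by nlinarith
      have h4 : (0 : ℤ) < (cl i : ℤ) - cl i' := by omega
      have h5 : (0 : ℤ) ≤ ((π i : ℕ) : ℤ) - (π i' : ℕ) := by
        by_contra hcon
        push Not at hcon
        nlinarith
      refine lt_of_le_of_ne (Fin.le_def.2 (by omega)) fun h => hne (π.injective h.symm)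

/-- Rows of different clusters are separated by a functional. -/
theorem exists_separation {cl : Fin n → ℕ} {σ π : Equiv.Perm (Fin n)}
    (hBcl : ∀ i i', cl i = cl i' → B i = B i')
    (hex : ∀ i i', cl i' < cl i →
        ∑ l, A (π i) (σ l) * B i' l + ∑ l, A (π i') (σ l) * B i l <
          ∑ l, A (π i) (σ l) * B i l + ∑ l, A (π i') (σ l) * B i' l ∨
        (∑ l, A (π i) (σ l) * B i' l + ∑ l, A (π i') (σ l) * B i l =
          ∑ l, A (π i) (σ l) * B i l + ∑ l, A (π i') (σ l) * B i' l ∧ π i' < π i))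
    (a b : Fin n) (hab : cl b < cl a) :
    ∃ v : ℕ → K, ∀ j : Fin n,
      (cl (π.symm j) = cl a → 0 < dot (n + 2) v (extRows n (rowMajor A) j)) ∧
      (cl (π.symm j) = cl b → dot (n + 2) v (extRows n (rowMajor A) j) < 0) := by
  set f : Fin n → K := fun j => ∑ l, A j (σ l) * (B a l - B b l) with hf
  obtain ⟨ε, t, h1, h2⟩ := exists_threshold f
    (Finset.univ.filter fun j => cl (π.symm j) = cl a)
    (Finset.univ.filter fun j => cl (π.symm j) = cl b) ⟨π a, by simp⟩ ⟨π b, by simp⟩ (by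
      intro j hj l hl
      have hj' : cl (π.symm j) = cl a := (Finset.mem_filter.1 hj).2
      have hl' : cl (π.symm l) = cl b := (Finset.mem_filter.1 hl).2
      have := hex (π.symm j) (π.symm l) (by omega)
      rw [hBcl _ _ hj', hBcl _ _ hl'] at this
      simp only [Equiv.apply_symm_apply] at this
      simp only [hf, mul_sub, Finset.sum_sub_distrib]
      rcases this with h | ⟨h, h'⟩
      · left; linarith
      · right; exact ⟨by linarith, h'⟩)
  -- The constant column carries the threshold and the index column the perturbation, which is why
  -- the rows of A were extended.
  set v : ℕ → K := fun y => if h : y < n then B a (σ.symm ⟨y, h⟩) - B b (σ.symm ⟨y, h⟩)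
    else if y = n then -t else ε with hv
  have hdot : ∀ j : Fin n, dot (n + 2) v (extRows n (rowMajor A) j) = f j - t + ε * (j : ℕ) := by
    intro j
    have e1 : ∑ y ∈ Finset.range n, v y * extRows n (rowMajor A) j y = f j := by
      rw [Finset.sum_range, hf]
      simp only
      rw [← Equiv.sum_comp σ]
      refine Finset.sum_congr rfl fun l _ => ?_
      simp only [hv, extRows, rowMajor_apply, (σ l).2, dif_pos, if_pos, Fin.eta,
        Equiv.symm_apply_apply]
      ring
    rw [dot, Finset.sum_range_succ, Finset.sum_range_succ, e1]
    simp [hv, extRows, sub_eq_add_neg]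
  refine ⟨v, fun j => ⟨fun h => ?_, fun h => ?_⟩⟩
  · have := h1 j (Finset.mem_filter.2 ⟨Finset.mem_univ _, h⟩)
    rw [hdot]; linarith
  · have := h2 j (Finset.mem_filter.2 ⟨Finset.mem_univ _, h⟩)
    rw [hdot]; linarith

/-- Counting: at a first mismatch i, all positions holding a row of the cluster of i come before i
and are matched, so they are in that cluster but miss i itself. Yet θ is a bijection, so the two
numbers agree. -/
theorem labels_eq {cl : Fin n → ℕ} {θ : Equiv.Perm (Fin n)}
    (h : ∀ i j : Fin n, i ≤ j → cl (θ i) = cl i ∨ cl (θ j) ≠ cl i) (i : Fin n) :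
    cl (θ i) = cl i := by
  induction i using WellFoundedLT.induction with
  | _ i ih =>
    by_contra hne
    have hall : ∀ j, i ≤ j → cl (θ j) ≠ cl i := fun j hj => (h i j hj).resolve_left hne
    have hcard : (Finset.univ.filter fun j => cl (θ j) = cl i).card =
        (Finset.univ.filter fun j => cl j = cl i).card :=
      Finset.card_equiv θ (by simp)
    have hsub : (Finset.univ.filter fun j => cl (θ j) = cl i) ⊂
        (Finset.univ.filter fun j => cl j = cl i) := by
      refine Finset.ssubset_iff_subset_ne.2 ⟨fun j hj => ?_, fun heq => ?_⟩
      · have hj' := (Finset.mem_filter.1 hj).2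
        have hlt : j < i := not_le.1 fun hle => hall j hle hj'
        exact Finset.mem_filter.2 ⟨Finset.mem_univ _, (ih j hlt).symm.trans hj'⟩
      · have : i ∈ Finset.univ.filter fun j => cl (θ j) = cl i := by rw [heq]; simp
        exact hne (Finset.mem_filter.1 this).2
    exact (Finset.card_lt_card hsub).ne hcard

theorem exists_goodCandidate (hB : B.IsSymm)
    (hconv : ∀ σ π, 2 * cross A B σ π ≤ cross A B σ σ + cross A B π π)
    (hrow : ∀ i j : Fin n, SameRow n (rowMajor B) i j ↔ B i = B j) {cl : ℕ → ℕ}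
    (hcl : IsRep n (rowMajor B) cl) :
    ∃ g < baseOf n ^ (rk n (n + 2) (extRows n (rowMajor A)) * repCount n cl * repCount n cl),
      GoodCandidate n (rk n (n + 2) (extRows n (rowMajor A)) * repCount n cl * repCount n cl)
        (rowMajor A) (rowMajor B) cl g := by
  rcases Nat.eq_zero_or_pos n with rfl | hn
  · refine ⟨0, by simp [repCount], fun π _ τ => ?_⟩
    rw [Subsingleton.elim π τ]
  have hrep : ∀ i : Fin n, B i = B ⟨cl i, (hcl i i.2).1⟩ := fun i =>
    (hrow i ⟨cl i, (hcl i i.2).1⟩).1 (hcl i i.2).2.1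
  have hle : ∀ i j : Fin n, B i = B j → cl i ≤ cl j := by
    intro i j hij
    refine (hcl j j.2).2.2 (cl i) (hcl i i.2).1 ?_
    exact (hrow j ⟨cl i, (hcl i i.2).1⟩).2 (hij.symm.trans (hrep i))
  have hiff : ∀ i j : Fin n, cl i = cl j ↔ B i = B j := by
    intro i j
    refine ⟨fun h => ?_, fun h => le_antisymm (hle i j h) (hle j i h.symm)⟩
    rw [hrep i, hrep j]
    congr 1
    exact Fin.ext h
  have hidem : ∀ i : Fin n, cl (cl i) = cl i := fun i =>
    ((hiff i ⟨cl i, (hcl i i.2).1⟩).2 (hrep i)).symm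
  obtain ⟨σ, π, hopt, hex⟩ := exists_sorted_optimum (A := A) (B := B) (fun i => cl i) hconv
  set τ : ℕ → ℕ := fun j => if h : j < n then cl (π.symm ⟨j, h⟩) else 0 with hτ
  set C := (Finset.range n).filter fun i => cl i = i with hC
  have hmem : ∀ i : Fin n, cl i ∈ C := fun i =>
    Finset.mem_filter.2 ⟨Finset.mem_range.2 (hcl i i.2).1, hidem i⟩
  have hsep : ∀ c ∈ C, ∀ r ∈ C, r < c → ∃ v : ℕ → K, ∀ j < n,
      (τ j = c → 0 < dot (n + 2) v (extRows n (rowMajor A) j)) ∧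
      (τ j = r → dot (n + 2) v (extRows n (rowMajor A) j) < 0) := by
    intro c hc r hr hlt
    obtain ⟨hc1, hc2⟩ := Finset.mem_filter.1 hc
    obtain ⟨hr1, hr2⟩ := Finset.mem_filter.1 hr
    rw [Finset.mem_range] at hc1 hr1
    obtain ⟨v, hv⟩ := exists_separation (cl := fun i : Fin n => cl i) (fun i i' h => (hiff i i').1 h)
      hex ⟨c, hc1⟩ ⟨r, hr1⟩ (by simpa only [hc2, hr2] using hlt)
    refine ⟨v, fun j hj => ?_⟩
    have := hv ⟨j, hj⟩
    simp only [hc2, hr2] at this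
    simpa only [hτ, hj, dif_pos] using this
  obtain ⟨g, hg, hst⟩ := exists_candidate hn (rowMajor A) τ C (c₀ := cl 0)
    (fun c hc => Finset.mem_range.1 (Finset.mem_filter.1 hc).1) (hmem ⟨0, hn⟩)
    (fun j hj => by simp only [hτ, hj, dif_pos]; exact hmem _) (by
      intro c hc r hr hne
      rcases lt_or_gt_of_ne hne with hlt | hlt
      · obtain ⟨v, hv⟩ := hsep r hr c hc hlt
        refine ⟨fun y => 0 * v y - 1 * v y, fun j hj => ?_⟩
        rw [dot_sub_left, zero_mul, one_mul, zero_sub]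
        exact ⟨fun h => neg_pos.2 ((hv j hj).2 h), fun h => neg_neg_of_pos ((hv j hj).1 h)⟩
      · exact hsep c hc r hr hlt)
  refine ⟨g, hg, fun ρ hρ ψ => ?_⟩
  have hlab : ∀ j : Fin n, (stage n (extRows n (rowMajor A)) (fun _ => cl 0) g
      (rk n (n + 2) (extRows n (rowMajor A)) * repCount n cl * repCount n cl)).2 j =
        cl (π.symm j) := by
    intro j
    refine (hst j j.2).trans ?_
    simp [hτ]
  have hθ := labels_eq (cl := fun i : Fin n => cl i) (θ := ρ.trans π.symm) (by
    intro i j hij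
    have := hρ i j hij
    rwa [hlab, hlab] at this)
  -- The permutation found and the optimal π differ by one that preserves clusters, hence B;
  -- symmetry transfers the equality of rows to columns.
  have hBθ : ∀ i j, B ((ρ.trans π.symm) i) ((ρ.trans π.symm) j) = B i j := by
    intro i j
    rw [(hiff _ _).1 (hθ i), ← hB.apply, (hiff _ _).1 (hθ j), hB.apply]
  have hcross : cross A B ρ ρ = cross A B π π := by
    symm
    rw [cross, cross, ← Equiv.sum_comp (ρ.trans π.symm)]
    refine Finset.sum_congr rfl fun i _ => ?_
    rw [← Equiv.sum_comp (ρ.trans π.symm)]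
    refine Finset.sum_congr rfl fun j _ => ?_
    rw [hBθ]
    simp
  rw [objPerm_eq_cross, objPerm_eq_cross, hcross]
  have := hopt ψ
  linarith

end Optimum

/-! ### Positive semidefinite matrices -/

section Real

variable {n : ℕ}

theorem exists_gram {A : Matrix (Fin n) (Fin n) ℝ} (hA : A.PosSemidef) :
    ∃ (m : ℕ) (u : Fin m → Fin n → ℝ), ∀ i j, A i j = ∑ a, u a i * u a j := by
  obtain ⟨m, u, h⟩ := Matrix.posSemidef_iff_eq_sum_vecMulVec.1 hA
  refine ⟨m, u, fun i j => ?_⟩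
  rw [h, Matrix.sum_apply]
  simp [Matrix.vecMulVec_apply]

/-- With Gram vectors of A and B the form becomes a sum of products of the same linear functions
evaluated at π and at σ; then 2xy ≤ x² + y². -/
theorem two_mul_cross_le {A B : Matrix (Fin n) (Fin n) ℝ} (hA : A.PosSemidef) (hB : B.PosSemidef)
    (σ π : Equiv.Perm (Fin n)) : 2 * cross A B σ π ≤ cross A B σ σ + cross A B π π := by
  obtain ⟨m, u, hu⟩ := exists_gram hA
  obtain ⟨m', v, hv⟩ := exists_gram hB
  have h : ∀ σ π : Equiv.Perm (Fin n), cross A B σ π =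
      ∑ a, ∑ b, (∑ i, u a (π i) * v b i) * (∑ j, u a (σ j) * v b j) := by
    intro σ π
    simp only [cross, hu, hv, Finset.sum_mul_sum]
    calc ∑ i, ∑ j, ∑ a, ∑ b, u a (π i) * u a (σ j) * (v b i * v b j)
        = ∑ i, ∑ a, ∑ j, ∑ b, u a (π i) * u a (σ j) * (v b i * v b j) :=
          Finset.sum_congr rfl fun i _ => Finset.sum_comm
      _ = ∑ a, ∑ i, ∑ j, ∑ b, u a (π i) * u a (σ j) * (v b i * v b j) := Finset.sum_comm
      _ = ∑ a, ∑ i, ∑ b, ∑ j, u a (π i) * u a (σ j) * (v b i * v b j) :=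
          Finset.sum_congr rfl fun a _ => Finset.sum_congr rfl fun i _ => Finset.sum_comm
      _ = ∑ a, ∑ b, ∑ i, ∑ j, u a (π i) * u a (σ j) * (v b i * v b j) :=
          Finset.sum_congr rfl fun a _ => Finset.sum_comm
      _ = _ := by
          refine Finset.sum_congr rfl fun a _ => Finset.sum_congr rfl fun b _ =>
            Finset.sum_congr rfl fun i _ => Finset.sum_congr rfl fun j _ => by ring
  rw [h, h, h, Finset.mul_sum, ← Finset.sum_add_distrib]
  refine Finset.sum_le_sum fun a _ => ?_
  rw [Finset.mul_sum, ← Finset.sum_add_distrib]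
  refine Finset.sum_le_sum fun b _ => ?_
  nlinarith [sq_nonneg ((∑ i, u a (π i) * v b i) - ∑ j, u a (σ j) * v b j)]

/-- The hypothesis says that the squared distance of two Gram vectors is not positive, so these
vectors coincide. -/
theorem row_eq_of_le {B : Matrix (Fin n) (Fin n) ℝ} (hB : B.PosSemidef) {i j : Fin n}
    (h : B i i + B j j ≤ B i j + B i j) : B i = B j := by
  obtain ⟨m, v, hv⟩ := exists_gram hB
  have h0 : ∑ b, (v b i - v b j) ^ 2 = B i i + B j j - (B i j + B i j) := by
    simp only [hv, ← Finset.sum_add_distrib, ← Finset.sum_sub_distrib]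
    exact Finset.sum_congr rfl fun b _ => by ring
  have h1 : ∑ b, (v b i - v b j) ^ 2 = 0 :=
    le_antisymm (by linarith) (Finset.sum_nonneg fun _ _ => sq_nonneg _)
  have h2 := (Finset.sum_eq_zero_iff_of_nonneg fun _ _ => sq_nonneg _).1 h1
  funext y
  rw [hv, hv]
  refine Finset.sum_congr rfl fun b hb => ?_
  rw [sub_eq_zero.1 (pow_eq_zero_iff two_ne_zero |>.1 (h2 b hb))]

theorem frobDist_sq (A B : Matrix (Fin n) (Fin n) ℝ) (π : Equiv.Perm (Fin n)) :
    frobDist A B π ^ 2 = ∑ i, ∑ j, (A (π i) (π j) - B i j) ^ 2 := by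
  rw [frobDist, Matrix.frobenius_norm_def]
  have h0 : (0 : ℝ) ≤ ∑ i, ∑ j, ‖(A.submatrix π π - B) i j‖ ^ (2 : ℝ) :=
    Finset.sum_nonneg fun _ _ => Finset.sum_nonneg fun _ _ => by positivity
  rw [← Real.sqrt_eq_rpow, Real.sq_sqrt h0]
  refine Finset.sum_congr rfl fun i _ => Finset.sum_congr rfl fun j _ => ?_
  rw [Real.rpow_two, Real.norm_eq_abs, sq_abs]
  rfl

theorem frobDist_nonneg (A B : Matrix (Fin n) (Fin n) ℝ) (π : Equiv.Perm (Fin n)) :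
    0 ≤ frobDist A B π := by
  rw [frobDist, Matrix.frobenius_norm_def]
  positivity

theorem IsSpectralDecomposition.mul_apply {r : ℕ} {M : Matrix (Fin n) (Fin n) ℝ}
    {U : Matrix (Fin n) (Fin r) ℝ} {ev : Fin r → ℝ} (h : IsSpectralDecomposition M U ev)
    (i : Fin n) (q : Fin r) : ∑ y, M i y * U y q = U i q * ev q := by
  have : M * U = U * Matrix.diagonal ev := by
    rw [h.eq_mul, Matrix.mul_assoc, h.orthonormal, Matrix.mul_one]
  have h2 := congrFun (congrFun this i) q
  rwa [Matrix.mul_apply, Matrix.mul_diagonal] at h2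

/-- From M = U Γ Uᵀ and M U = U Γ with Γ invertible, rows of U and of M determine each other. So
clusters can be found without computing eigenvectors, which need not exist over K. -/
theorem IsSpectralDecomposition.row_eq_iff {r : ℕ} {M : Matrix (Fin n) (Fin n) ℝ}
    {U : Matrix (Fin n) (Fin r) ℝ} {ev : Fin r → ℝ} (h : IsSpectralDecomposition M U ev)
    (i j : Fin n) : U i = U j ↔ M i = M j := by
  constructor
  · intro hU
    have hD : ∀ i y, M i y = ∑ q, U i q * ev q * U y q := by
      intro i y
      conv_lhs => rw [h.eq_mul]
      rw [Matrix.mul_apply]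
      simp [Matrix.mul_diagonal]
    funext y
    rw [hD, hD, hU]
  · intro hM
    funext q
    have h1 := h.mul_apply i q
    rw [hM, h.mul_apply j q] at h1
    exact (mul_right_cancel₀ (h.ev_ne_zero q) h1).symm

/-- A positive semidefinite matrix of rank zero has at most one cluster. -/
theorem IsClusteringNumber.le_one {B : Matrix (Fin n) (Fin n) ℝ} {p : ℕ}
    (h : IsClusteringNumber B p) (hr : B.rank = 0) : p ≤ 1 := by
  obtain ⟨r, U, ev, hU, rfl⟩ := h
  have hB : B = 0 := by
    rw [Matrix.rank_eq_finrank_span_row, Submodule.finrank_eq_zero, Submodule.span_eq_bot] at hr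
    funext i
    exact hr _ ⟨i, rfl⟩
  have hsub : (Set.range fun i : Fin n => U i) ⊆ {0} := by
    rintro _ ⟨i, rfl⟩
    funext q
    have := hU.mul_apply i q
    simp only [hB, Matrix.zero_apply, zero_mul, Finset.sum_const_zero] at this
    exact (mul_eq_zero.1 this.symm).resolve_right (hU.ev_ne_zero q)
  exact (Set.ncard_le_ncard hsub).trans (by simp)

theorem IsClusteringNumber.le {n p : ℕ} {M : Matrix (Fin n) (Fin n) ℝ}
    (h : IsClusteringNumber M p) : p ≤ n := by
  obtain ⟨r, U, ev, -, rfl⟩ := h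
  rw [← Nat.card_coe_set_eq]
  exact (Finite.card_range_le _).trans (by simp)

theorem IsClusteringNumber.pos {B : Matrix (Fin n) (Fin n) ℝ} {p : ℕ}
    (h : IsClusteringNumber B p) (hn : 0 < n) : 0 < p := by
  obtain ⟨r, U, ev, hU, rfl⟩ := h
  rw [Set.ncard_pos]
  exact ⟨_, ⟨0, hn⟩, rfl⟩

end Real

/-! ### From the subfield K to the real numbers -/

section Transfer

variable {K : Type} [Field K] [LinearOrder K] [IsStrictOrderedRing K] {n : ℕ} {ι : K →+* ℝ}
  {A B : Matrix (Fin n) (Fin n) K}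

theorem isSymm_of_map (hB : (B.map ι).PosSemidef) : B.IsSymm := by
  ext i j
  have := hB.isHermitian.apply i j
  simp only [Matrix.map_apply, star_trivial] at this
  exact ι.injective this

theorem map_cross (σ π : Equiv.Perm (Fin n)) :
    ι (cross A B σ π) = cross (A.map ι) (B.map ι) σ π := by
  simp [cross]

theorem two_mul_cross_le_of_map (hι : StrictMono ι) (hA : (A.map ι).PosSemidef)
    (hB : (B.map ι).PosSemidef) (σ π : Equiv.Perm (Fin n)) :
    2 * cross A B σ π ≤ cross A B σ σ + cross A B π π := by
  rw [← hι.le_iff_le, map_mul, map_add, map_cross, map_cross, map_cross, map_ofNat]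
  exact two_mul_cross_le hA hB σ π

theorem sameRow_iff (hι : StrictMono ι) (hB : (B.map ι).PosSemidef) (i j : Fin n) :
    SameRow n (rowMajor B) i j ↔ B i = B j := by
  rw [SameRow, rowMajor_apply, rowMajor_apply, rowMajor_apply]
  constructor
  · intro h
    rw [← hι.le_iff_le, map_add, map_add] at h
    have := row_eq_of_le hB (i := i) (j := j) h
    funext y
    exact ι.injective (congrFun this y)
  · intro h
    have hs := (isSymm_of_map hB).apply i j
    have h1 : B i i = B j i := congrFun h i
    have h2 : B j j = B i j := (congrFun h j).symm
    rw [h1, h2, hs]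

theorem map_objPerm (π : Equiv.Perm (Fin n)) :
    ι (objPerm n (rowMajor A) (rowMajor B) π) = frobDist (A.map ι) (B.map ι) π ^ 2 := by
  rw [objPerm_rowMajor, frobDist_sq]
  simp

/-- Rows that are linearly independent over K remain so over an extension field. -/
theorem rank_le_rank_map (A : Matrix (Fin n) (Fin n) K) (ι : K →+* ℝ) :
    Module.finrank K (Submodule.span K (Set.range fun i => A i)) ≤ (A.map ι).rank := by
  let _ : Algebra K ℝ := ι.toAlgebra
  obtain ⟨f, hf, -, hli⟩ := Submodule.exists_fun_fin_finrank_span_eq K (Set.range fun i => A i)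
  have hli' := linearIndependent_algebraMap_comp_iff (S := ℝ).2 hli
  rw [Matrix.rank_eq_finrank_span_row]
  have hcard := finrank_span_eq_card hli'
  rw [Fintype.card_fin] at hcard
  rw [← hcard]
  refine Submodule.finrank_mono (Submodule.span_mono ?_)
  rintro _ ⟨m, rfl⟩
  obtain ⟨i, hi⟩ := hf m
  exact ⟨i, funext fun y => congrArg ι (congrFun hi y)⟩

/-- The extended rows lie in the sum of the row space of A, padded with zeros, and the span of two
unit vectors. -/
theorem rk_extRows_le (A : Matrix (Fin n) (Fin n) K) (ι : K →+* ℝ) :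
    rk n (n + 2) (extRows n (rowMajor A)) ≤ (A.map ι).rank + 2 := by
  set E : (Fin n → K) →ₗ[K] (Fin (n + 2) → K) :=
    { toFun := fun f y => if h : (y : ℕ) < n then f ⟨y, h⟩ else 0
      map_add' := fun f g => by funext y; by_cases h : (y : ℕ) < n <;> simp [h]
      map_smul' := fun a f => by funext y; by_cases h : (y : ℕ) < n <;> simp [h] } with hE
  set V := Submodule.span K (Set.range fun i => A i) with hV
  set e : Fin (n + 2) → K := fun y => if (y : ℕ) = n then 1 else 0 with he
  set e' : Fin (n + 2) → K := fun y => if (y : ℕ) = n + 1 then 1 else 0 with he'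
  set W := Submodule.span K ((({e, e'} : Finset (Fin (n + 2) → K)) : Set (Fin (n + 2) → K)))
    with hW
  have hle : Submodule.span K (Set.range fun (j : Fin n) (y : Fin (n + 2)) =>
      extRows n (rowMajor A) j y) ≤ V.map E ⊔ W := by
    rw [Submodule.span_le]
    rintro _ ⟨j, rfl⟩
    refine Submodule.mem_sup.2 ⟨E (A j), Submodule.mem_map_of_mem (Submodule.subset_span ⟨j, rfl⟩),
      e + ((j : ℕ) : K) • e', W.add_mem (Submodule.subset_span (by simp))
        (W.smul_mem _ (Submodule.subset_span (by simp))), ?_⟩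
    funext y
    have hy := y.2
    by_cases h1 : (y : ℕ) < n
    · have h2 : (y : ℕ) ≠ n := by omega
      have h3 : (y : ℕ) ≠ n + 1 := by omega
      have := rowMajor_apply A j ⟨y, h1⟩
      simp only at this
      simp [hE, he, he', extRows, h1, h2, h3, this]
    · by_cases h2 : (y : ℕ) = n
      · simp [hE, he, he', extRows, h2]
      · have h3 : (y : ℕ) = n + 1 := by omega
        simp [hE, he, he', extRows, h3]
  have h1 := Submodule.finrank_mono hle
  have h2 := Submodule.finrank_add_le_finrank_add_finrank (V.map E) W
  have h3 := Submodule.finrank_map_le E V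
  have h4 : Module.finrank K W ≤ 2 := (finrank_span_finset_le_card _).trans Finset.card_le_two
  have h5 : Module.finrank K V ≤ (A.map ι).rank := rank_le_rank_map A ι
  exact h1.trans (h2.trans (Nat.add_le_add (h3.trans h5) h4))

theorem repCount_eq {p : ℕ} (hι : StrictMono ι) (hB : (B.map ι).PosSemidef)
    (hp : IsClusteringNumber (B.map ι) p) {cl : ℕ → ℕ} (hcl : IsRep n (rowMajor B) cl) :
    repCount n cl = p := by
  obtain ⟨r, U, ev, hU, rfl⟩ := hp
  have hiff : ∀ i j : Fin n, U i = U j ↔ SameRow n (rowMajor B) i j := by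
    intro i j
    rw [hU.row_eq_iff, sameRow_iff hι hB]
    refine ⟨fun h => funext fun y => ι.injective (congrFun h y), fun h => funext fun y => ?_⟩
    simp only [Matrix.map_apply]
    rw [h]
  set G : ℕ → Fin r → ℝ := fun c => if h : c < n then U ⟨c, h⟩ else 0 with hG
  set C := (Finset.range n).filter fun i => cl i = i with hC
  have hle : ∀ i j : Fin n, U i = U j → cl i ≤ cl j := by
    intro i j hij
    refine (hcl j j.2).2.2 (cl i) (hcl i i.2).1 ?_
    refine (hiff j ⟨cl i, (hcl i i.2).1⟩).1 (hij.symm.trans ?_)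
    exact (hiff i ⟨cl i, (hcl i i.2).1⟩).2 (hcl i i.2).2.1
  have hrange : (Set.range fun i : Fin n => U i) = G '' (C : Set ℕ) := by
    ext x
    constructor
    · rintro ⟨i, rfl⟩
      have h1 := (hcl i i.2).1
      have h2 : U i = U ⟨cl i, h1⟩ := (hiff i ⟨cl i, h1⟩).2 (hcl i i.2).2.1
      refine ⟨cl i, ?_, ?_⟩
      · simp only [hC, Finset.coe_filter, Finset.mem_range, Set.mem_ofPred_eq]
        exact ⟨h1, le_antisymm (hle ⟨cl i, h1⟩ i h2.symm) (hle i ⟨cl i, h1⟩ h2)⟩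
      · simp only [hG, h1, dif_pos, h2]
    · rintro ⟨c, hc, rfl⟩
      have hc' : c < n := Finset.mem_range.1 (Finset.mem_filter.1 hc).1
      exact ⟨⟨c, hc'⟩, by simp only [hG, hc', dif_pos]⟩
  have hinj : Set.InjOn G (C : Set ℕ) := by
    intro a ha b hb hab
    obtain ⟨ha1, ha2⟩ := Finset.mem_filter.1 ha
    obtain ⟨hb1, hb2⟩ := Finset.mem_filter.1 hb
    rw [Finset.mem_range] at ha1 hb1
    simp only [hG, ha1, hb1, dif_pos] at hab
    rw [← ha2, ← hb2]
    exact le_antisymm (hle ⟨a, ha1⟩ ⟨b, hb1⟩ hab) (hle ⟨b, hb1⟩ ⟨a, ha1⟩ hab.symm)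
  rw [hrange, hinj.ncard_image, Set.ncard_coe_finset]
  rfl

end Transfer

/-! ### The running time -/

theorem baseOf_le {n L : ℕ} (hL : 1 ≤ L) (hn : n ≤ L) : baseOf n ≤ 6 * L ^ 4 := by
  rw [baseOf]
  calc n * n * n * (n + 2) * 2 ≤ L * L * L * (3 * L) * 2 := by gcongr; omega
    _ = 6 * L ^ 4 := by ring

/-- The factor 25 = 5² pays for the growth of the entries per instruction, since the exponent of 5
in `growth_le` is at most twice the number of instructions. -/
theorem baseOf_add_one_le {n : ℕ} (hn : 2 ≤ n) : (baseOf n + 1) * 25 ≤ n ^ 12 := by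
  have h1 : baseOf n + 1 ≤ 5 * n ^ 4 := by
    obtain ⟨m, rfl⟩ := Nat.exists_eq_add_of_le hn
    rw [baseOf]
    ring_nf
    nlinarith [Nat.zero_le (m ^ 2), Nat.zero_le (m ^ 3), Nat.zero_le (m ^ 4)]
  calc (baseOf n + 1) * 25 ≤ 5 * n ^ 4 * 25 := Nat.mul_le_mul_right _ h1
    _ = 125 * n ^ 4 := by ring
    _ ≤ 2 ^ 8 * n ^ 4 := by gcongr; norm_num
    _ ≤ n ^ 8 * n ^ 4 := by gcongr
    _ = n ^ 12 := by ring

/-- The number of candidates times the growth factor of the entries, in terms of the parameters. -/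
theorem growth_le {n k p r L : ℕ} (hL : 1 ≤ L) (hnL : n ≤ L) (hrn : r ≤ n) (hrk : r ≤ k + 2)
    (hpn : p ≤ n) (hp : 0 < n → 0 < p) (hk : k = 0 → p ≤ 1) :
    (baseOf n + 1) ^ (r * p * p) * 5 ^ (r * p * p + r) ≤
      175 * n ^ (36 * k * p ^ 2) * L ^ 24 := by
  have hL' : 1 ≤ L ^ 24 := Nat.one_le_pow _ _ hL
  rcases Nat.lt_or_ge n 2 with h2 | h2
  · interval_cases n
    -- Here 0 ^ 0 = 1 is needed: for n = 0 also p = 0, so the exponent of n vanishes.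
    · obtain rfl : r = 0 := by omega
      obtain rfl : p = 0 := by omega
      simp
      omega
    -- For n = 1 the power of n is 1, and the constant 175 = 7 * 25 must cover the left side.
    · have hM : r * p * p ≤ 1 * 1 * 1 := by gcongr
      calc (baseOf 1 + 1) ^ (r * p * p) * 5 ^ (r * p * p + r)
          ≤ (baseOf 1 + 1) ^ 1 * 5 ^ (1 + 1) := by gcongr <;> omega
        _ = 175 * 1 ^ (36 * k * p ^ 2) * 1 := by simp [baseOf]
        _ ≤ _ := Nat.mul_le_mul_left _ hL'
  · have hp1 : 1 ≤ p := hp (by omega)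
    have hrM : r ≤ r * p * p := by
      calc r = r * 1 * 1 := by ring
        _ ≤ r * p * p := by gcongr
    -- For k ≥ 1 use k + 2 ≤ 3k. For k = 0 there is only one cluster, so r * p * p ≤ 2, and the
    -- remaining n ^ 24 is absorbed by the input size.
    have hM : 12 * (r * p * p) ≤ 36 * k * p ^ 2 + 24 := by
      have h3 : r * p * p ≤ (k + 2) * p * p := by gcongr
      rcases Nat.eq_zero_or_pos k with h0 | h0
      · have := hk h0
        obtain rfl : p = 1 := by omega
        subst h0
        omega
      · have h4 : (k + 2) * p * p ≤ 3 * k * p * p := by gcongr; omega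
        calc 12 * (r * p * p) ≤ 12 * (3 * k * p * p) := Nat.mul_le_mul_left _ (h3.trans h4)
          _ = 36 * k * p ^ 2 := by ring
          _ ≤ _ := Nat.le_add_right _ _
    calc (baseOf n + 1) ^ (r * p * p) * 5 ^ (r * p * p + r)
        ≤ (baseOf n + 1) ^ (r * p * p) * 5 ^ (2 * (r * p * p)) := by
          gcongr
          · norm_num
          · omega
      _ = ((baseOf n + 1) * 25) ^ (r * p * p) := by
          rw [mul_pow, pow_mul 5 2]; norm_num
      _ ≤ (n ^ 12) ^ (r * p * p) := Nat.pow_le_pow_left (baseOf_add_one_le h2) _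
      _ = n ^ (12 * (r * p * p)) := (pow_mul _ _ _).symm
      _ ≤ n ^ (36 * k * p ^ 2 + 24) := Nat.pow_le_pow_right (by omega) hM
      _ = 1 * n ^ (36 * k * p ^ 2) * n ^ 24 := by rw [pow_add, one_mul]
      _ ≤ 175 * n ^ (36 * k * p ^ 2) * L ^ 24 := by gcongr; norm_num

/-! ### The size of the input -/

section Input

variable {K : Type} [Field K] {n : ℕ}

theorem le_inputSize (w : K → ℕ) (A B : Matrix (Fin n) (Fin n) K) :
    1 + 2 * (n * n) ≤ inputSize w A B := by
  have h (M : Matrix (Fin n) (Fin n) K) : n * n ≤ ∑ i, ∑ j, (1 + w (M i j)) := by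
    calc n * n = ∑ _i : Fin n, ∑ _j : Fin n, 1 := by simp
      _ ≤ _ := Finset.sum_le_sum fun i _ => Finset.sum_le_sum fun j _ => Nat.le_add_right _ _
  have h1 := h A
  have h2 := h B
  rw [inputSize]
  omega

theorem entry_le_sum (w : K → ℕ) (M : Matrix (Fin n) (Fin n) K) (i j : Fin n) :
    w (M i j) ≤ ∑ i, ∑ j, (1 + w (M i j)) :=
  calc w (M i j) ≤ 1 + w (M i j) := Nat.le_add_left _ _
    _ ≤ ∑ j, (1 + w (M i j)) :=
      Finset.single_le_sum (f := fun j => 1 + w (M i j)) (fun _ _ => Nat.zero_le _)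
        (Finset.mem_univ j)
    _ ≤ _ :=
      Finset.single_le_sum (f := fun i => ∑ j, (1 + w (M i j))) (fun _ _ => Nat.zero_le _)
        (Finset.mem_univ i)

theorem IsHeight.zero_le_one {w h : K → ℕ} (hh : IsHeight w h) : h 0 ≤ 1 := by
  simpa using hh.natCast_le 0

theorem IsHeight.rowMajor_le {w h : K → ℕ} (hh : IsHeight w h) (M : Matrix (Fin n) (Fin n) K)
    (a : ℕ) : h (rowMajor M a) ≤ ∑ i, ∑ j, (1 + w (M i j)) + 1 := by
  rw [rowMajor]
  split_ifs with ha
  · exact ((hh.le_size _).trans (entry_le_sum w M _ _)).trans (Nat.le_succ _)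
  · exact hh.zero_le_one.trans (Nat.le_add_left _ _)

end Input

/-! ### Correctness and cost of the algorithm -/

section Main

variable {K : Type} [Field K] [LinearOrder K] [IsStrictOrderedRing K] {ι : K →+* ℝ} {w h : K → ℕ}

theorem HoldsOptimum.holdsSolution {n : ℕ} {A B : Matrix (Fin n) (Fin n) K} {s : Store K}
    (hι : StrictMono ι) (hs : HoldsOptimum n (rowMajor A) (rowMajor B) s) :
    HoldsSolution ι A B s := by
  obtain ⟨π, h1, h2, h3⟩ := hs
  refine ⟨π, h1, fun σ => ?_, by rw [h2, map_objPerm]⟩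
  have := hι.monotone (h3 σ)
  rw [map_objPerm, map_objPerm] at this
  exact (pow_le_pow_iff_left₀ (frobDist_nonneg _ _ _) (frobDist_nonneg _ _ _) two_ne_zero).1 this

theorem solvesPSDWithin (hι : StrictMono ι) (hh : IsHeight w h) :
    SolvesPSDWithin ι w solveP fun n k p L =>
      solveP.weight * (960 * 175 ^ 2) * n ^ (72 * k * p ^ 2) * L ^ 60 := by
  intro n k p A B hA hB hkA hkB hp
  set L := inputSize w A B with hL
  have hnL := le_inputSize w A B
  have hAL (a : ℕ) : h (rowMajor A a) ≤ L := by
    have := hh.rowMajor_le A a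
    rw [hL, inputSize]
    omega
  have hBL (a : ℕ) : h (rowMajor B a) ≤ L := by
    have := hh.rowMajor_le B a
    rw [hL, inputSize]
    omega
  rw [← hL] at hnL
  clear_value L
  have hL1 : 1 ≤ L := by omega
  have hn : n ≤ L := by nlinarith
  set r := rk n (n + 2) (extRows n (rowMajor A)) with hr
  have hrn : r ≤ n := rk_le _ _ _
  have hrk : r ≤ k + 2 := (rk_extRows_le A ι).trans (by omega)
  have hcount {cl : ℕ → ℕ} (hcl : IsRep n (rowMajor B) cl) : repCount n cl = p :=
    repCount_eq hι hB hp hcl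
  have hgood : ∀ cl, IsRep n (rowMajor B) cl → ∃ g < baseOf n ^ (r * p * p),
      GoodCandidate n (r * p * p) (rowMajor A) (rowMajor B) cl g := by
    intro cl hcl
    have := exists_goodCandidate (A := A) (isSymm_of_map hB) (two_mul_cross_le_of_map hι hA hB)
      (sameRow_iff hι hB) hcl
    rwa [hcount hcl] at this
  have hpn : p ≤ n := hp.le
  have hG := growth_le hL1 hn hrn hrk hpn hp.pos fun hk => hp.le_one (by omega)
  set M := r * p * p with hM
  have hML : M ≤ L ^ 3 := by
    calc M ≤ L * L * L := by rw [hM]; gcongr <;> omega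
      _ = L ^ 3 := by ring
  have hN : n * (n + 2) ≤ 3 * L ^ 2 := by
    calc n * (n + 2) ≤ L * (3 * L) := by gcongr; omega
      _ = 3 * L ^ 2 := by ring
  have hbL := baseOf_le hL1 hn
  set b := baseOf n with hb
  set E := 5 ^ (M + r) with hE
  set D := (b + 1) ^ M with hD
  have hE1 : 1 ≤ E := Nat.one_le_pow _ _ (by norm_num)
  have hD1 : 1 ≤ D := Nat.one_le_pow _ _ (by omega)
  have le5 (m : ℕ) (hm : m ≤ 5) : L ^ m ≤ L ^ 5 := Nat.pow_le_pow_right hL1 hm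
  have hL5 : L ≤ L ^ 5 := by simpa using le5 1
  have h15 : 1 ≤ L ^ 5 := Nat.one_le_pow _ _ hL1
  have hLL : L ≤ L ^ 2 := by nlinarith
  -- D bounds the number of candidates and E the growth of heights in the pivots. The polynomial
  -- factors cover addresses, the base of the encoding, and the height of the objective.
  set c : Bounds K := ⟨w, h, D * (6 * L ^ 5), E * (8 * L ^ 2)⟩ with hc
  have hX {m : ℕ} (hm : m ≤ 6 * L ^ 5) : m ≤ c.X :=
    hm.trans (Nat.le_mul_of_pos_left _ hD1)
  have hF {m : ℕ} (hm : m ≤ 8 * L ^ 2) : m ≤ c.F :=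
    hm.trans (Nat.le_mul_of_pos_left _ hE1)
  have hh0 := hh.zero_le_one
  have hBdd : Bdd c (inputStore A B) := by
    refine ⟨fun x => ?_, fun _ _ => Nat.zero_le _, fun _ => hF (by change h 0 ≤ _; omega),
      fun m a => hF ?_⟩
    · refine hX ?_
      change (if x = 0 then n else 0) ≤ _
      split_ifs <;> omega
    · change h (if m = 0 then rowMajor A a else if m = 1 then rowMajor B a else 0) ≤ _
      have h1 := hAL a
      have h2 := hBL a
      split_ifs <;> omega
  have hext : ∀ j < n, ∀ y < n + 2, h (extRows n (rowMajor A) j y) ≤ 2 * L := by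
    intro j hj y hy
    rw [extRows]
    split_ifs
    · have := hAL (j * n + y)
      omega
    · have := hh.natCast_le 1
      simp only [Nat.cast_one, Nat.size_one] at this
      omega
    · have h1 := hh.natCast_le j
      have h2 := size_le_self j
      omega
  have hMN : M * (n * (n + 2)) ≤ 3 * L ^ 5 := by
    calc M * (n * (n + 2)) ≤ L ^ 3 * (3 * L ^ 2) := Nat.mul_le_mul hML hN
      _ = 3 * L ^ 5 := by ring
  have hrN : r * (n * (n + 2)) ≤ 3 * L ^ 3 := by
    calc r * (n * (n + 2)) ≤ L * (3 * L ^ 2) := Nat.mul_le_mul (hrn.trans hn) hN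
      _ = 3 * L ^ 3 := by ring
  have l2 := le5 2 (by norm_num)
  have l3 := le5 3 (by norm_num)
  have l4 := le5 4 (by norm_num)
  have hFE {m : ℕ} (hm : m ≤ M + r) : 5 ^ m * (2 * L) ≤ c.F :=
    Nat.mul_le_mul (Nat.pow_le_pow_right (by norm_num) hm) (by omega)
  have hXb : ∀ t ≤ M, b ^ t ≤ c.X := fun t ht =>
    calc b ^ t ≤ (b + 1) ^ t := Nat.pow_le_pow_left (Nat.le_succ _) _
      _ ≤ D := Nat.pow_le_pow_right (Nat.succ_pos _) ht
      _ ≤ c.X := Nat.le_mul_of_pos_right _ (by omega)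
  obtain ⟨t, s, hex, ht, -, hs⟩ := solve_spec (c := c) (s := inputStore A B) (n := n)
    (A := rowMajor A) (B := rowMajor B) (f := 2 * L) (k := r) (p := p) hh hBdd rfl rfl rfl rfl rfl
    rfl (by omega) rfl (fun cl hcl => hcount hcl) hext (fun a => (hAL a).trans (by omega))
    (fun a => (hBL a).trans (by omega)) (hF (by omega)) (hFE (by omega)) (hFE (by omega))
    (hF (by nlinarith)) (hF (by omega)) (hX (by omega)) (hX (by omega))
    hXb (hX (by omega)) (hX (by omega)) (hX (hMN.trans (by omega))) (hX (by omega))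
    (hX (by omega)) hgood
  refine ⟨t, s, hex, ht.trans ?_, hs.holdsSolution hι⟩
  have hDG : b ^ M + 1 ≤ 2 * (D * E) := by
    have h1 : b ^ M ≤ D := Nat.pow_le_pow_left (Nat.le_succ _) _
    have h2 : D ≤ D * E := Nat.le_mul_of_pos_right _ hE1
    omega
  have hU : c.U ≤ 15 * (D * E) * L ^ 5 := by
    have h1 : D * (6 * L ^ 5) ≤ D * E * (6 * L ^ 5) := by
      gcongr
      exact Nat.le_mul_of_pos_right _ hE1
    have h2 : E * (8 * L ^ 2) ≤ D * E * (8 * L ^ 5) := by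
      gcongr
      exact Nat.le_mul_of_pos_left _ hD1
    have h3 : 1 * 1 * 1 ≤ D * E * L ^ 5 := by gcongr
    calc c.U = D * (6 * L ^ 5) + E * (8 * L ^ 2) + 1 := rfl
      _ ≤ D * E * (6 * L ^ 5) + D * E * (8 * L ^ 5) + D * E * L ^ 5 := by omega
      _ = 15 * (D * E) * L ^ 5 := by ring
  have hL2 : 1 ≤ L ^ 2 := Nat.one_le_pow _ _ hL1
  have hL3 : 1 ≤ L ^ 3 := Nat.one_le_pow _ _ hL1
  have hM1 : M + 1 ≤ 2 * L ^ 3 := by omega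
  have hN1 : n * (n + 2) + 1 ≤ 4 * L ^ 2 := by omega
  calc solveP.weight * ((b ^ M + 1) * ((M + 1) * ((n * (n + 2) + 1) *
        ((n * (n + 2) + 1) * c.U))))
      ≤ solveP.weight * ((2 * (D * E)) * ((2 * L ^ 3) * ((4 * L ^ 2) * ((4 * L ^ 2) *
        (15 * (D * E) * L ^ 5))))) := by gcongr
    -- The square arises because D * E bounds, up to polynomial factors, both the number of
    -- iterations of the search and the cost unit.
    _ = solveP.weight * 960 * L ^ 12 * (D * E) ^ 2 := by ring
    _ ≤ solveP.weight * 960 * L ^ 12 * (175 * n ^ (36 * k * p ^ 2) * L ^ 24) ^ 2 := by gcongr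
    _ = _ := by
      dsimp only
      rw [mul_pow, mul_pow, ← pow_mul, ← pow_mul,
        show 72 * k * p ^ 2 = 36 * k * p ^ 2 * 2 by ring]
      ring

end Main

end MatSim

/-- One algorithm solves the problem in `n ^ O(k p²)` times a polynomial in the size of the input,
both over the rational numbers with every operation charged by the bit length of its operands and
results, and over the real numbers with field operations at unit cost. -/
theorem theorem4p1 :
    ∃ (P : MatSim.Prog) (C c d : ℕ),
      MatSim.SolvesPSDWithin (Rat.castHom ℝ) MatSim.ratBits P
        (fun n k p L => C * n ^ (c * k * p ^ 2) * L ^ d) ∧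
      MatSim.SolvesPSDWithin (RingHom.id ℝ) (fun _ => 0) P
        (fun n k p L => C * n ^ (c * k * p ^ 2) * L ^ d) :=
  ⟨_, _, _, _, MatSim.solvesPSDWithin Rat.cast_strictMono MatSim.isHeight_ratBits,
    MatSim.solvesPSDWithin strictMono_id MatSim.isHeight_zero⟩
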